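/- For a function $s$ and a parameter $\gamma\in\mathbb C$ put $$f(q,p;\alpha)=\frac{s(q+p+\alpha)\,s(q-p+\alpha)}{s(q+p-\alpha)\,s(q-p-\alpha)}$$ and consider, for a field $u(n,t)$ with $u_j=u(n+j,t)$, the lattice equation $$u_{,t}=\frac{1}{f(u,u_2;2\gamma)f(u,u_1;-\gamma)f(u,u_{-1};-\gamma)-1}-\frac{1}{f(u,u_1;-\gamma)f(u,u_{-1};-\gamma)f(u,u_{-2};2\gamma)-1}.\tag{1}$$ Let $\mathcal F$ be the family of lattice equations $$u_{,t}=\frac{H(u_{-1},u)\,H(u,u_1)\,(u_2-u_{-2})}{P(u_{-2},u_{-1},u,u_1)\,P(u_{-1},u,u_1,u_2)}\tag{2}$$ where $P\neq0$ is an affine-linear polynomial (degree at most 1 in each variable) over $\mathbb C$ with the symmetry of a square, $P(u_{-1},u,u_1,u_2)=P(u_2,u_1,u,u_{-1})=P(u_1,u,u_{-1},u_2)$, and $H(u,u_1)=H(u_1,u)$ is a biquadratic polynomial (degree at most 2 in each variable) with $$\mathrm{const}\cdot H(u,u_1)=\partial_{-1}(P)\,\partial_2(P)-\partial_{-1}\partial_2(P)\,P,\qquad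 \mathrm{const}\neq0,\quad \partial_i=\partial/\partial u_i.$$ A point transformation $\tilde u=\varphi(u)$, $\partial_t=c\,\partial_{\tilde t}$ ($c\ne0$) brings one lattice equation to another one if, for all differentiable fields whose values are points where $\varphi$ is regular with $\varphi'\neq0$, wherever the first equation is defined the second one is defined on the transformed field, and the field satisfies the first equation if and only if the transformed field satisfies the second one. The first equation (1) is considered where all denominators of the three-fold products of $f$ and of the right-hand side are nonzero; (2) where both values of $P$ are nonzero. **Theorem.** 1. In each of the following cases equation (1) is brought by the indicated point transformation to an equation (2) of the family $\mathcal F$ with the indicated $H$ and $P$. (a) $s=\sigma$ is the Weierstrass function of a period lattice $\Lambda\subset\mathbb C$ with invariants $g_2,g_3$, $4\gamma\notin\Lambda$; the transformation is $\tilde u=\wp(u)$, $\partial_t=4\wp'(\gamma)^2\wp'(2\gamma)\,\partial_{\tilde t}$, and with $g=\wp(\gamma)$ $$H=\left(uu_1+gu+gu_1+\tfrac{g_2}{4}\right)^2-(u+u_1+g)(4guu_1-g_3),$$ $$\begin{aligned}P={}&(12g^2-g_2)\left(u_{-1}uu_1u_2+\tfrac{g_2^2}{16}\right)-(4g^3+g_2g+2g_3)(u_{-1}uu_1+u_{-1}uu_2+u_{-1}u_1u_2+uu_1u_2-g_3)\\&+2\left(g^4-g_3g-\tfrac{g_2^2}{16}\right)(u_{-1}+u_1)(u+u_2)-g(4g^3-3g_2g-4g_3)(u_{-1}u_1+uu_2)\\&+g\left(g_2g^2+6g_3g+\tfrac{g_2^2}{4}\right)(u_{-1}+u+u_1+u_2).\end{aligned}$$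 (b) $s=\sinh$, $\sinh(4\gamma)\neq0$; the transformation is $\tilde u=\cosh(2u)$, $\partial_t=-\frac{1}{\sinh(4\gamma)}\,\partial_{\tilde t}$, and with $g=e^{2\gamma}$ $$H=(g+g^{-1})(u_1-gu)(gu_1-u)+\tfrac14(1-g^2)^2(1+g^{-2}),$$ $$P=(gu_2-u_{-1})(u_1-gu)+(u_2-gu_1)(gu_{-1}-u)+\tfrac14(1-g^2)^2(1+g^{-2}).$$ (c) $s(x)=x$, $\gamma\neq0$; the transformation is $\tilde u=u^2$, $\partial_t=-\frac{1}{4\gamma}\,\partial_{\tilde t}$, and $$H=(u_1-u)^2-2\gamma^2(u_1+u)+\gamma^4,$$ $$P=\tfrac12(u_2+u)(u_1+u_{-1})-u_2u-u_1u_{-1}-\gamma^2(u_{-1}+u+u_1+u_2)+3\gamma^4.$$ 2. The family $\mathcal F$ is invariant under the Möbius transformations $\tilde u=M(u)=\frac{\kappa u+\lambda}{\mu u+\nu}$, $\kappa\nu-\lambda\mu\neq0$. Namely, for every equation (2) of $\mathcal F$ the transformation $\tilde u=M(u)$, $\tilde t=t$ brings it to the equation (2) of $\mathcal F$ with the polynomials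 $$\prod_{i=1}^4(\kappa-\mu x_i)\;P\big(M^{-1}x_1,\dots,M^{-1}x_4\big),\qquad \prod_{i=1}^2(\kappa-\mu x_i)^2\;H\big(M^{-1}x_1,M^{-1}x_2\big).$$ 3. The polynomials $P$ of case (a) form the generic orbits of this action. Namely, for an affine-linear polynomial $P$ with the symmetry of a square put $h(u,u_1)=\partial_{-1}(P)\partial_2(P)-\partial_{-1}\partial_2(P)P$ and $r(u)=(\partial_1h)^2-2h\,\partial_1^2h$ (the discriminant of $h$ in $u_1$), a binary quartic form in the projective sense. Then $r$ has four distinct zeros on the projective line (a Zariski open condition on $P$) if and only if $P$ is obtained by the above action of some Möbius matrix (including scalings) from the polynomial of case (a) for some lattice $\Lambda$ and some $\gamma$ with $4\gamma\notin\Lambda$. -/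

import Mathlib

noncomputable section

namespace PointEq

open MvPolynomial

/-! ### Second order lattice equations and point transformations -/

/-- A lattice equation `u_{,t} = rhs (u₋₂, u₋₁, u, u₁, u₂)`. The right-hand side is considered only
on the set `dom` of the windows `(u₋₂, u₋₁, u, u₁, u₂)` where it is defined. -/
structure LatticeEquation where
  dom : ℂ → ℂ → ℂ → ℂ → ℂ → Prop
  rhs : ℂ → ℂ → ℂ → ℂ → ℂ → ℂ

/-- The right-hand side of the equation is defined on the field `u` at the site `n` and time `t`
(`u n t` is the value at the site `n`). -/
def LatticeEquation.Admissible (E : LatticeEquation) (u : ℤ → ℂ → ℂ) (n : ℤ) (t : ℂ) : Prop :=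
  E.dom (u (n - 2) t) (u (n - 1) t) (u n t) (u (n + 1) t) (u (n + 2) t)

/-- The field `u` satisfies the equation at the site `n` and time `t`. -/
def LatticeEquation.Holds (E : LatticeEquation) (u : ℤ → ℂ → ℂ) (n : ℤ) (t : ℂ) : Prop :=
  HasDerivAt (u n) (E.rhs (u (n - 2) t) (u (n - 1) t) (u n t) (u (n + 1) t) (u (n + 2) t)) t

/-- The field `ũ` obtained from `u` by the point transformation `ũ = φ(u)`, `t̃ = c t`
(that is, `∂_t = c ∂_{t̃}`). -/
def pointTransform (φ : ℂ → ℂ) (c : ℂ) (u : ℤ → ℂ → ℂ) : ℤ → ℂ → ℂ :=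
  fun n s => φ (u n (s / c))

/-- The point transformation `ũ = φ(u)`, `∂_t = c ∂_{t̃}` brings the equation `E` to `E'`.
Consider any differentiable field whose values are points where `φ` is locally invertible
(`deriv φ ≠ 0`; this excludes the poles of `φ`, since `deriv` vanishes where `φ` is not
differentiable). Wherever `E` is defined on `u`, the equation `E'` is defined on the transformed
field, and `u` satisfies `E` if and only if the transformed field satisfies `E'`. -/
def PointEquivalentVia (φ : ℂ → ℂ) (c : ℂ) (E E' : LatticeEquation) : Prop :=
  c ≠ 0 ∧
  ∀ (u : ℤ → ℂ → ℂ) (n : ℤ) (t : ℂ),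
    (∀ j, DifferentiableAt ℂ (u j) t) → (∀ j, deriv φ (u j t) ≠ 0) → E.Admissible u n t →
      E'.Admissible (pointTransform φ c u) n (c * t) ∧
      (E.Holds u n t ↔ E'.Holds (pointTransform φ c u) n (c * t))

/-! ### The lattice equation attached to an odd function `s` -/

/-- `f(q, p; α) = s(q+p+α) s(q-p+α) / (s(q+p-α) s(q-p-α))`. -/
def factor (s : ℂ → ℂ) (q p α : ℂ) : ℂ :=
  s (q + p + α) * s (q - p + α) / (s (q + p - α) * s (q - p - α))

/-- The denominator of `f(q, p; α)` does not vanish. -/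
def FactorDefined (s : ℂ → ℂ) (q p α : ℂ) : Prop :=
  s (q + p - α) * s (q - p - α) ≠ 0

/-- The lattice equation
`u_{,t} = 1 / (f(u,u₂;2γ) f(u,u₁;-γ) f(u,u₋₁;-γ) - 1)
          - 1 / (f(u,u₁;-γ) f(u,u₋₁;-γ) f(u,u₋₂;2γ) - 1)`. -/
def sigmaLattice (s : ℂ → ℂ) (γ : ℂ) : LatticeEquation where
  dom um2 um1 u u1 u2 :=
    FactorDefined s u u2 (2 * γ) ∧ FactorDefined s u u1 (-γ) ∧ FactorDefined s u um1 (-γ) ∧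
    FactorDefined s u um2 (2 * γ) ∧
    factor s u u2 (2 * γ) * factor s u u1 (-γ) * factor s u um1 (-γ) - 1 ≠ 0 ∧
    factor s u u1 (-γ) * factor s u um1 (-γ) * factor s u um2 (2 * γ) - 1 ≠ 0
  rhs um2 um1 u u1 u2 :=
    1 / (factor s u u2 (2 * γ) * factor s u u1 (-γ) * factor s u um1 (-γ) - 1)
      - 1 / (factor s u u1 (-γ) * factor s u um1 (-γ) * factor s u um2 (2 * γ) - 1)

/-- The Weierstrass function
`σ(z) = z ∏_{l ≠ 0} (1 - z/l) exp(z/l + z²/(2l²))` of a period lattice. -/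
def weierstrassSigma (L : PeriodPair) (z : ℂ) : ℂ :=
  z * ∏' l : {l : L.lattice // l ≠ 0},
    ((1 - z / ((l : L.lattice) : ℂ)) *
      Complex.exp (z / ((l : L.lattice) : ℂ) + z ^ 2 / (2 * ((l : L.lattice) : ℂ) ^ 2)))

/-! ### The family of rational lattice equations

The variables `X 0, X 1, X 2, X 3` of `P` stand for `u₋₁, u, u₁, u₂`; the variables `X 0, X 1` of
`H` stand for `u, u₁`. -/

/-- The lattice equation
`u_{,t} = H(u₋₁,u) H(u,u₁) (u₂ - u₋₂) / (P(u₋₂,u₋₁,u,u₁) P(u₋₁,u,u₁,u₂))`. -/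
def rationalLattice (P : MvPolynomial (Fin 4) ℂ) (H : MvPolynomial (Fin 2) ℂ) :
    LatticeEquation where
  dom um2 um1 u u1 u2 := eval ![um2, um1, u, u1] P ≠ 0 ∧ eval ![um1, u, u1, u2] P ≠ 0
  rhs um2 um1 u u1 u2 :=
    eval ![um1, u] H * eval ![u, u1] H * (u2 - um2) /
      (eval ![um2, um1, u, u1] P * eval ![um1, u, u1, u2] P)

/-- Affine-linear polynomial with the symmetry of a square:
`P(u₋₁,u,u₁,u₂) = P(u₂,u₁,u,u₋₁) = P(u₁,u,u₋₁,u₂)`. -/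
def IsSquareAffine (P : MvPolynomial (Fin 4) ℂ) : Prop :=
  (∀ i, P.degreeOf i ≤ 1) ∧
  rename ![3, 2, 1, 0] P = P ∧
  rename ![2, 1, 0, 3] P = P

/-- `∂₋₁(P) ∂₂(P) - ∂₋₁∂₂(P) P`, with `∂₋₁`, `∂₂` the derivatives in `u₋₁`, `u₂`. -/
def edgeForm (P : MvPolynomial (Fin 4) ℂ) : MvPolynomial (Fin 4) ℂ :=
  pderiv 0 P * pderiv 3 P - pderiv 0 (pderiv 3 P) * P

/-- The pairs `(P, H)` of the family: `P ≠ 0` is affine-linear with the symmetry of a square, `H` is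
a symmetric biquadratic polynomial, and
`const · H(u,u₁) = ∂₋₁(P) ∂₂(P) - ∂₋₁∂₂(P) P` with a nonzero constant. -/
def InFamily (P : MvPolynomial (Fin 4) ℂ) (H : MvPolynomial (Fin 2) ℂ) : Prop :=
  P ≠ 0 ∧ IsSquareAffine P ∧
  (∀ i, H.degreeOf i ≤ 2) ∧ rename ![1, 0] H = H ∧
  ∃ k : ℂ, k ≠ 0 ∧ C k * rename ![1, 2] H = edgeForm P

/-! ### The explicit polynomials -/

def ellH (γ g₂ g₃ : ℂ) : MvPolynomial (Fin 2) ℂ :=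
  (X 0 * X 1 + C γ * X 0 + C γ * X 1 + C (g₂ / 4)) ^ 2
    - (X 0 + X 1 + C γ) * (C (4 * γ) * X 0 * X 1 - C g₃)

def ellP (γ g₂ g₃ : ℂ) : MvPolynomial (Fin 4) ℂ :=
  C (12 * γ ^ 2 - g₂) * (X 0 * X 1 * X 2 * X 3 + C (g₂ ^ 2 / 16))
    - C (4 * γ ^ 3 + g₂ * γ + 2 * g₃) *
        (X 0 * X 1 * X 2 + X 0 * X 1 * X 3 + X 0 * X 2 * X 3 + X 1 * X 2 * X 3 - C g₃)
    + C (2 * (γ ^ 4 - g₃ * γ - g₂ ^ 2 / 16)) * (X 0 + X 2) * (X 1 + X 3)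
    - C (γ * (4 * γ ^ 3 - 3 * g₂ * γ - 4 * g₃)) * (X 0 * X 2 + X 1 * X 3)
    + C (γ * (g₂ * γ ^ 2 + 6 * g₃ * γ + g₂ ^ 2 / 4)) * (X 0 + X 1 + X 2 + X 3)

def trigH (γ : ℂ) : MvPolynomial (Fin 2) ℂ :=
  C (γ + γ⁻¹) * (X 1 - C γ * X 0) * (C γ * X 1 - X 0)
    + C (1 / 4 * (1 - γ ^ 2) ^ 2 * (1 + (γ ^ 2)⁻¹))

def trigP (γ : ℂ) : MvPolynomial (Fin 4) ℂ :=
  (C γ * X 3 - X 0) * (X 2 - C γ * X 1) + (X 3 - C γ * X 2) * (C γ * X 0 - X 1)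
    + C (1 / 4 * (1 - γ ^ 2) ^ 2 * (1 + (γ ^ 2)⁻¹))

def ratH (γ : ℂ) : MvPolynomial (Fin 2) ℂ :=
  (X 1 - X 0) ^ 2 - C (2 * γ ^ 2) * (X 1 + X 0) + C (γ ^ 4)

def ratP (γ : ℂ) : MvPolynomial (Fin 4) ℂ :=
  C (1 / 2) * (X 3 + X 1) * (X 2 + X 0) - X 3 * X 1 - X 2 * X 0
    - C (γ ^ 2) * (X 0 + X 1 + X 2 + X 3) + C (3 * γ ^ 4)

/-! ### Möbius transformations -/

/-- The transformation `u ↦ (κ u + l) / (μ u + ν)`. -/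
def moebius (κ l μ ν : ℂ) (u : ℂ) : ℂ := (κ * u + l) / (μ * u + ν)

/-- The action of `u ↦ (κ u + l) / (μ u + ν)` on the polynomials of degree at most `d` in each of
the variables: one substitutes the inverse transformation `x ↦ (ν x - l) / (κ - μ x)` for each
variable and multiplies by the product of `(κ - μ xᵢ) ^ d` over all variables. -/
def moebiusAct {m : ℕ} (d : ℕ) (κ l μ ν : ℂ) (P : MvPolynomial (Fin m) ℂ) :
    MvPolynomial (Fin m) ℂ :=
  ∑ e ∈ P.support, C (P.coeff e) *
    ∏ i, ((C ν * X i - C l) ^ (e i) * (C κ - C μ * X i) ^ (d - e i))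

/-- `27` times the discriminant of the binary quartic form `∑ rᵢ xⁱ y⁴⁻ⁱ`. It is nonzero if and
only if the form has four distinct zeros on the projective line. -/
def quarticDiscr (r : Polynomial ℂ) : ℂ :=
  4 * (12 * r.coeff 4 * r.coeff 0 - 3 * r.coeff 3 * r.coeff 1 + r.coeff 2 ^ 2) ^ 3
    - (72 * r.coeff 4 * r.coeff 2 * r.coeff 0 + 9 * r.coeff 3 * r.coeff 2 * r.coeff 1
        - 27 * r.coeff 4 * r.coeff 1 ^ 2 - 27 * r.coeff 0 * r.coeff 3 ^ 2
        - 2 * r.coeff 2 ^ 3) ^ 2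

/-- The discriminant `r(u) = (∂₁h)² - 2 h ∂₁²h` in `u₁` of the biquadratic
`h(u,u₁) = ∂₋₁(P) ∂₂(P) - ∂₋₁∂₂(P) P`. For affine-linear `P` it depends on `u` only (so that the
other variables may be set to zero) and is of degree at most `4`. -/
def edgeQuartic (P : MvPolynomial (Fin 4) ℂ) : Polynomial ℂ :=
  aeval ![0, Polynomial.X, 0, 0]
    (pderiv 2 (edgeForm P) ^ 2 - 2 * edgeForm P * pderiv 2 (pderiv 2 (edgeForm P)))

/-- `P` is generic: the quartic `r` has four distinct zeros on the projective line. This is the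
condition that a certain polynomial in the coefficients of `P` does not vanish. -/
def IsGeneric (P : MvPolynomial (Fin 4) ℂ) : Prop := quarticDiscr (edgeQuartic P) ≠ 0

end PointEq

end

/-! Part 1. Write `f = N/D`. Both terms of equation (1) are governed by three products: the face
expression `NNN - DDD`, the edge product `N·D` for a neighbour `u_{±1}`, and the cross expression
`DN' - D'N` for `u_{±2}`. If, after the change of variable, these are explicit multiples of `P`, `H`
and `u₂ - u₋₂`, then (1) becomes (2) by pure algebra (`sigmaLattice_window`), and the multipliers
determine the time scaling. For `s = x` and `s = sinh` the three identities are elementary. For `s =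
σ` they rest on `σ(a+b)σ(a-b) = -σ(a)²σ(b)²(℘(a) - ℘(b))` (`weierstrassSigma_add_mul_sub`) and the
addition theorem: the sum, difference and product of the numbers `℘(u±γ) - ℘(γ)` are rational in
`℘(u)` and `℘'(u)`, and the face expression is antisymmetric under exchange of these two numbers
(`face_identity`). The product formula itself is Liouville's theorem applied to a periodic function
whose poles cancel.

Part 2. A polynomial `P` with the symmetry of a square is the symmetric bilinear form, with matrix
rows `(a, b, d)`, `(b, c, e)`, `(d, e, f)`, in the vectors `(x₀x₂, x₀+x₂, 1)` and `(x₁x₃, x₁+x₃,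
1)`. Möbius maps act on these vectors by a symmetric square. The coefficients of the edge form are
the signed 2×2 minors of the matrix, so forming the edge form commutes with the action up to the
square of the determinant.

Part 3. Since `adj(adj M) = det M · M`, the edge form determines `P` up to a scalar when `det M ≠ 0`
(`exists_eq_C_mul_ellP`). The discriminant of the quartic `r` is an invariant, so genericity is
constant on orbits. For a generic `P`, one root of `r` is moved to infinity and the quadratic term
is removed by a translation. The edge form is then a multiple of `ellH` for some `g`, `g₂`, `g₃`
with `g₂³ ≠ 27g₃²`. A lattice with these invariants exists (`exists_periodPair`), `℘` takes the
value `g` at some `γ`, and the nonvanishing leading coefficient of the edge form, a multiple of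
`℘'(γ)³℘'(2γ)`, excludes `4γ ∈ Λ`. -/

noncomputable section

namespace PointEq

open MvPolynomial

/-! ### Affine-linear polynomials with the symmetry of a square and their edge forms -/

/-- The general affine-linear polynomial with the symmetry of a square. -/
def squarePoly (a b c d e f : ℂ) : MvPolynomial (Fin 4) ℂ :=
  C a * (X 0 * X 1 * X 2 * X 3)
    + C b * (X 0 * X 1 * X 2 + X 0 * X 1 * X 3 + X 0 * X 2 * X 3 + X 1 * X 2 * X 3)
    + C c * ((X 0 + X 2) * (X 1 + X 3)) + C d * (X 0 * X 2 + X 1 * X 3)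
    + C e * (X 0 + X 1 + X 2 + X 3) + C f

/-- The general symmetric biquadratic polynomial. -/
def biquadratic (a b c d e f : ℂ) : MvPolynomial (Fin 2) ℂ :=
  C a * (X 0 ^ 2 * X 1 ^ 2) + C b * (X 0 ^ 2 * X 1 + X 0 * X 1 ^ 2) + C c * (X 0 ^ 2 + X 1 ^ 2)
    + C d * (X 0 * X 1) + C e * (X 0 + X 1) + C f

lemma eval_squarePoly (a b c d e f : ℂ) (x : Fin 4 → ℂ) :
    eval x (squarePoly a b c d e f) =
      a * (x 0 * x 1 * x 2 * x 3)
        + b * (x 0 * x 1 * x 2 + x 0 * x 1 * x 3 + x 0 * x 2 * x 3 + x 1 * x 2 * x 3)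
        + c * ((x 0 + x 2) * (x 1 + x 3)) + d * (x 0 * x 2 + x 1 * x 3)
        + e * (x 0 + x 1 + x 2 + x 3) + f := by
  simp [squarePoly]

lemma eval_biquadratic (a b c d e f : ℂ) (x : Fin 2 → ℂ) :
    eval x (biquadratic a b c d e f) =
      a * (x 0 ^ 2 * x 1 ^ 2) + b * (x 0 ^ 2 * x 1 + x 0 * x 1 ^ 2) + c * (x 0 ^ 2 + x 1 ^ 2)
        + d * (x 0 * x 1) + e * (x 0 + x 1) + f := by
  simp [biquadratic]

lemma degreeOf_add_le_of_le {σ : Type*} {i : σ} {p q : MvPolynomial σ ℂ} {m : ℕ}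
    (hp : degreeOf i p ≤ m) (hq : degreeOf i q ≤ m) : degreeOf i (p + q) ≤ m :=
  (degreeOf_add_le _ _ _).trans (max_le hp hq)

lemma degreeOf_C_mul_le_of_le {σ : Type*} {i : σ} {p : MvPolynomial σ ℂ} {m : ℕ} {a : ℂ}
    (hp : degreeOf i p ≤ m) : degreeOf i (C a * p) ≤ m :=
  (degreeOf_C_mul_le _ _ _).trans hp

lemma degreeOf_sub_le_of_le {σ : Type*} {i : σ} {p q : MvPolynomial σ ℂ} {m : ℕ}
    (hp : degreeOf i p ≤ m) (hq : degreeOf i q ≤ m) : degreeOf i (p - q) ≤ m := by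
  rw [sub_eq_add_neg, ← neg_one_mul, ← C_1, ← C_neg]
  exact degreeOf_add_le_of_le hp (degreeOf_C_mul_le_of_le hq)

lemma degreeOf_mul_le_of_le {σ : Type*} {i : σ} {p q : MvPolynomial σ ℂ} {m n : ℕ}
    (hp : degreeOf i p ≤ m) (hq : degreeOf i q ≤ n) : degreeOf i (p * q) ≤ m + n :=
  (degreeOf_mul_le _ _ _).trans (Nat.add_le_add hp hq)

lemma degreeOf_squarePoly (a b c d e f : ℂ) (i : Fin 4) :
    degreeOf i (squarePoly a b c d e f) ≤ 1 := by
  have hX (j : Fin 4) : degreeOf i (X j : MvPolynomial (Fin 4) ℂ) ≤ if i = j then 1 else 0 :=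
    (degreeOf_X i j).le
  have h1 : degreeOf i (X 0 + X 2 : MvPolynomial (Fin 4) ℂ) ≤ if i = 0 ∨ i = 2 then 1 else 0 :=
    degreeOf_add_le_of_le ((hX 0).trans (by grind)) ((hX 2).trans (by grind))
  have h2 : degreeOf i (X 1 + X 3 : MvPolynomial (Fin 4) ℂ) ≤ if i = 1 ∨ i = 3 then 1 else 0 :=
    degreeOf_add_le_of_le ((hX 1).trans (by grind)) ((hX 3).trans (by grind))
  have hXX {j k : Fin 4} (hjk : j ≠ k) :
      degreeOf i (X j * X k : MvPolynomial (Fin 4) ℂ) ≤ if i = j ∨ i = k then 1 else 0 :=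
    (degreeOf_mul_le_of_le (hX j) (hX k)).trans (by grind)
  have hXXX {j k m : Fin 4} (hjk : j ≠ k) (hm : m ≠ j ∧ m ≠ k) :
      degreeOf i (X j * X k * X m : MvPolynomial (Fin 4) ℂ) ≤ 1 :=
    (degreeOf_mul_le_of_le (hXX hjk) (hX m)).trans (by grind)
  have hX1 (j : Fin 4) : degreeOf i (X j : MvPolynomial (Fin 4) ℂ) ≤ 1 := (hX j).trans (by grind)
  have h4 : degreeOf i (X 0 * X 1 * X 2 * X 3 : MvPolynomial (Fin 4) ℂ) ≤ 1 := by
    rw [mul_assoc]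
    exact (degreeOf_mul_le_of_le (hXX (by decide)) (hXX (by decide))).trans (by grind)
  have hXX1 {j k : Fin 4} (hjk : j ≠ k) :
      degreeOf i (X j * X k : MvPolynomial (Fin 4) ℂ) ≤ 1 := (hXX hjk).trans (by grind)
  unfold squarePoly
  refine degreeOf_add_le_of_le (degreeOf_add_le_of_le (degreeOf_add_le_of_le (degreeOf_add_le_of_le
    (degreeOf_add_le_of_le ?_ ?_) ?_) ?_) ?_) (by simp)
  · exact degreeOf_C_mul_le_of_le h4
  · exact degreeOf_C_mul_le_of_le (degreeOf_add_le_of_le (degreeOf_add_le_of_le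
      (degreeOf_add_le_of_le (hXXX (by decide) (by decide)) (hXXX (by decide) (by decide)))
      (hXXX (by decide) (by decide))) (hXXX (by decide) (by decide)))
  · exact degreeOf_C_mul_le_of_le ((degreeOf_mul_le_of_le h1 h2).trans (by grind))
  · exact degreeOf_C_mul_le_of_le
      (degreeOf_add_le_of_le (hXX1 (by decide)) (hXX1 (by decide)))
  · exact degreeOf_C_mul_le_of_le (degreeOf_add_le_of_le (degreeOf_add_le_of_le
      (degreeOf_add_le_of_le (hX1 0) (hX1 1)) (hX1 2)) (hX1 3))

lemma degreeOf_biquadratic (a b c d e f : ℂ) (i : Fin 2) :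
    degreeOf i (biquadratic a b c d e f) ≤ 2 := by
  have hX (j : Fin 2) : degreeOf i (X j : MvPolynomial (Fin 2) ℂ) = if i = j then 1 else 0 :=
    degreeOf_X i j
  have hm := fun p q : MvPolynomial (Fin 2) ℂ => degreeOf_mul_le i p q
  have hp (j : Fin 2) := degreeOf_pow_le i (X j : MvPolynomial (Fin 2) ℂ) 2
  unfold biquadratic
  refine degreeOf_add_le_of_le (degreeOf_add_le_of_le (degreeOf_add_le_of_le (degreeOf_add_le_of_le
    (degreeOf_add_le_of_le ?_ ?_) ?_) ?_) ?_) (by simp)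
  all_goals
    refine degreeOf_C_mul_le_of_le ?_
    repeat' refine degreeOf_add_le_of_le ?_ ?_
    all_goals grind

lemma rename_biquadratic (a b c d e f : ℂ) :
    rename ![1, 0] (biquadratic a b c d e f) = biquadratic a b c d e f := by
  simp [biquadratic]; ring

lemma isSquareAffine_squarePoly (a b c d e f : ℂ) : IsSquareAffine (squarePoly a b c d e f) := by
  refine ⟨degreeOf_squarePoly a b c d e f, ?_, ?_⟩ <;> simp [squarePoly] <;> ring

/-- A polynomial of degree at most 1 in each variable that vanishes on a grid with two values per
variable is zero. -/
lemma eq_of_eval_eq_of_degreeOf_le_one {P Q : MvPolynomial (Fin 4) ℂ}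
    (hP : ∀ i, P.degreeOf i ≤ 1) (hQ : ∀ i, Q.degreeOf i ≤ 1)
    (h : ∀ x : Fin 4 → ℂ, (∀ i, x i = 0 ∨ x i = 1) → eval x P = eval x Q) : P = Q := by
  rw [← sub_eq_zero]
  refine eq_zero_of_eval_zero_at_prod_finset _ (fun _ => {0, 1}) (fun i => ?_) (fun x hx => ?_)
  · have := degreeOf_sub_le_of_le (hP i) (hQ i)
    rw [Finset.card_pair zero_ne_one]
    omega
  · rw [map_sub, sub_eq_zero]
    exact h x (by simpa using hx)

lemma exists_eq_squarePoly {P : MvPolynomial (Fin 4) ℂ} (hP : IsSquareAffine P) :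
    ∃ a b c d e f, P = squarePoly a b c d e f := by
  obtain ⟨h1, h2, h3⟩ := hP
  have s1 (p q r s : ℂ) : eval ![p, q, r, s] P = eval ![s, r, q, p] P := by
    conv_lhs => rw [← h2]
    rw [eval_rename]
    congr 1
    congr 1
    ext i
    fin_cases i <;> rfl
  have s2 (p q r s : ℂ) : eval ![p, q, r, s] P = eval ![r, q, p, s] P := by
    conv_lhs => rw [← h3]
    rw [eval_rename]
    congr 1
    congr 1
    ext i
    fin_cases i <;> rfl
  have s3 (p q r s : ℂ) : eval ![p, q, r, s] P = eval ![p, s, r, q] P := by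
    rw [s1, s2, s1]
  set p0 := eval ![0, 0, 0, 0] P with hp0
  set p1 := eval ![1, 0, 0, 0] P with hp1
  set pe := eval ![1, 1, 0, 0] P with hpe
  set pd := eval ![1, 0, 1, 0] P with hpd
  set p3 := eval ![1, 1, 1, 0] P with hp3
  set p4 := eval ![1, 1, 1, 1] P with hp4
  have e1 : p1 - p0 = p1 - p0 := rfl
  -- The symmetry group has six orbits on the vertices of the cube `{0,1}⁴`; `pe` and `pd` belong to
  -- adjacent and opposite pairs of corners of the square. The coefficients follow by
  -- inclusion-exclusion over the subsets of corners.
  refine ⟨p4 - 4 * p3 + 2 * pd + 4 * pe - 4 * p1 + p0, p3 - pd - 2 * pe + 3 * p1 - p0,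
    pe - 2 * p1 + p0, pd - 2 * p1 + p0, p1 - p0, p0, ?_⟩
  refine eq_of_eval_eq_of_degreeOf_le_one h1 (degreeOf_squarePoly _ _ _ _ _ _) fun x hx => ?_
  have hx' : x = ![x 0, x 1, x 2, x 3] := by ext i; fin_cases i <;> rfl
  have a1 : eval ![0, 1, 0, 0] P = p1 := by rw [s1, s2]
  have a2 : eval ![0, 0, 1, 0] P = p1 := by rw [s2]
  have a3 : eval ![0, 0, 0, 1] P = p1 := by rw [s1]
  have b1 : eval ![0, 1, 1, 0] P = pe := by rw [s2]
  have b2 : eval ![0, 0, 1, 1] P = pe := by rw [s1]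
  have b3 : eval ![1, 0, 0, 1] P = pe := by rw [s3]
  have b4 : eval ![0, 1, 0, 1] P = pd := by rw [s1]
  have c1 : eval ![0, 1, 1, 1] P = p3 := by rw [s1]
  have c2 : eval ![1, 0, 1, 1] P = p3 := by rw [s3]
  have c3 : eval ![1, 1, 0, 1] P = p3 := by rw [s2, c1]
  rw [hx', eval_squarePoly]
  rcases hx 0 with h0 | h0 <;> rcases hx 1 with h1 | h1 <;> rcases hx 2 with h2 | h2 <;>
    rcases hx 3 with h3 | h3 <;> rw [h0, h1, h2, h3] <;>
    simp only [Matrix.cons_val_zero, Matrix.cons_val_one, Matrix.cons_val] <;>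
    (try simp only [a1, a2, a3, b1, b2, b3, b4, c1, c2, c3, ← hp0, ← hp1, ← hpe, ← hpd, ← hp3,
      ← hp4]) <;> ring

/-- The six coefficients are, up to sign, the 2×2 minors of the symmetric matrix with rows `(a, b,
d)`, `(b, c, e)`, `(d, e, f)`. -/
lemma edgeForm_squarePoly (a b c d e f : ℂ) :
    edgeForm (squarePoly a b c d e f) =
      rename ![1, 2] (biquadratic (b ^ 2 - a * c) (b * d - a * e) (c * d - b * e) (d ^ 2 - a * f)
        (e * d - b * f) (e ^ 2 - c * f)) := by
  simp [edgeForm, squarePoly, biquadratic, pderiv_X]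
  ring

lemma squarePoly_ne_zero {a b c d e f : ℂ}
    (h : ∃ x : Fin 4 → ℂ, eval x (squarePoly a b c d e f) ≠ 0) : squarePoly a b c d e f ≠ 0 := by
  obtain ⟨x, hx⟩ := h
  rintro h0
  simp [h0] at hx

lemma rename_edge_injective :
    Function.Injective (rename (R := ℂ) (![1, 2] : Fin 2 → Fin 4)) :=
  rename_injective _ (by decide)

lemma C_mul_biquadratic (k a b c d e f : ℂ) :
    C k * biquadratic a b c d e f =
      biquadratic (k * a) (k * b) (k * c) (k * d) (k * e) (k * f) := by
  simp only [biquadratic, C_mul]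
  ring

lemma inFamily_squarePoly {a b c d e f k : ℂ} (hk : k ≠ 0) (hP : squarePoly a b c d e f ≠ 0)
    {H : MvPolynomial (Fin 2) ℂ}
    (hH : H = biquadratic (k * (b ^ 2 - a * c)) (k * (b * d - a * e)) (k * (c * d - b * e))
      (k * (d ^ 2 - a * f)) (k * (e * d - b * f)) (k * (e ^ 2 - c * f))) :
    InFamily (squarePoly a b c d e f) H := by
  refine ⟨hP, isSquareAffine_squarePoly _ _ _ _ _ _, ?_, ?_, k⁻¹, inv_ne_zero hk, ?_⟩
  · rw [hH]; exact degreeOf_biquadratic _ _ _ _ _ _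
  · rw [hH]; exact rename_biquadratic _ _ _ _ _ _
  · rw [edgeForm_squarePoly, hH, ← C_mul_biquadratic, map_mul, rename_C, ← mul_assoc, ← C_mul,
      inv_mul_cancel₀ hk, C_1, one_mul]

lemma InFamily.exists_coeff {P : MvPolynomial (Fin 4) ℂ} {H : MvPolynomial (Fin 2) ℂ}
    (h : InFamily P H) : ∃ a b c d e f k : ℂ, k ≠ 0 ∧ P = squarePoly a b c d e f ∧
      H = biquadratic (k * (b ^ 2 - a * c)) (k * (b * d - a * e)) (k * (c * d - b * e))
        (k * (d ^ 2 - a * f)) (k * (e * d - b * f)) (k * (e ^ 2 - c * f)) := by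
  obtain ⟨-, hP, -, -, k, hk, hH⟩ := h
  obtain ⟨a, b, c, d, e, f, rfl⟩ := exists_eq_squarePoly hP
  refine ⟨a, b, c, d, e, f, k⁻¹, inv_ne_zero hk, rfl, rename_edge_injective ?_⟩
  rw [← C_mul_biquadratic, map_mul, rename_C, ← edgeForm_squarePoly, ← hH, ← mul_assoc, ← C_mul,
    inv_mul_cancel₀ hk, C_1, one_mul]

/-! ### The action of the Möbius transformations -/

lemma eval_moebiusAct {m d : ℕ} {κ l μ ν : ℂ} {P : MvPolynomial (Fin m) ℂ}
    (hP : ∀ i, P.degreeOf i ≤ d) {x : Fin m → ℂ} (hx : ∀ i, κ - μ * x i ≠ 0) :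
    eval x (moebiusAct d κ l μ ν P) =
      (∏ i, (κ - μ * x i) ^ d) * eval (fun i => (ν * x i - l) / (κ - μ * x i)) P := by
  rw [moebiusAct, map_sum, eval_eq', Finset.mul_sum]
  refine Finset.sum_congr rfl fun s hs => ?_
  simp only [map_mul, eval_C, map_prod, map_pow, map_sub, eval_X]
  rw [mul_left_comm, ← Finset.prod_mul_distrib]
  congr 1
  refine Finset.prod_congr rfl fun i _ => ?_
  have hsi : s i ≤ d := degreeOf_le_iff.1 (hP i) s hs
  rw [div_pow, mul_div_assoc', eq_div_iff (pow_ne_zero _ (hx i)), mul_assoc, ← pow_add,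
    Nat.sub_add_cancel hsi, mul_comm]

/-- After multiplication by the nonzero polynomial `∏ (κ - μ xᵢ)` the two sides agree everywhere,
and this factor can be cancelled. -/
lemma eq_of_eval_eq_of_ne {m : ℕ} {κ μ : ℂ} (h : κ ≠ 0 ∨ μ ≠ 0) {P Q : MvPolynomial (Fin m) ℂ}
    (hPQ : ∀ x : Fin m → ℂ, (∀ i, κ - μ * x i ≠ 0) → eval x P = eval x Q) : P = Q := by
  have hne : (∏ i : Fin m, (C κ - C μ * X i : MvPolynomial (Fin m) ℂ)) ≠ 0 := by
    refine Finset.prod_ne_zero_iff.2 fun i _ h0 => ?_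
    have e0 := congrArg (eval fun _ => 0) h0
    have e1 := congrArg (eval fun _ => 1) h0
    simp at e0 e1
    grind
  refine mul_right_cancel₀ hne (MvPolynomial.funext fun x => ?_)
  by_cases hx : ∀ i, κ - μ * x i ≠ 0
  · rw [map_mul, map_mul, hPQ x hx]
  · push Not at hx
    obtain ⟨i, hi⟩ := hx
    have : eval x (∏ i : Fin m, (C κ - C μ * X i : MvPolynomial (Fin m) ℂ)) = 0 := by
      rw [map_prod]
      exact Finset.prod_eq_zero (Finset.mem_univ i) (by simpa using hi)
    rw [map_mul, map_mul, this, mul_zero, mul_zero]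

lemma ne_zero_or_ne_zero_of_det {κ l μ ν : ℂ} (h : κ * ν - l * μ ≠ 0) : κ ≠ 0 ∨ μ ≠ 0 := by
  by_contra! h0
  simp [h0.1, h0.2] at h

/-- The symmetric bilinear form with the coefficients of a square polynomial. -/
def squareForm (a b c d e f r₁ r₂ r₃ s₁ s₂ s₃ : ℂ) : ℂ :=
  a * r₁ * s₁ + b * (r₁ * s₂ + r₂ * s₁) + c * r₂ * s₂ + d * (r₁ * s₃ + r₃ * s₁)
    + e * (r₂ * s₃ + r₃ * s₂) + f * r₃ * s₃

/-- `P` is a bilinear form in `(x₀x₂, x₀+x₂, 1)` and `(x₁x₃, x₁+x₃, 1)`. The substitution with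
cleared denominators acts linearly on each of these vectors, and the triples of arguments are the
columns of that linear map. -/
lemma moebiusAct_squarePoly {κ l μ ν : ℂ} (h : κ * ν - l * μ ≠ 0) (a b c d e f : ℂ) :
    moebiusAct 1 κ l μ ν (squarePoly a b c d e f) =
      squarePoly
        (squareForm a b c d e f (ν ^ 2) (-2 * ν * μ) (μ ^ 2) (ν ^ 2) (-2 * ν * μ) (μ ^ 2))
        (squareForm a b c d e f (ν ^ 2) (-2 * ν * μ) (μ ^ 2)
          (-ν * l) (ν * κ + l * μ) (-κ * μ))
        (squareForm a b c d e f (-ν * l) (ν * κ + l * μ) (-κ * μ)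
          (-ν * l) (ν * κ + l * μ) (-κ * μ))
        (squareForm a b c d e f (ν ^ 2) (-2 * ν * μ) (μ ^ 2) (l ^ 2) (-2 * l * κ) (κ ^ 2))
        (squareForm a b c d e f (-ν * l) (ν * κ + l * μ) (-κ * μ) (l ^ 2) (-2 * l * κ) (κ ^ 2))
        (squareForm a b c d e f (l ^ 2) (-2 * l * κ) (κ ^ 2) (l ^ 2) (-2 * l * κ) (κ ^ 2)) := by
  refine eq_of_eval_eq_of_ne (ne_zero_or_ne_zero_of_det h) fun x hx => ?_
  rw [eval_moebiusAct (degreeOf_squarePoly _ _ _ _ _ _) hx, eval_squarePoly, eval_squarePoly,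
    Fin.prod_univ_four]
  have h0 := hx 0
  have h1 := hx 1
  have h2 := hx 2
  have h3 := hx 3
  simp only [squareForm, pow_one]
  field_simp
  ring

/-- The same mechanism for the bilinear form in `(x₀², x₀, 1)` and `(x₁², x₁, 1)`. The order `a b d
c e f` is deliberate: here `d` is the middle diagonal entry and `c` the corner one. -/
lemma moebiusAct_biquadratic {κ l μ ν : ℂ} (h : κ * ν - l * μ ≠ 0) (a b c d e f : ℂ) :
    moebiusAct 2 κ l μ ν (biquadratic a b c d e f) =
      biquadratic
        (squareForm a b d c e f (ν ^ 2) (-ν * μ) (μ ^ 2) (ν ^ 2) (-ν * μ) (μ ^ 2))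
        (squareForm a b d c e f (ν ^ 2) (-ν * μ) (μ ^ 2)
          (-2 * ν * l) (ν * κ + l * μ) (-2 * κ * μ))
        (squareForm a b d c e f (ν ^ 2) (-ν * μ) (μ ^ 2) (l ^ 2) (-l * κ) (κ ^ 2))
        (squareForm a b d c e f (-2 * ν * l) (ν * κ + l * μ) (-2 * κ * μ)
          (-2 * ν * l) (ν * κ + l * μ) (-2 * κ * μ))
        (squareForm a b d c e f (-2 * ν * l) (ν * κ + l * μ) (-2 * κ * μ)
          (l ^ 2) (-l * κ) (κ ^ 2))
        (squareForm a b d c e f (l ^ 2) (-l * κ) (κ ^ 2) (l ^ 2) (-l * κ) (κ ^ 2)) := by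
  refine eq_of_eval_eq_of_ne (ne_zero_or_ne_zero_of_det h) fun x hx => ?_
  rw [eval_moebiusAct (degreeOf_biquadratic _ _ _ _ _ _) hx, eval_biquadratic, eval_biquadratic,
    Fin.prod_univ_two]
  have h0 := hx 0
  have h1 := hx 1
  simp only [squareForm]
  field_simp
  ring

end PointEq
end

noncomputable section

namespace PointEq

open MvPolynomial

/-! ### Point equivalences -/

/-- By the chain rule the equivalence reduces to a pointwise identity between the right-hand sides.
The converse direction uses uniqueness of the derivative and cancels `φ' ≠ 0`. -/
lemma pointEquivalentVia_of_window {φ : ℂ → ℂ} {c : ℂ} {E E' : LatticeEquation} (hc : c ≠ 0)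
    (h : ∀ a₀ a₁ a₂ a₃ a₄ : ℂ, deriv φ a₀ ≠ 0 → deriv φ a₁ ≠ 0 → deriv φ a₂ ≠ 0 →
      deriv φ a₃ ≠ 0 → deriv φ a₄ ≠ 0 → E.dom a₀ a₁ a₂ a₃ a₄ →
      E'.dom (φ a₀) (φ a₁) (φ a₂) (φ a₃) (φ a₄) ∧
        c * E'.rhs (φ a₀) (φ a₁) (φ a₂) (φ a₃) (φ a₄) = deriv φ a₂ * E.rhs a₀ a₁ a₂ a₃ a₄) :
    PointEquivalentVia φ c E E' := by
  refine ⟨hc, fun u n t hu hφ hE => ?_⟩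
  obtain ⟨h1, h2⟩ := h _ _ _ _ _ (hφ (n - 2)) (hφ (n - 1)) (hφ n) (hφ (n + 1)) (hφ (n + 2)) hE
  have ht : c * t / c = t := mul_div_cancel_left₀ t hc
  have hval (j : ℤ) : pointTransform φ c u j (c * t) = φ (u j t) := by
    simp only [pointTransform, ht]
  refine ⟨by simpa only [LatticeEquation.Admissible, hval] using h1, ?_⟩
  have hφd : HasDerivAt φ (deriv φ (u n t)) (u n t) :=
    (differentiableAt_of_deriv_ne_zero (hφ n)).hasDerivAt
  have hlin : HasDerivAt (fun s : ℂ => s / c) (1 / c) (c * t) := (hasDerivAt_id _).div_const c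
  have hcomp {d : ℂ} (hd : HasDerivAt (u n) d t) :
      HasDerivAt (pointTransform φ c u n) (deriv φ (u n t) * (d * (1 / c))) (c * t) := by
    have h3 : HasDerivAt (fun s : ℂ => u n (s / c)) (d * (1 / c)) (c * t) := by
      refine HasDerivAt.comp (c * t) (h₂ := u n) ?_ hlin
      rwa [ht]
    refine HasDerivAt.comp (c * t) (h₂ := φ) ?_ h3
    rwa [ht]
  simp only [LatticeEquation.Holds, hval]
  constructor
  · intro hd
    convert hcomp hd using 1
    rw [← mul_assoc, ← h2]
    field_simp
  · intro hd
    have h4 := hcomp (hu n).hasDerivAt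
    have h5 := h4.unique hd
    have h6 : deriv (u n) t =
        E.rhs (u (n - 2) t) (u (n - 1) t) (u n t) (u (n + 1) t) (u (n + 2) t) := by
      refine mul_left_cancel₀ (hφ n) ?_
      rw [← h2, ← h5]
      field_simp
    rw [← h6]
    exact (hu n).hasDerivAt

lemma eval_window (P : MvPolynomial (Fin 4) ℂ) {κ l μ ν : ℂ}
    (hP : ∀ i, P.degreeOf i ≤ 1) (h : κ * ν - l * μ ≠ 0) {x₀ x₁ x₂ x₃ : ℂ}
    (h₀ : μ * x₀ + ν ≠ 0) (h₁ : μ * x₁ + ν ≠ 0) (h₂ : μ * x₂ + ν ≠ 0) (h₃ : μ * x₃ + ν ≠ 0) :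
    eval ![moebius κ l μ ν x₀, moebius κ l μ ν x₁, moebius κ l μ ν x₂, moebius κ l μ ν x₃]
      (moebiusAct 1 κ l μ ν P) =
    (κ * ν - l * μ) ^ 4 / ((μ * x₀ + ν) * (μ * x₁ + ν) * (μ * x₂ + ν) * (μ * x₃ + ν)) *
      eval ![x₀, x₁, x₂, x₃] P := by
  have key {x : ℂ} (hx : μ * x + ν ≠ 0) :
      κ - μ * moebius κ l μ ν x = (κ * ν - l * μ) / (μ * x + ν) := by
    rw [moebius]; field_simp; ring
  have key2 {x : ℂ} (hx : μ * x + ν ≠ 0) :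
      (ν * moebius κ l μ ν x - l) / (κ - μ * moebius κ l μ ν x) = x := by
    have hm : moebius κ l μ ν x * (μ * x + ν) = κ * x + l := div_mul_cancel₀ _ hx
    rw [div_eq_iff (by rw [key hx]; exact div_ne_zero h hx)]
    linear_combination hm
  rw [eval_moebiusAct hP]
  · rw [Fin.prod_univ_four]
    congr 1
    · simp only [pow_one, Matrix.cons_val_zero, Matrix.cons_val_one, Matrix.cons_val, key h₀,
        key h₁, key h₂, key h₃]
      field_simp
    · congr 2
      ext i
      fin_cases i <;> simp [key2 h₀, key2 h₁, key2 h₂, key2 h₃]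
  · intro i
    fin_cases i <;> simp [key h₀, key h₁, key h₂, key h₃, h, h₀, h₁, h₂, h₃]

lemma eval_edge (H : MvPolynomial (Fin 2) ℂ) {κ l μ ν : ℂ}
    (hH : ∀ i, H.degreeOf i ≤ 2) (h : κ * ν - l * μ ≠ 0) {x₀ x₁ : ℂ}
    (h₀ : μ * x₀ + ν ≠ 0) (h₁ : μ * x₁ + ν ≠ 0) :
    eval ![moebius κ l μ ν x₀, moebius κ l μ ν x₁] (moebiusAct 2 κ l μ ν H) =
    (κ * ν - l * μ) ^ 4 / ((μ * x₀ + ν) ^ 2 * (μ * x₁ + ν) ^ 2) * eval ![x₀, x₁] H := by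
  have key {x : ℂ} (hx : μ * x + ν ≠ 0) :
      κ - μ * moebius κ l μ ν x = (κ * ν - l * μ) / (μ * x + ν) := by
    rw [moebius]; field_simp; ring
  have key2 {x : ℂ} (hx : μ * x + ν ≠ 0) :
      (ν * moebius κ l μ ν x - l) / (κ - μ * moebius κ l μ ν x) = x := by
    have hm : moebius κ l μ ν x * (μ * x + ν) = κ * x + l := div_mul_cancel₀ _ hx
    rw [div_eq_iff (by rw [key hx]; exact div_ne_zero h hx)]
    linear_combination hm
  rw [eval_moebiusAct hH]
  · rw [Fin.prod_univ_two]
    congr 1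
    · simp only [Matrix.cons_val_zero, Matrix.cons_val_one, key h₀, key h₁]
      field_simp
    · congr 2
      ext i
      fin_cases i <;> simp [key2 h₀, key2 h₁]
  · intro i
    fin_cases i <;> simp [key h₀, key h₁, h, h₀, h₁]

lemma hasDerivAt_moebius {κ l μ ν x : ℂ} (hx : μ * x + ν ≠ 0) :
    HasDerivAt (moebius κ l μ ν) ((κ * ν - l * μ) / (μ * x + ν) ^ 2) x := by
  have h1 : HasDerivAt (fun x => κ * x + l) κ x := by
    simpa using ((hasDerivAt_id x).const_mul κ).add_const l
  have h2 : HasDerivAt (fun x => μ * x + ν) μ x := by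
    simpa using ((hasDerivAt_id x).const_mul μ).add_const ν
  exact (h1.div h2 hx).congr_deriv (by ring)

/-- Division by zero gives the pole a finite value, but continuity there would force `κ x + l = 0`
together with `μ x + ν = 0`, against the determinant. So the condition `deriv ≠ 0` on a field
excludes the pole. -/
lemma deriv_moebius_pole {κ l μ ν x : ℂ} (h : κ * ν - l * μ ≠ 0) (hx : μ * x + ν = 0) :
    deriv (moebius κ l μ ν) x = 0 := by
  by_contra hne
  have hd := (differentiableAt_of_deriv_ne_zero hne).continuousAt
  have hμ : μ ≠ 0 := by
    rintro rfl
    simp at hx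
    simp [hx] at h
  have h1 : Filter.Tendsto (fun y => moebius κ l μ ν y * (μ * y + ν)) (nhdsWithin x {x}ᶜ)
      (nhds (moebius κ l μ ν x * (μ * x + ν))) :=
    ((hd.mul (by fun_prop)).tendsto).mono_left nhdsWithin_le_nhds
  have h2 : Filter.Tendsto (fun y => κ * y + l) (nhdsWithin x {x}ᶜ) (nhds (κ * x + l)) :=
    (Continuous.tendsto (by fun_prop) x).mono_left nhdsWithin_le_nhds
  have h3 : (fun y => moebius κ l μ ν y * (μ * y + ν)) =ᶠ[nhdsWithin x {x}ᶜ]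
      fun y => κ * y + l := by
    filter_upwards [self_mem_nhdsWithin] with y hy
    have : μ * y + ν ≠ 0 := by
      intro h0
      apply hy
      have : μ * (y - x) = 0 := by linear_combination h0 - hx
      simpa [hμ, sub_eq_zero] using this
    rw [moebius, div_mul_cancel₀ _ this]
  have h4 := tendsto_nhds_unique (h1.congr' h3) h2
  rw [hx, mul_zero] at h4
  apply h
  linear_combination κ * hx + μ * h4

lemma inFamily_moebiusAct {P : MvPolynomial (Fin 4) ℂ} {H : MvPolynomial (Fin 2) ℂ}
    (hPH : InFamily P H) {κ l μ ν : ℂ} (h : κ * ν - l * μ ≠ 0) :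
    InFamily (moebiusAct 1 κ l μ ν P) (moebiusAct 2 κ l μ ν H) := by
  have hne : moebiusAct 1 κ l μ ν P ≠ 0 := by
    intro h0
    refine hPH.1 (eq_of_eval_eq_of_ne (κ := ν) (μ := -μ) (by by_contra! h1; simp_all) ?_)
    intro x hx
    replace hx (i : Fin 4) : μ * x i + ν ≠ 0 := by
      rw [add_comm]; simpa using hx i
    have e := eval_window P hPH.2.1.1 h (hx 0) (hx 1) (hx 2) (hx 3)
    have hx' : ![x 0, x 1, x 2, x 3] = x := by ext i; fin_cases i <;> rfl
    rw [h0, map_zero, hx', eq_comm, mul_eq_zero, div_eq_zero_iff] at e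
    simpa [h, hx] using e
  obtain ⟨a, b, c, d, e, f, k, hk, rfl, rfl⟩ := hPH.exists_coeff
  rw [moebiusAct_squarePoly h] at hne ⊢
  -- The edge form of the transformed `P` is the transformed edge form times the square of the
  -- determinant, which the constant has to absorb.
  refine inFamily_squarePoly (k := k / (κ * ν - l * μ) ^ 2) (div_ne_zero hk (pow_ne_zero 2 h)) hne ?_
  rw [moebiusAct_biquadratic h]
  congr 1 <;> rw [div_mul_eq_mul_div, eq_div_iff (pow_ne_zero 2 h)] <;>
    simp only [squareForm] <;> ring

theorem pointEquivalentVia_moebius {P : MvPolynomial (Fin 4) ℂ} {H : MvPolynomial (Fin 2) ℂ}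
    (hPH : InFamily P H) {κ l μ ν : ℂ} (h : κ * ν - l * μ ≠ 0) :
    PointEquivalentVia (moebius κ l μ ν) 1 (rationalLattice P H)
      (rationalLattice (moebiusAct 1 κ l μ ν P) (moebiusAct 2 κ l μ ν H)) := by
  refine pointEquivalentVia_of_window one_ne_zero fun x₀ x₁ x₂ x₃ x₄ h₀ h₁ h₂ h₃ h₄ hdom => ?_
  replace h₀ : μ * x₀ + ν ≠ 0 := fun h' => h₀ (deriv_moebius_pole h h')
  replace h₁ : μ * x₁ + ν ≠ 0 := fun h' => h₁ (deriv_moebius_pole h h')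
  replace h₂ : μ * x₂ + ν ≠ 0 := fun h' => h₂ (deriv_moebius_pole h h')
  replace h₃ : μ * x₃ + ν ≠ 0 := fun h' => h₃ (deriv_moebius_pole h h')
  replace h₄ : μ * x₄ + ν ≠ 0 := fun h' => h₄ (deriv_moebius_pole h h')
  obtain ⟨hd₁, hd₂⟩ := hdom
  simp only [rationalLattice]
  rw [eval_window P hPH.2.1.1 h h₀ h₁ h₂ h₃, eval_window P hPH.2.1.1 h h₁ h₂ h₃ h₄,
    eval_edge H hPH.2.2.1 h h₁ h₂, eval_edge H hPH.2.2.1 h h₂ h₃, (hasDerivAt_moebius h₂).deriv]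
  refine ⟨⟨?_, ?_⟩, ?_⟩
  · simp [h, h₀, h₁, h₂, h₃, hd₁]
  · simp [h, h₁, h₂, h₃, h₄, hd₂]
  · have e : moebius κ l μ ν x₄ - moebius κ l μ ν x₀ =
        (κ * ν - l * μ) * (x₄ - x₀) / ((μ * x₄ + ν) * (μ * x₀ + ν)) := by
      rw [moebius, moebius, div_sub_div _ _ h₄ h₀]
      congr 1
      ring
    rw [e]
    field_simp

end PointEq
end

noncomputable section

namespace PointEq

open MvPolynomial

/-! ### The lattice equation of a function `s` as a rational lattice equation -/

/-- The numerator of `factor`. -/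
def factorNum (s : ℂ → ℂ) (q p α : ℂ) : ℂ := s (q + p + α) * s (q - p + α)

/-- The denominator of `factor`. -/
def factorDen (s : ℂ → ℂ) (q p α : ℂ) : ℂ := s (q + p - α) * s (q - p - α)

/-- Over a common denominator, the difference of the two fractions has a numerator in which the pure
products of denominators cancel. What remains is the two edge products times the cross expression.
The same reduction serves all three choices of `s`, and `hc` is the balance of the scalar factors.
-/
lemma sigmaLattice_window {s : ℂ → ℂ} {γ x₀ x₁ x₂ x₃ x₄ c δ k₁ k₂ j₁ j₂ i H₁ H₂ P₁ P₂ z : ℂ}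
    (hdom : (sigmaLattice s γ).dom x₀ x₁ x₂ x₃ x₄)
    (h₂ : factorNum s x₂ x₄ (2 * γ) * factorNum s x₂ x₃ (-γ) * factorNum s x₂ x₁ (-γ) -
      factorDen s x₂ x₄ (2 * γ) * factorDen s x₂ x₃ (-γ) * factorDen s x₂ x₁ (-γ) = k₂ * P₂)
    (h₁ : factorNum s x₂ x₀ (2 * γ) * factorNum s x₂ x₃ (-γ) * factorNum s x₂ x₁ (-γ) -
      factorDen s x₂ x₀ (2 * γ) * factorDen s x₂ x₃ (-γ) * factorDen s x₂ x₁ (-γ) = k₁ * P₁)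
    (hj₂ : factorNum s x₂ x₃ (-γ) * factorDen s x₂ x₃ (-γ) = j₂ * H₂)
    (hj₁ : factorNum s x₂ x₁ (-γ) * factorDen s x₂ x₁ (-γ) = j₁ * H₁)
    (hi : factorDen s x₂ x₄ (2 * γ) * factorNum s x₂ x₀ (2 * γ) -
      factorDen s x₂ x₀ (2 * γ) * factorNum s x₂ x₄ (2 * γ) = i * z)
    (hc : c * (k₁ * k₂) = δ * (j₁ * j₂ * i)) :
    (P₁ ≠ 0 ∧ P₂ ≠ 0) ∧
      c * (H₁ * H₂ * z / (P₁ * P₂)) = δ * (sigmaLattice s γ).rhs x₀ x₁ x₂ x₃ x₄ := by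
  have hf (q p α : ℂ) : factor s q p α = factorNum s q p α / factorDen s q p α := rfl
  have hfd (q p α : ℂ) : FactorDefined s q p α ↔ factorDen s q p α ≠ 0 := Iff.rfl
  simp only [sigmaLattice, hf, hfd] at hdom ⊢
  obtain ⟨d₂, d₃, d₁, d₀, hd₂, hd₁⟩ := hdom
  generalize factorNum s x₂ x₄ (2 * γ) = n at *
  generalize factorDen s x₂ x₄ (2 * γ) = d at *
  generalize factorNum s x₂ x₀ (2 * γ) = n' at *
  generalize factorDen s x₂ x₀ (2 * γ) = d' at *
  generalize factorNum s x₂ x₃ (-γ) = m at *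
  generalize factorDen s x₂ x₃ (-γ) = e at *
  generalize factorNum s x₂ x₁ (-γ) = m' at *
  generalize factorDen s x₂ x₁ (-γ) = e' at *
  have e₂ : n / d * (m / e) * (m' / e') - 1 = k₂ * P₂ / (d * e * e') := by
    rw [← h₂]; field_simp
  have e₁ : m / e * (m' / e') * (n' / d') - 1 = k₁ * P₁ / (d' * e * e') := by
    rw [← h₁]; field_simp
  rw [e₂] at hd₂ ⊢
  rw [e₁] at hd₁ ⊢
  have hP₁ : k₁ * P₁ ≠ 0 := fun h => hd₁ (by rw [h, zero_div])
  have hP₂ : k₂ * P₂ ≠ 0 := fun h => hd₂ (by rw [h, zero_div])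
  have hk₁ := left_ne_zero_of_mul hP₁
  have hk₂ := left_ne_zero_of_mul hP₂
  have hp₁ := right_ne_zero_of_mul hP₁
  have hp₂ := right_ne_zero_of_mul hP₂
  refine ⟨⟨hp₁, hp₂⟩, ?_⟩
  have key : (d * e * e') * (k₁ * P₁) - (d' * e * e') * (k₂ * P₂) =
      (j₁ * H₁) * (j₂ * H₂) * (i * z) := by
    rw [← h₁, ← h₂, ← hi, ← hj₁, ← hj₂]; ring
  have e₃ : 1 / (k₂ * P₂ / (d * e * e')) - 1 / (k₁ * P₁ / (d' * e * e')) =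
      (j₁ * H₁) * (j₂ * H₂) * (i * z) / ((k₁ * k₂) * (P₁ * P₂)) := by
    rw [← key]; field_simp
  rw [e₃, mul_div_assoc', mul_div_assoc', div_eq_div_iff (by positivity) (by positivity)]
  linear_combination (H₁ * H₂ * z * (P₁ * P₂)) * hc

/-! ### The rational case -/

lemma ratP_eq (γ : ℂ) : ratP γ =
    squarePoly 0 0 (1 / 2) (-1) (-γ ^ 2) (3 * γ ^ 4) := by
  simp only [ratP, squarePoly, C_neg, C_0, C_1]
  ring

lemma ratH_eq (γ : ℂ) : ratH γ =
    biquadratic 0 0 1 (-2) (-2 * γ ^ 2) (γ ^ 4) := by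
  simp only [ratH, biquadratic, C_neg, C_0, C_1, C_mul, map_ofNat]
  ring

lemma inFamily_rat (γ : ℂ) : InFamily (ratP γ) (ratH γ) := by
  rw [ratP_eq, ratH_eq]
  refine inFamily_squarePoly (k := -2) (by norm_num) (squarePoly_ne_zero ?_) ?_
  · by_contra! h
    have h₀ := h 0
    have h₁ := h ![1, 0, 1, 0]
    have h₂ := h ![-1, 0, -1, 0]
    simp only [eval_squarePoly, Pi.zero_apply, Matrix.cons_val] at h₀ h₁ h₂
    have : (-2 : ℂ) = 0 := by linear_combination h₁ + h₂ - 2 * h₀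
    norm_num at this
  · congr 1 <;> ring

theorem pointEquivalentVia_rat {γ : ℂ} (hγ : γ ≠ 0) :
    PointEquivalentVia (fun u => u ^ 2) (-1 / (4 * γ)) (sigmaLattice (fun x => x) γ)
      (rationalLattice (ratP γ) (ratH γ)) := by
  have hd (x : ℂ) : deriv (fun u : ℂ => u ^ 2) x = 2 * x := by simp
  refine pointEquivalentVia_of_window (div_ne_zero (by norm_num) (by simpa using hγ))
    fun x₀ x₁ x₂ x₃ x₄ h₀ h₁ h₂ h₃ h₄ hdom => ?_
  rw [hd]
  simp only [rationalLattice, ratP_eq, ratH_eq, eval_squarePoly, eval_biquadratic]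
  refine sigmaLattice_window hdom (k₁ := -8 * x₂ * γ) (k₂ := -8 * x₂ * γ) (j₁ := 1) (j₂ := 1)
    (i := -8 * x₂ * γ) ?_ ?_ ?_ ?_ ?_ ?_
  all_goals try simp only [factorNum, factorDen, Matrix.cons_val]
  · ring
  · ring
  · ring
  · ring
  · ring
  · field_simp; ring

/-! ### The trigonometric case -/

lemma trigP_eq (g : ℂ) : trigP g =
    squarePoly 0 0 g (-1 - g ^ 2) 0 (1 / 4 * (1 - g ^ 2) ^ 2 * (1 + (g ^ 2)⁻¹)) := by
  simp only [trigP, squarePoly, C_0, C_sub, C_neg, C_pow, C_1]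
  ring

lemma trigH_eq {g : ℂ} (hg : g ≠ 0) : trigH g =
    biquadratic 0 0 (g ^ 2 + 1) (-(g + g⁻¹) * (1 + g ^ 2)) 0
      (1 / 4 * (1 - g ^ 2) ^ 2 * (1 + (g ^ 2)⁻¹)) := by
  have h1 : (C g⁻¹ * C g : MvPolynomial (Fin 2) ℂ) = 1 := by
    rw [← C_mul, inv_mul_cancel₀ hg, C_1]
  simp only [trigH, biquadratic, C_0, C_neg, C_pow, C_1, C_add, C_mul]
  linear_combination (X 0 ^ 2 + X 1 ^ 2) * h1

lemma inFamily_trig {g : ℂ} (hg : g ≠ 0) : InFamily (trigP g) (trigH g) := by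
  rw [trigP_eq, trigH_eq hg]
  refine inFamily_squarePoly (k := -1 / g) (by simpa using hg) (squarePoly_ne_zero ?_) ?_
  · by_contra! h
    have h₀ := h 0
    have h₁ := h ![1, 1, 0, 0]
    simp only [eval_squarePoly, Pi.zero_apply, Matrix.cons_val] at h₀ h₁
    exact hg (by linear_combination h₁ - h₀)
  · congr 1 <;> field_simp <;> ring

lemma sinh_add_mul_sinh_sub (a p : ℂ) :
    Complex.sinh (a + p) * Complex.sinh (a - p) =
      (Complex.cosh (2 * a) - Complex.cosh (2 * p)) / 2 := by
  have h1 := Complex.cosh_add (a + p) (a - p)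
  have h2 := Complex.cosh_sub (a + p) (a - p)
  rw [show a + p + (a - p) = 2 * a by ring] at h1
  rw [show a + p - (a - p) = 2 * p by ring] at h2
  rw [h1, h2]; ring

theorem pointEquivalentVia_trig {γ : ℂ} (hγ : Complex.sinh (4 * γ) ≠ 0) :
    PointEquivalentVia (fun u => Complex.cosh (2 * u)) (-1 / Complex.sinh (4 * γ))
      (sigmaLattice Complex.sinh γ)
      (rationalLattice (trigP (Complex.exp (2 * γ))) (trigH (Complex.exp (2 * γ)))) := by
  have hd (x : ℂ) : deriv (fun u : ℂ => Complex.cosh (2 * u)) x = 2 * Complex.sinh (2 * x) := by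
    have h1 : HasDerivAt (fun u : ℂ => 2 * u) 2 x := by simpa using (hasDerivAt_id x).const_mul 2
    rw [h1.ccosh.deriv, mul_comm]
  refine pointEquivalentVia_of_window (div_ne_zero (by norm_num) hγ)
    fun x₀ x₁ x₂ x₃ x₄ h₀ h₁ h₂ h₃ h₄ hdom => ?_
  rw [hd]
  have hg := Complex.exp_ne_zero (2 * γ)
  simp only [rationalLattice, trigP_eq, trigH_eq hg, eval_squarePoly, eval_biquadratic]
  have hn (q p α : ℂ) : factorNum Complex.sinh q p α =
      (Complex.cosh (2 * q) * Complex.cosh (2 * α) + Complex.sinh (2 * q) * Complex.sinh (2 * α)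
        - Complex.cosh (2 * p)) / 2 := by
    rw [factorNum, show q + p + α = q + α + p by ring, show q - p + α = q + α - p by ring,
      sinh_add_mul_sinh_sub, mul_add, Complex.cosh_add]
  have hdn (q p α : ℂ) : factorDen Complex.sinh q p α =
      (Complex.cosh (2 * q) * Complex.cosh (2 * α) - Complex.sinh (2 * q) * Complex.sinh (2 * α)
        - Complex.cosh (2 * p)) / 2 := by
    rw [factorDen, show q + p - α = q - α + p by ring, show q - p - α = q - α - p by ring,
      sinh_add_mul_sinh_sub, mul_sub, Complex.cosh_sub]
  have c2 : Complex.cosh (2 * γ) = (Complex.exp (2 * γ) + (Complex.exp (2 * γ))⁻¹) / 2 := by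
    rw [Complex.cosh, Complex.exp_neg]
  have s2 : Complex.sinh (2 * γ) = (Complex.exp (2 * γ) - (Complex.exp (2 * γ))⁻¹) / 2 := by
    rw [Complex.sinh, Complex.exp_neg]
  have c4 : Complex.cosh (2 * (2 * γ)) =
      (Complex.exp (2 * γ) ^ 2 + (Complex.exp (2 * γ) ^ 2)⁻¹) / 2 := by
    rw [Complex.cosh, Complex.exp_neg, two_mul (2 * γ), Complex.exp_add, sq]
  have s4 : Complex.sinh (4 * γ) =
      (Complex.exp (2 * γ) ^ 2 - (Complex.exp (2 * γ) ^ 2)⁻¹) / 2 := by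
    rw [show 4 * γ = 2 * γ + 2 * γ by ring, Complex.sinh, Complex.exp_neg, Complex.exp_add, sq]
  have s4' : Complex.sinh (2 * (2 * γ)) =
      (Complex.exp (2 * γ) ^ 2 - (Complex.exp (2 * γ) ^ 2)⁻¹) / 2 := by
    rw [← s4]; congr 1; ring
  have hY : Complex.sinh (2 * x₂) ^ 2 = Complex.cosh (2 * x₂) ^ 2 - 1 := by
    rw [Complex.cosh_sq]; ring
  have hs : Complex.exp (2 * γ) ^ 4 - 1 ≠ 0 := by
    intro h
    apply hγ
    rw [s4]
    field_simp
    linear_combination h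
  have hs' : Complex.exp (2 * γ) ^ 2 + 1 ≠ 0 := by
    intro h
    apply hs
    linear_combination (Complex.exp (2 * γ) ^ 2 - 1) * h
  -- In the variables `cosh(2x)` each product `s(a+p)s(a-p)` is linear in `cosh(2p)`. The face and
  -- cross expressions are odd in `sinh(2x₂)`, which accounts for that factor in `k₁`, `k₂` and `i`.
  refine sigmaLattice_window hdom
    (k₁ := -(Complex.exp (2 * γ) ^ 2 - 1) / (8 * Complex.exp (2 * γ) ^ 2) * Complex.sinh (2 * x₂))
    (k₂ := -(Complex.exp (2 * γ) ^ 2 - 1) / (8 * Complex.exp (2 * γ) ^ 2) * Complex.sinh (2 * x₂))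
    (j₁ := 1 / (4 * (Complex.exp (2 * γ) ^ 2 + 1))) (j₂ := 1 / (4 * (Complex.exp (2 * γ) ^ 2 + 1)))
    (i := -(1 / 2) * Complex.sinh (2 * x₂) * Complex.sinh (4 * γ)) ?_ ?_ ?_ ?_ ?_ ?_
  all_goals simp only [hn, hdn, Matrix.cons_val, mul_neg, Complex.cosh_neg, Complex.sinh_neg,
    c2, s2, c4, s4, s4']
  all_goals
    generalize Complex.exp (2 * γ) = g at *
    generalize Complex.sinh (2 * x₂) = Y at *
    generalize Complex.cosh (2 * x₂) = X at *
    generalize Complex.cosh (2 * x₀) = x at *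
    generalize Complex.cosh (2 * x₁) = y at *
    generalize Complex.cosh (2 * x₃) = z at *
    generalize Complex.cosh (2 * x₄) = w at *
  -- The coefficient is the cubic term in `Y = sinh(2x₂)` of the face expression, with one factor
  -- `Y²` left to be replaced by `X² - 1`.
  · linear_combination (norm := (field_simp; ring))
      ((g ^ 2 - (g ^ 2)⁻¹) / 2 * ((g - g⁻¹) / 2) ^ 2 / 4 * Y) * hY
  · linear_combination (norm := (field_simp; ring))
      ((g ^ 2 - (g ^ 2)⁻¹) / 2 * ((g - g⁻¹) / 2) ^ 2 / 4 * Y) * hY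
  · field_simp
    ring_nf
    rw [hY]
    ring
  · field_simp
    ring_nf
    rw [hY]
    ring
  · field_simp
    ring
  · have : g ^ 4 - 1 = (g ^ 2 - 1) * (g ^ 2 + 1) := by ring
    field_simp
    ring

end PointEq
end

noncomputable section

namespace PointEq

open Filter Topology
open scoped Topology

/-! ### The Weierstrass sigma function -/

variable (L : PeriodPair)

/-- The factor of the product for the sigma function at the lattice point `l`. -/
def sigmaTerm (l z : ℂ) : ℂ := (1 - z / l) * Complex.exp (z / l + z ^ 2 / (2 * l ^ 2))

/-- The product for `σ(z) / z`. -/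
def sigmaProd (z : ℂ) : ℂ := ∏' l : {l : L.lattice // l ≠ 0}, sigmaTerm ((l : L.lattice) : ℂ) z

lemma weierstrassSigma_eq (z : ℂ) : weierstrassSigma L z = z * sigmaProd L z := rfl

/-- The exponential cancels the first two Taylor terms of `log(1 - w)`, leaving a cubic remainder.
The cubic order matters because `∑ ‖l‖⁻³` converges over a lattice of rank 2. -/
lemma norm_elementary_factor_sub_one_le {w : ℂ} (hw : ‖w‖ ≤ 1 / 2) :
    ‖(1 - w) * Complex.exp (w + w ^ 2 / 2) - 1‖ ≤ 2 * ‖w‖ ^ 3 := by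
  have h1 : ‖-w‖ < 1 := by rw [norm_neg]; linarith
  have h2 := Complex.norm_log_sub_logTaylor_le 2 h1
  have h3 : Complex.logTaylor (2 + 1) (-w) = -w - w ^ 2 / 2 := by
    simp [Complex.logTaylor, Finset.sum_range_succ]
    ring
  have hne : 1 - w ≠ 0 := by
    intro h
    have : w = 1 := by linear_combination -h
    norm_num [this] at hw
  have h4 : (1 - w) * Complex.exp (w + w ^ 2 / 2) =
      Complex.exp (Complex.log (1 + -w) - Complex.logTaylor (2 + 1) (-w)) := by
    rw [h3, show Complex.log (1 + -w) - (-w - w ^ 2 / 2) =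
      Complex.log (1 - w) + (w + w ^ 2 / 2) by ring_nf, Complex.exp_add (Complex.log _),
      Complex.exp_log hne]
  have h5 : (1 - ‖w‖)⁻¹ ≤ 2 := by
    rw [inv_le_comm₀ (by linarith) (by norm_num)]
    linarith
  have h6 : ‖Complex.log (1 + -w) - Complex.logTaylor (2 + 1) (-w)‖ ≤ ‖w‖ ^ 3 := by
    refine h2.trans ?_
    rw [norm_neg]
    norm_num
    rw [div_le_iff₀ (by norm_num)]
    have : 0 ≤ ‖w‖ ^ 3 := by positivity
    nlinarith
  rw [h4]
  have h7 : ‖w‖ ^ 3 ≤ 1 := pow_le_one₀ (norm_nonneg _) (by linarith)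
  exact (Complex.norm_exp_sub_one_le (h6.trans h7)).trans (by linarith)

lemma norm_sigmaTerm_sub_one_le {l z : ℂ} {r : ℝ} (hz : ‖z‖ ≤ r) (hl : 2 * r ≤ ‖l‖)
    (hr : 0 < r) : ‖sigmaTerm l z - 1‖ ≤ 2 * r ^ 3 * ‖l‖ ^ (-3 : ℝ) := by
  have hl0 : 0 < ‖l‖ := by linarith
  have hw : ‖z / l‖ ≤ 1 / 2 := by
    rw [norm_div, div_le_iff₀ hl0]; linarith
  have := norm_elementary_factor_sub_one_le hw
  have e : (z / l) ^ 2 / 2 = z ^ 2 / (2 * l ^ 2) := by rw [div_pow, div_div, mul_comm]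
  rw [e] at this
  refine this.trans ?_
  rw [norm_div, div_pow, Real.rpow_neg hl0.le, mul_assoc, div_eq_mul_inv]
  norm_cast
  gcongr

lemma summable_lattice_norm_rpow :
    Summable fun l : {l : L.lattice // l ≠ 0} => ‖((l : L.lattice) : ℂ)‖ ^ (-3 : ℝ) := by
  have := ZLattice.summable_norm_rpow L.lattice (-3) (by simp; norm_num)
  exact this.comp_injective Subtype.val_injective

lemma eventually_lattice_norm_ge (r : ℝ) :
    ∀ᶠ l : {l : L.lattice // l ≠ 0} in cofinite, r ≤ ‖((l : L.lattice) : ℂ)‖ := by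
  have h : {l : L.lattice | ‖(l : ℂ)‖ < r}.Finite := by
    refine (isCompact_iff_finite.mp (isCompact_closedBall (0 : L.lattice) r)).subset ?_
    intro l hl
    simpa using (show ‖(l : ℂ)‖ < r from hl).le
  rw [eventually_cofinite]
  refine (h.preimage (f := Subtype.val) Subtype.val_injective.injOn).subset ?_
  intro l hl
  simpa using hl

lemma differentiable_sigmaTerm (l : ℂ) : Differentiable ℂ (sigmaTerm l) := by
  unfold sigmaTerm
  fun_prop

lemma hasProdLocallyUniformlyOn_sigmaTerm :
    HasProdLocallyUniformlyOn (fun (l : {l : L.lattice // l ≠ 0}) z => sigmaTerm (l : L.lattice) z)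
      (sigmaProd L) Set.univ := by
  refine hasProdLocallyUniformlyOn_of_forall_compact isOpen_univ fun K _ hK => ?_
  obtain ⟨r, hr⟩ := hK.isBounded.exists_norm_le
  have hr' : ∀ x ∈ K, ‖x‖ ≤ max r 1 := fun x hx => (hr x hx).trans (le_max_left _ _)
  have hr0 : 0 < max r 1 := lt_max_of_lt_right one_pos
  have := Summable.hasProdUniformlyOn_one_add (K := K)
    (f := fun (l : {l : L.lattice // l ≠ 0}) z => sigmaTerm (l : L.lattice) z - 1) hK
    ((summable_lattice_norm_rpow L).mul_left (2 * (max r 1) ^ 3)) (by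
      filter_upwards [eventually_lattice_norm_ge L (2 * max r 1)] with l hl x hx
      exact norm_sigmaTerm_sub_one_le (hr' x hx) hl hr0)
    (fun l => ((differentiable_sigmaTerm _).continuous.sub continuous_const).continuousOn)
  simp only [add_sub_cancel] at this
  exact this

lemma tendstoLocallyUniformlyOn_sigmaProd :
    TendstoLocallyUniformlyOn
      (fun (s : Finset {l : L.lattice // l ≠ 0}) z => ∏ l ∈ s, sigmaTerm (l : L.lattice) z)
      (sigmaProd L) atTop Set.univ :=
  hasProdLocallyUniformlyOn_sigmaTerm L

lemma differentiable_finset_prod_sigmaTerm (s : Finset {l : L.lattice // l ≠ 0}) :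
    Differentiable ℂ fun z => ∏ l ∈ s, sigmaTerm (l : L.lattice) z :=
  Differentiable.fun_finsetProd fun _ _ => differentiable_sigmaTerm _

lemma differentiable_sigmaProd : Differentiable ℂ (sigmaProd L) := by
  rw [← differentiableOn_univ]
  exact (tendstoLocallyUniformlyOn_sigmaProd L).differentiableOn
    (.of_forall fun s => (differentiable_finset_prod_sigmaTerm L s).differentiableOn) isOpen_univ

lemma differentiable_weierstrassSigma : Differentiable ℂ (weierstrassSigma L) :=
  differentiable_id.mul (differentiable_sigmaProd L)

lemma sigmaTerm_ne_zero {l z : ℂ} (hl : l ≠ 0) (h : z ≠ l) : sigmaTerm l z ≠ 0 := by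
  refine mul_ne_zero (fun h0 => h ?_) (Complex.exp_ne_zero _)
  field_simp at h0
  linear_combination -h0

/-- An absolutely convergent infinite product vanishes only if one of its factors does. -/
lemma sigmaProd_ne_zero {z : ℂ} (hz : z ∉ (L.lattice : Set ℂ) \ {0}) : sigmaProd L z ≠ 0 := by
  have h1 : Summable fun l : {l : L.lattice // l ≠ 0} =>
      ‖sigmaTerm ((l : L.lattice) : ℂ) z - 1‖ := by
    refine Summable.of_norm_bounded_eventually
      ((summable_lattice_norm_rpow L).mul_left (2 * (‖z‖ + 1) ^ 3)) ?_
    filter_upwards [eventually_lattice_norm_ge L (2 * (‖z‖ + 1))] with l hl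
    rw [norm_norm]
    exact norm_sigmaTerm_sub_one_le (by linarith) hl (by positivity)
  have := tprod_one_add_ne_zero_of_summable
    (f := fun l : {l : L.lattice // l ≠ 0} => sigmaTerm ((l : L.lattice) : ℂ) z - 1) (fun l => ?_)
    h1
  · simp only [add_sub_cancel] at this
    exact this
  · rw [add_sub_cancel]
    have hl : ((l : L.lattice) : ℂ) ≠ 0 := by simpa using l.2
    exact sigmaTerm_ne_zero hl fun h => hz ⟨h ▸ l.1.2, h ▸ hl⟩

lemma sigmaProd_eq_zero {z : ℂ} (hz : z ∈ L.lattice) (h0 : z ≠ 0) : sigmaProd L z = 0 := by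
  refine tprod_of_exists_eq_zero ⟨⟨⟨z, hz⟩, by simpa using h0⟩, ?_⟩
  simp [sigmaTerm, h0]

@[simp] lemma sigmaProd_zero : sigmaProd L 0 = 1 := by
  simp [sigmaProd, sigmaTerm]

lemma sigmaProd_neg (z : ℂ) : sigmaProd L (-z) = sigmaProd L z := by
  let e : {l : L.lattice // l ≠ 0} ≃ {l : L.lattice // l ≠ 0} :=
    (Equiv.neg L.lattice).subtypeEquiv fun l => by simp
  rw [sigmaProd, sigmaProd, ← e.tprod_eq]
  refine tprod_congr fun l => ?_
  simp [sigmaTerm, e]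

lemma weierstrassSigma_neg (z : ℂ) : weierstrassSigma L (-z) = -weierstrassSigma L z := by
  rw [weierstrassSigma_eq, weierstrassSigma_eq, sigmaProd_neg, neg_mul]

lemma weierstrassSigma_eq_zero_iff {z : ℂ} : weierstrassSigma L z = 0 ↔ z ∈ L.lattice := by
  rw [weierstrassSigma_eq, mul_eq_zero]
  constructor
  · rintro (rfl | h)
    · exact zero_mem _
    · by_contra hz
      exact sigmaProd_ne_zero L (fun h' => hz h'.1) h
  · intro h
    by_cases h0 : z = 0
    · exact Or.inl h0
    · exact Or.inr (sigmaProd_eq_zero L h h0)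

lemma hasDerivAt_weierstrassSigma_zero : HasDerivAt (weierstrassSigma L) 1 0 := by
  have := (hasDerivAt_id (0 : ℂ)).mul (differentiable_sigmaProd L 0).hasDerivAt
  simpa [sigmaProd_zero] using! this

/-! ### The second logarithmic derivative -/

lemma logDeriv_sigmaTerm {l z : ℂ} (hl : l ≠ 0) (h : z ≠ l) :
    logDeriv (sigmaTerm l) z = 1 / (z - l) + 1 / l + z / l ^ 2 := by
  have h1 : HasDerivAt (fun z : ℂ => 1 - z / l) (-(1 / l)) z := by
    simpa using ((hasDerivAt_id z).div_const l).const_sub 1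
  have h2 : HasDerivAt (fun z : ℂ => z / l + z ^ 2 / (2 * l ^ 2))
      (1 / l + 2 * z / (2 * l ^ 2)) z := by
    simpa using! ((hasDerivAt_id z).div_const l).add ((hasDerivAt_pow 2 z).div_const (2 * l ^ 2))
  have h3 : HasDerivAt (sigmaTerm l) _ z := h1.mul h2.cexp
  have h4 : z - l ≠ 0 := sub_ne_zero.2 h
  have h5 : 1 - z / l ≠ 0 := by
    intro h0
    apply h4
    field_simp at h0
    linear_combination -h0
  have h6 : l - z ≠ 0 := sub_ne_zero.2 h.symm
  rw [logDeriv_apply, h3.deriv, sigmaTerm]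
  have h7 := Complex.exp_ne_zero (z / l + z ^ 2 / (2 * l ^ 2))
  rw [div_eq_iff (mul_ne_zero h5 h7)]
  generalize Complex.exp (z / l + z ^ 2 / (2 * l ^ 2)) = w
  field_simp
  ring

/-- Locally uniform convergence of holomorphic functions passes to first and second derivatives, and
`(log g)'' = (g''g - g'²)/g²`. No logarithm has to be chosen. -/
lemma tendsto_deriv_logDeriv {ι : Type*} {p : Filter ι} [p.NeBot] {F : ι → ℂ → ℂ} {f : ℂ → ℂ}
    (hF : TendstoLocallyUniformlyOn F f p Set.univ) (hd : ∀ i, Differentiable ℂ (F i)) {z : ℂ}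
    (hz : f z ≠ 0) :
    Tendsto (fun i => deriv (logDeriv (F i)) z) p (𝓝 (deriv (logDeriv f) z)) := by
  have hd' (i : ι) : Differentiable ℂ (deriv (F i)) := fun w => (hd i).analyticAt w |>.deriv.differentiableAt
  have hF1 := hF.deriv (.of_forall fun i => (hd i).differentiableOn) isOpen_univ
  have hF2 := hF1.deriv (.of_forall fun i => (hd' i).differentiableOn) isOpen_univ
  have hf : Differentiable ℂ f := by
    rw [← differentiableOn_univ]
    exact hF.differentiableOn (.of_forall fun i => (hd i).differentiableOn) isOpen_univ
  have hf' : Differentiable ℂ (deriv f) := fun w => (hf.analyticAt w).deriv.differentiableAt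
  have t0 := hF.tendsto_at (Set.mem_univ z)
  have t1 := hF1.tendsto_at (Set.mem_univ z)
  have t2 := hF2.tendsto_at (Set.mem_univ z)
  have key {g : ℂ → ℂ} (hg : Differentiable ℂ g) (hg' : Differentiable ℂ (deriv g))
      (h0 : g z ≠ 0) : deriv (logDeriv g) z =
        (deriv (deriv g) z * g z - deriv g z * deriv g z) / g z ^ 2 :=
    ((hg' z).hasDerivAt.div (hg z).hasDerivAt h0).deriv
  rw [key hf hf' hz]
  refine Tendsto.congr' ?_ (((t2.mul t0).sub (t1.mul t1)).div (t0.pow 2) (pow_ne_zero 2 hz))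
  filter_upwards [t0.eventually_ne hz] with i hi
  exact (key (hd i) (hd' i) hi).symm

/-- Termwise differentiation of the logarithm produces the series of `℘` without its summand at `0`;
the factor `z` of `σ` supplies that summand later. -/
lemma deriv_logDeriv_sigmaProd {z : ℂ} (hz : z ∉ (L.lattice : Set ℂ) \ {0}) :
    deriv (logDeriv (sigmaProd L)) z = -L.weierstrassPExcept 0 z := by
  have hlz (l : {l : L.lattice // l ≠ 0}) : ((l : L.lattice) : ℂ) ≠ 0 := by simpa using l.2
  have hopen : ((L.lattice : Set ℂ) \ {0})ᶜ ∈ 𝓝 z := L.isOpen_compl_lattice_sdiff.mem_nhds hz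
  have h1 := tendsto_deriv_logDeriv (tendstoLocallyUniformlyOn_sigmaProd L)
    (differentiable_finset_prod_sigmaTerm L) (sigmaProd_ne_zero L hz)
  have h2 (s : Finset {l : L.lattice // l ≠ 0}) :
      deriv (logDeriv fun z => ∏ l ∈ s, sigmaTerm (l : L.lattice) z) z =
        ∑ l ∈ s, -(1 / (z - (l : L.lattice)) ^ 2 - 1 / ((l : L.lattice) : ℂ) ^ 2) := by
    have e1 : (logDeriv fun z => ∏ l ∈ s, sigmaTerm (l : L.lattice) z) =ᶠ[𝓝 z]
        fun w => ∑ l ∈ s, (1 / (w - (l : L.lattice)) + 1 / ((l : L.lattice) : ℂ) +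
          w / ((l : L.lattice) : ℂ) ^ 2) := by
      filter_upwards [hopen] with w hw
      have hwl (l : {l : L.lattice // l ≠ 0}) : w ≠ (l : L.lattice) := by
        rintro rfl
        exact hw ⟨l.1.2, hlz l⟩
      rw [logDeriv_prod (fun l _ => sigmaTerm_ne_zero (hlz l) (hwl l))
        (fun l _ => differentiable_sigmaTerm _ w)]
      exact Finset.sum_congr rfl fun l _ => logDeriv_sigmaTerm (hlz l) (hwl l)
    rw [e1.deriv_eq]
    refine HasDerivAt.deriv (HasDerivAt.fun_sum fun l _ => ?_)
    have hl : z - (l : L.lattice) ≠ 0 := by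
      rw [sub_ne_zero]
      rintro rfl
      exact hz ⟨l.1.2, hlz l⟩
    have e2 := ((((hasDerivAt_id z).sub_const ((l : L.lattice) : ℂ)).inv hl).add_const
      (1 / ((l : L.lattice) : ℂ))).add ((hasDerivAt_id z).div_const (((l : L.lattice) : ℂ) ^ 2))
    refine (e2.congr_of_eventuallyEq (.of_forall fun w => ?_)).congr_deriv ?_
    · simp
    · simp; ring
  simp only [h2] at h1
  have h3 : HasSum (fun l : {l : L.lattice // l ≠ 0} =>
      -(1 / (z - (l : L.lattice)) ^ 2 - 1 / ((l : L.lattice) : ℂ) ^ 2))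
      (-L.weierstrassPExcept 0 z) := by
    refine HasSum.neg ?_
    have h4 := L.hasSum_weierstrassPExcept 0 z
    rw [← Subtype.val_injective (p := fun l : L.lattice => l ≠ 0) |>.hasSum_iff] at h4
    · refine h4.congr_fun fun l => ?_
      simp only [Function.comp_apply, if_neg (hlz l)]
    · intro l hl
      simp at hl
      simp [hl]
  exact tendsto_nhds_unique h1 h3

end PointEq
end

noncomputable section

namespace PointEq

open Filter Topology

variable (L : PeriodPair)

/-! ### Quasi-periodicity -/

/-- The Weierstrass zeta function. -/
def weierstrassZeta (z : ℂ) : ℂ := logDeriv (weierstrassSigma L) z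

lemma isOpen_compl_lattice : IsOpen (L.lattice : Set ℂ)ᶜ := L.isClosed_lattice.isOpen_compl

lemma countable_lattice : (L.lattice : Set ℂ).Countable :=
  countable_of_Lindelof_of_discrete (X := L.lattice)

lemma isPreconnected_compl_lattice : IsPreconnected (L.lattice : Set ℂ)ᶜ :=
  ((countable_lattice L).isConnected_compl_of_one_lt_rank (by simp)).2

lemma hasDerivAt_weierstrassSigma {z : ℂ} (hz : z ∉ L.lattice) :
    HasDerivAt (weierstrassSigma L) (weierstrassZeta L z * weierstrassSigma L z) z := by
  have h := (weierstrassSigma_eq_zero_iff L).not.2 hz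
  rw [weierstrassZeta, logDeriv_apply, div_mul_cancel₀ _ h]
  exact (differentiable_weierstrassSigma L z).hasDerivAt

lemma hasDerivAt_weierstrassZeta {z : ℂ} (hz : z ∉ L.lattice) :
    HasDerivAt (weierstrassZeta L) (-L.weierstrassP z) z := by
  have hz0 : z ≠ 0 := by rintro rfl; exact hz (zero_mem _)
  have h1 : weierstrassZeta L =ᶠ[𝓝 z] fun w => w⁻¹ + logDeriv (sigmaProd L) w := by
    filter_upwards [(isOpen_compl_lattice L).mem_nhds hz] with w hw
    have hw0 : w ≠ 0 := by rintro rfl; exact hw (zero_mem _)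
    have hp := sigmaProd_ne_zero L (z := w) fun h' => hw h'.1
    have h2 : HasDerivAt (weierstrassSigma L)
        (1 * sigmaProd L w + w * deriv (sigmaProd L) w) w :=
      (hasDerivAt_id w).mul (differentiable_sigmaProd L w).hasDerivAt
    rw [weierstrassZeta, logDeriv_apply, logDeriv_apply, h2.deriv, weierstrassSigma_eq]
    field_simp
  have hz' : z ∉ (L.lattice : Set ℂ) \ {0} := fun h' => hz h'.1
  have hd : DifferentiableAt ℂ (logDeriv (sigmaProd L)) z :=
    ((differentiable_sigmaProd L).analyticAt z).deriv.differentiableAt.div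
      (differentiable_sigmaProd L z) (sigmaProd_ne_zero L hz')
  have h3 := ((hasDerivAt_inv hz0).add hd.hasDerivAt).congr_of_eventuallyEq h1
  refine h3.congr_deriv ?_
  rw [deriv_logDeriv_sigmaProd L hz']
  have := L.weierstrassPExcept_add 0 z
  simp only [ZeroMemClass.coe_zero] at this
  rw [← this]
  simp

lemma weierstrassZeta_neg (z : ℂ) : weierstrassZeta L (-z) = -weierstrassZeta L z := by
  have h1 : deriv (weierstrassSigma L) (-z) = deriv (weierstrassSigma L) z := by
    have h2 := ((differentiable_weierstrassSigma L (-z)).hasDerivAt.scomp z (hasDerivAt_neg z)).neg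
    have h3 : (-(weierstrassSigma L ∘ Neg.neg)) = weierstrassSigma L := by
      ext w
      simp [weierstrassSigma_neg]
    rw [h3] at h2
    simpa using h2.deriv.symm
  rw [weierstrassZeta, weierstrassZeta, logDeriv_apply, logDeriv_apply, h1, weierstrassSigma_neg,
    div_neg]

lemma exists_forall_eq_of_deriv_eq_zero {f : ℂ → ℂ}
    (h : ∀ z, z ∉ L.lattice → HasDerivAt f 0 z) : ∃ c, ∀ z, z ∉ L.lattice → f z = c := by
  obtain ⟨c, hc⟩ := (isOpen_compl_lattice L).exists_is_const_of_deriv_eq_zero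
    (isPreconnected_compl_lattice L)
    (fun z hz => (h z hz).differentiableAt.differentiableWithinAt) (fun z hz => (h z hz).deriv)
  exact ⟨c, fun z hz => hc z hz⟩

/-- Two integrations of the periodicity of `℘`: first `ζ(z+ω) - ζ(z)` is a constant `η`, then
`σ(z+ω)/(exp(ηz)σ(z))` is a constant. Both use that the complement of the countable lattice is
connected. -/
lemma exists_weierstrassSigma_add {ω : ℂ} (hω : ω ∈ L.lattice) :
    ∃ η c : ℂ, ∀ z, weierstrassSigma L (z + ω) = c * Complex.exp (η * z) * weierstrassSigma L z := by
  have hmem {z : ℂ} (hz : z ∉ L.lattice) : z + ω ∉ L.lattice :=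
    fun h => hz (by simpa using sub_mem h hω)
  obtain ⟨η, hη⟩ := exists_forall_eq_of_deriv_eq_zero L
    (f := fun z => weierstrassZeta L (z + ω) - weierstrassZeta L z) fun z hz => by
      have h1 := ((hasDerivAt_weierstrassZeta L (hmem hz)).comp_add_const z ω).sub
        (hasDerivAt_weierstrassZeta L hz)
      refine h1.congr_deriv ?_
      rw [L.weierstrassP_add_coe z ⟨ω, hω⟩]
      ring
  obtain ⟨c, hc⟩ := exists_forall_eq_of_deriv_eq_zero L
    (f := fun z => weierstrassSigma L (z + ω) / (Complex.exp (η * z) * weierstrassSigma L z))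
    fun z hz => by
      have hσ := (weierstrassSigma_eq_zero_iff L).not.2 hz
      have he := Complex.exp_ne_zero (η * z)
      have h2 : HasDerivAt (fun z => Complex.exp (η * z)) (Complex.exp (η * z) * η) z := by
        simpa using ((hasDerivAt_id z).const_mul η).cexp
      have h1 := ((hasDerivAt_weierstrassSigma L (hmem hz)).comp_add_const z ω).div
        (h2.mul (hasDerivAt_weierstrassSigma L hz)) (mul_ne_zero he hσ)
      refine h1.congr_deriv ?_
      rw [div_eq_zero_iff]
      left
      have := hη z hz
      simp only [Pi.mul_apply]
      linear_combination weierstrassSigma L (z + ω) * Complex.exp (η * z) *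
        weierstrassSigma L z * this
  refine ⟨η, c, fun z => ?_⟩
  by_cases hz : z ∈ L.lattice
  · rw [(weierstrassSigma_eq_zero_iff L).2 hz, (weierstrassSigma_eq_zero_iff L).2 (add_mem hz hω),
      mul_zero]
  · have hσ := (weierstrassSigma_eq_zero_iff L).not.2 hz
    have := hc z hz
    rw [div_eq_iff (mul_ne_zero (Complex.exp_ne_zero _) hσ)] at this
    rw [this]
    ring

/-! ### The product formula -/

lemma eq_of_periodic_of_differentiable {f : ℂ → ℂ} (hf : Differentiable ℂ f)
    (hp : ∀ z, ∀ ω ∈ L.lattice, f (z + ω) = f z) (z w : ℂ) : f z = f w :=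
  hf.apply_eq_apply_of_bounded (IsZLattice.isCompact_range_of_periodic L.lattice _ hf.continuous
    fun z ω hω => hp z ω hω).isBounded z w

lemma deriv_zero_of_even {f : ℂ → ℂ} (hf : ∀ z, f (-z) = f z) : deriv f 0 = 0 := by
  have h := deriv_comp_neg f 0
  simp only [hf, neg_zero] at h
  linear_combination (1 / 2 : ℂ) * h

/-- With `b` fixed, `G(z) = σ(z+b)σ(z-b)/σ(z)² + σ(b)²℘(z)` is periodic and its double pole at `0`
cancels. By Liouville `G` is constant. Comparing its values at `a` and at `b`, where the quotient
vanishes because `σ(0) = 0`, gives the formula. -/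
theorem weierstrassSigma_add_mul_sub {a b : ℂ} (ha : a ∉ L.lattice) (hb : b ∉ L.lattice) :
    weierstrassSigma L (a + b) * weierstrassSigma L (a - b) =
      -weierstrassSigma L a ^ 2 * weierstrassSigma L b ^ 2 *
        (L.weierstrassP a - L.weierstrassP b) := by
  set σ := weierstrassSigma L with hσ
  have hσd := differentiable_weierstrassSigma L
  set n : ℂ → ℂ := fun z => σ (z + b) * σ (z - b) / sigmaProd L z ^ 2 + σ b ^ 2 +
    σ b ^ 2 * z ^ 2 * L.weierstrassPExcept 0 z with hn
  set G : ℂ → ℂ := fun z => σ (z + b) * σ (z - b) / σ z ^ 2 + σ b ^ 2 * L.weierstrassP z with hG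
  have hnG {z : ℂ} (hz : z ∉ L.lattice) : n z = z ^ 2 * G z := by
    have hz0 : z ≠ 0 := by rintro rfl; exact hz (zero_mem _)
    have hp := sigmaProd_ne_zero L (z := z) fun h' => hz h'.1
    have := L.weierstrassPExcept_def 0 z
    simp only [ZeroMemClass.coe_zero] at this
    simp only [hn, hG, hσ, weierstrassSigma_eq L z, this]
    field_simp
    simp only [sub_zero]
    ring
  have hna : AnalyticAt ℂ n 0 := by
    have h1 : AnalyticAt ℂ (fun z => σ (z + b) * σ (z - b)) 0 :=
      (Differentiable.mul (hσd.comp (by fun_prop)) (hσd.comp (by fun_prop))).analyticAt 0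
    have h2 := (differentiable_sigmaProd L).analyticAt 0
    have h3 := L.analyticAt_weierstrassPExcept 0
    refine ((h1.div (h2.pow 2) (by simp)).add analyticAt_const).add
      ((analyticAt_const.mul (analyticAt_id.pow 2)).mul h3)
  have hneven (z : ℂ) : n (-z) = n z := by
    have e1 : σ (-z + b) = -σ (z - b) := by rw [hσ, ← weierstrassSigma_neg]; congr 1; ring
    have e2 : σ (-z - b) = -σ (z + b) := by rw [hσ, ← weierstrassSigma_neg]; congr 1; ring
    simp only [hn, e1, e2, sigmaProd_neg, L.weierstrassPExcept_neg, neg_zero]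
    ring
  have hn0 : n 0 = 0 := by
    simp [hn, hσ, weierstrassSigma_neg]
    ring
  -- Evenness of `n = z²G` rules out a simple pole, so `n(0) = 0` alone leaves a removable
  -- singularity of `G`; its value is the double slope `k`.
  have hn1 : deriv n 0 = 0 := deriv_zero_of_even hneven
  set k := dslope (dslope n 0) 0 with hk
  have hka : AnalyticAt ℂ k 0 := by
    obtain ⟨p, hp⟩ := hna
    exact ⟨_, hp.has_fpower_series_dslope_fslope.has_fpower_series_dslope_fslope⟩
  have hkn {z : ℂ} (hz : z ≠ 0) : n z = z ^ 2 * k z := by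
    have e1 := sub_smul_dslope n 0 z
    have e2 := sub_smul_dslope (dslope n 0) 0 z
    rw [dslope_same, hn1] at e2
    simp only [sub_zero, smul_eq_mul, hn0] at e1 e2
    rw [← e1, ← e2]
    ring
  classical
  set F : ℂ → ℂ := fun z => if z ∈ L.lattice then k 0 else G z with hF
  have hGper (z ω : ℂ) (hω : ω ∈ L.lattice) (hz : z ∉ L.lattice) : G (z + ω) = G z := by
    obtain ⟨η, c, hc⟩ := exists_weierstrassSigma_add L hω
    have hσz := (weierstrassSigma_eq_zero_iff L).not.2 hz
    have hσz' : weierstrassSigma L (z + ω) ≠ 0 :=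
      (weierstrassSigma_eq_zero_iff L).not.2 fun h => hz (by simpa using sub_mem h hω)
    have hc0 : c ≠ 0 := by
      rintro rfl
      rw [hc z] at hσz'
      simp at hσz'
    have he : Complex.exp (η * (z + b)) * Complex.exp (η * (z - b)) = Complex.exp (η * z) ^ 2 := by
      rw [← Complex.exp_add, sq, ← Complex.exp_add]
      congr 1
      ring
    have he0 := Complex.exp_ne_zero (η * z)
    simp only [hG, hσ]
    rw [show z + ω + b = z + b + ω by ring, show z + ω - b = z - b + ω by ring, hc, hc, hc,
      L.weierstrassP_add_coe z ⟨ω, hω⟩]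
    congr 1
    rw [div_eq_div_iff (pow_ne_zero 2 (by positivity)) (pow_ne_zero 2 hσz)]
    linear_combination c ^ 2 * weierstrassSigma L (z + b) * weierstrassSigma L (z - b) *
      weierstrassSigma L z ^ 2 * he
  have hFper (z ω : ℂ) (hω : ω ∈ L.lattice) : F (z + ω) = F z := by
    by_cases hz : z ∈ L.lattice
    · simp only [hF, if_pos hz, if_pos (add_mem hz hω)]
    · have : z + ω ∉ L.lattice := fun h => hz (by simpa using sub_mem h hω)
      simp only [hF, if_neg hz, if_neg this, hGper z ω hω hz]
  have hF0 : DifferentiableAt ℂ F 0 := by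
    refine hka.differentiableAt.congr_of_eventuallyEq ?_
    filter_upwards [L.compl_lattice_sdiff_singleton_mem_nhds 0] with z hz
    by_cases hz0 : z = 0
    · subst hz0
      simp only [hF, if_pos (zero_mem L.lattice)]
    · have hzl : z ∉ L.lattice := fun h => hz ⟨h, hz0⟩
      simp only [hF, if_neg hzl]
      refine mul_left_cancel₀ (pow_ne_zero 2 hz0) ?_
      rw [← hnG hzl, hkn hz0]
  have hFd : Differentiable ℂ F := by
    intro z
    by_cases hz : z ∈ L.lattice
    · have h1 : F = fun w => F (w - z) := by
        ext w
        rw [← hFper (w - z) z hz, sub_add_cancel]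
      rw [h1]
      exact DifferentiableAt.comp z (g := F) (f := fun w => w - z) (by simpa using hF0)
        (by fun_prop)
    · have h1 : F =ᶠ[𝓝 z] G := by
        filter_upwards [(isOpen_compl_lattice L).mem_nhds hz] with w hw
        simp only [hF, if_neg (show w ∉ L.lattice from hw)]
      refine DifferentiableAt.congr_of_eventuallyEq ?_ h1
      have h2 : DifferentiableAt ℂ L.weierstrassP z :=
        (L.analyticOnNhd_weierstrassP z hz).differentiableAt
      have h3 : DifferentiableAt ℂ (fun z => σ (z + b) * σ (z - b)) z :=
        (Differentiable.mul (hσd.comp (by fun_prop)) (hσd.comp (by fun_prop))) z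
      exact (h3.div ((hσd z).pow 2) (pow_ne_zero 2
        ((weierstrassSigma_eq_zero_iff L).not.2 hz))).add (h2.const_mul _)
  have hab := eq_of_periodic_of_differentiable L hFd hFper a b
  simp only [hF, if_neg ha, if_neg hb, hG] at hab
  have hσ0 : σ 0 = 0 := (weierstrassSigma_eq_zero_iff L).2 (zero_mem _)
  have hσa : σ a ≠ 0 := (weierstrassSigma_eq_zero_iff L).not.2 ha
  rw [sub_self, hσ0, mul_zero, zero_div, zero_add] at hab
  field_simp at hab
  linear_combination hab

end PointEq
end

noncomputable section

namespace PointEq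

open Filter Topology

variable (L : PeriodPair)

/-! ### Values of the Weierstrass functions -/

lemma eq_of_eq_off_countable {f g : ℂ → ℂ} {T : Set ℂ} (hT : T.Countable) {x : ℂ}
    (hf : ContinuousAt f x) (hg : ContinuousAt g x) (h : ∀ z, z ∉ T → f z = g z) : f x = g x := by
  have hx : x ∈ closure Tᶜ := (hT.dense_compl ℝ) x
  have : (𝓝[Tᶜ] x).NeBot := mem_closure_iff_nhdsWithin_neBot.1 hx
  refine tendsto_nhds_unique (l := 𝓝[Tᶜ] x) (hf.tendsto.mono_left nhdsWithin_le_nhds) ?_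
  refine (hg.tendsto.mono_left nhdsWithin_le_nhds).congr' ?_
  filter_upwards [self_mem_nhdsWithin] with z hz
  exact (h z hz).symm

lemma hasDerivAt_weierstrassP {z : ℂ} (hz : z ∉ L.lattice) :
    HasDerivAt L.weierstrassP (L.derivWeierstrassP z) z := by
  rw [← L.deriv_weierstrassP]
  exact (L.analyticOnNhd_weierstrassP z hz).differentiableAt.hasDerivAt

lemma weierstrassP_eq_iff {a b : ℂ} (ha : a ∉ L.lattice) (hb : b ∉ L.lattice) :
    L.weierstrassP a = L.weierstrassP b ↔ a + b ∈ L.lattice ∨ a - b ∈ L.lattice := by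
  rw [← weierstrassSigma_eq_zero_iff, ← weierstrassSigma_eq_zero_iff, ← mul_eq_zero,
    weierstrassSigma_add_mul_sub L ha hb]
  have hσa := (weierstrassSigma_eq_zero_iff L).not.2 ha
  have hσb := (weierstrassSigma_eq_zero_iff L).not.2 hb
  simp [hσa, hσb, sub_eq_zero]

/-- Differentiate the product formula in `a` at `a = b = z`. Only the derivatives of the factors
vanishing there survive, and `σ'(0) = 1`. -/
lemma weierstrassSigma_two_mul {z : ℂ} (hz : z ∉ L.lattice) :
    weierstrassSigma L (2 * z) = -L.derivWeierstrassP z * weierstrassSigma L z ^ 4 := by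
  have hd := differentiable_weierstrassSigma L
  have h0 : weierstrassSigma L 0 = 0 := (weierstrassSigma_eq_zero_iff L).2 (zero_mem _)
  have h1 : HasDerivAt (fun w => weierstrassSigma L (w + z) * weierstrassSigma L (w - z))
      (weierstrassSigma L (2 * z)) z := by
    have e1 := (hd (z + z)).hasDerivAt.comp_add_const z z
    have e2 : HasDerivAt (fun w => weierstrassSigma L (w - z)) 1 z := by
      have := hasDerivAt_weierstrassSigma_zero L
      rw [← sub_self z] at this
      exact this.comp_sub_const z z
    refine (e1.mul e2).congr_deriv ?_
    rw [sub_self, h0, two_mul]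
    ring
  have h2 : HasDerivAt (fun w => -weierstrassSigma L w ^ 2 * weierstrassSigma L z ^ 2 *
      (L.weierstrassP w - L.weierstrassP z))
      (-L.derivWeierstrassP z * weierstrassSigma L z ^ 4) z := by
    have e1 := ((((hd z).hasDerivAt.fun_pow 2).neg.mul_const (weierstrassSigma L z ^ 2)).mul
      ((hasDerivAt_weierstrassP L hz).sub_const (L.weierstrassP z)))
    refine e1.congr_deriv ?_
    simp
    ring
  refine h1.unique (h2.congr_of_eventuallyEq ?_)
  filter_upwards [(isOpen_compl_lattice L).mem_nhds hz] with w hw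
  exact weierstrassSigma_add_mul_sub L hw hz

lemma derivWeierstrassP_ne_zero_iff {z : ℂ} (hz : z ∉ L.lattice) :
    L.derivWeierstrassP z ≠ 0 ↔ 2 * z ∉ L.lattice := by
  rw [← weierstrassSigma_eq_zero_iff, weierstrassSigma_two_mul L hz]
  simp [(weierstrassSigma_eq_zero_iff L).not.2 hz]

/-- Differentiating the cubic equation for `℘'²` gives this after cancelling `2℘'`. Points with `2z`
in the lattice, where `℘'` may vanish, are reached by continuity. -/
lemma hasDerivAt_derivWeierstrassP {z : ℂ} (hz : z ∉ L.lattice) :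
    HasDerivAt L.derivWeierstrassP (6 * L.weierstrassP z ^ 2 - L.g₂ / 2) z := by
  have ha := L.analyticOnNhd_derivWeierstrassP
  have hd {w : ℂ} (hw : w ∉ L.lattice) := (ha w hw).differentiableAt.hasDerivAt
  have hT : ((L.lattice : Set ℂ) ∪ (fun w => 2 * w) ⁻¹' L.lattice).Countable :=
    (countable_lattice L).union ((countable_lattice L).preimage_of_injOn
      (mul_right_injective₀ two_ne_zero).injOn)
  refine (hd hz).congr_deriv (eq_of_eq_off_countable hT (f := deriv L.derivWeierstrassP)
    (g := fun z => 6 * L.weierstrassP z ^ 2 - L.g₂ / 2) (ha z hz).deriv.continuousAt ?_ ?_)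
  · have := (hasDerivAt_weierstrassP L hz).continuousAt
    fun_prop
  · intro w hw
    simp only [Set.mem_union, SetLike.mem_coe, Set.mem_preimage, not_or] at hw
    have h1 := (hd hw.1).fun_pow 2
    have hP := hasDerivAt_weierstrassP L hw.1
    have h2 := (((hP.fun_pow 3).const_mul 4).sub (hP.const_mul L.g₂)).sub_const L.g₃
    have h3 := h1.unique (h2.congr_of_eventuallyEq (by
      filter_upwards [(isOpen_compl_lattice L).mem_nhds hw.1] with x hx
      exact L.derivWeierstrassP_sq x hx))
    have h4 := (derivWeierstrassP_ne_zero_iff L hw.1).2 hw.2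
    refine mul_left_cancel₀ (mul_ne_zero two_ne_zero h4) ?_
    norm_num at h3
    linear_combination h3

/-! ### The addition theorem -/

/-- The logarithmic derivative of the product formula with respect to `a`. Adding the formula with
`a` and `b` exchanged, `ζ` being odd, isolates `ζ(a+b)`; one more derivative then yields the
addition theorem for `℘`. -/
lemma weierstrassZeta_add {a b : ℂ} (ha : a ∉ L.lattice) (hb : b ∉ L.lattice)
    (hab : a + b ∉ L.lattice) (hab' : a - b ∉ L.lattice) :
    weierstrassZeta L (a + b) + weierstrassZeta L (a - b) - 2 * weierstrassZeta L a =
      L.derivWeierstrassP a / (L.weierstrassP a - L.weierstrassP b) := by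
  have h0 : L.weierstrassP a - L.weierstrassP b ≠ 0 := by
    rw [sub_ne_zero, Ne, weierstrassP_eq_iff L ha hb]
    tauto
  have h1 := ((hasDerivAt_weierstrassSigma L hab).comp_add_const a b).mul
    ((hasDerivAt_weierstrassSigma L hab').comp_sub_const a b)
  have h2 := ((((hasDerivAt_weierstrassSigma L ha).fun_pow 2).neg.mul_const
    (weierstrassSigma L b ^ 2)).mul ((hasDerivAt_weierstrassP L ha).sub_const (L.weierstrassP b)))
  have h3 := h1.unique (h2.congr_of_eventuallyEq (by
    filter_upwards [(isOpen_compl_lattice L).mem_nhds ha] with w hw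
    exact weierstrassSigma_add_mul_sub L hw hb))
  have h4 := weierstrassSigma_add_mul_sub L ha hb
  have hσa := (weierstrassSigma_eq_zero_iff L).not.2 ha
  have hσb := (weierstrassSigma_eq_zero_iff L).not.2 hb
  rw [eq_div_iff h0]
  refine mul_left_cancel₀ (mul_ne_zero (pow_ne_zero 2 hσa) (pow_ne_zero 2 hσb)) ?_
  norm_num at h3
  linear_combination -h3 + (weierstrassZeta L (a + b) + weierstrassZeta L (a - b)) * h4

lemma weierstrassZeta_add' {a b : ℂ} (ha : a ∉ L.lattice) (hb : b ∉ L.lattice)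
    (hab : a + b ∉ L.lattice) (hab' : a - b ∉ L.lattice) :
    2 * (weierstrassZeta L (a + b) - weierstrassZeta L a - weierstrassZeta L b) =
      (L.derivWeierstrassP a - L.derivWeierstrassP b) /
        (L.weierstrassP a - L.weierstrassP b) := by
  have h1 := weierstrassZeta_add L ha hb hab hab'
  have h2 := weierstrassZeta_add L hb ha (by rwa [add_comm]) (by rwa [← neg_sub, neg_mem_iff])
  rw [add_comm b a, ← neg_sub a b, weierstrassZeta_neg,
    ← neg_sub (L.weierstrassP a) (L.weierstrassP b), div_neg] at h2
  rw [sub_div]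
  linear_combination h1 + h2

theorem weierstrassP_add {a b : ℂ} (ha : a ∉ L.lattice) (hb : b ∉ L.lattice)
    (hab : a + b ∉ L.lattice) (hab' : a - b ∉ L.lattice) :
    4 * (L.weierstrassP a - L.weierstrassP b) ^ 2 *
      (L.weierstrassP (a + b) + L.weierstrassP a + L.weierstrassP b) =
      (L.derivWeierstrassP a - L.derivWeierstrassP b) ^ 2 := by
  have h0 : L.weierstrassP a - L.weierstrassP b ≠ 0 := by
    rw [sub_ne_zero, Ne, weierstrassP_eq_iff L ha hb]
    tauto
  have h1 := ((((hasDerivAt_weierstrassZeta L hab).comp_add_const a b).sub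
    (hasDerivAt_weierstrassZeta L ha)).sub_const (weierstrassZeta L b)).const_mul 2
  have h2 := ((hasDerivAt_derivWeierstrassP L ha).sub_const (L.derivWeierstrassP b)).div
    ((hasDerivAt_weierstrassP L ha).sub_const (L.weierstrassP b)) h0
  have h3 := h1.unique (h2.congr_of_eventuallyEq (by
    filter_upwards [(isOpen_compl_lattice L).mem_nhds ha,
      (continuous_add_const b).continuousAt.preimage_mem_nhds ((isOpen_compl_lattice L).mem_nhds hab),
      (continuous_sub_right b).continuousAt.preimage_mem_nhds
        ((isOpen_compl_lattice L).mem_nhds hab')] with w hw1 hw2 hw3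
    exact weierstrassZeta_add' L hw1 hb hw2 hw3))
  rw [eq_div_iff (pow_ne_zero 2 h0)] at h3
  have ea := L.derivWeierstrassP_sq a ha
  have eb := L.derivWeierstrassP_sq b hb
  linear_combination -2 * h3 + ea - eb

/-- The limit `w → z` of the addition theorem for `w` and `z`, divided by `(w - z)²`: the
differences of `℘` and `℘'` become derivatives. -/
lemma weierstrassP_two_mul {z : ℂ} (hz : z ∉ L.lattice) (hz2 : 2 * z ∉ L.lattice) :
    4 * L.derivWeierstrassP z ^ 2 * (L.weierstrassP (2 * z) + 2 * L.weierstrassP z) =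
      (6 * L.weierstrassP z ^ 2 - L.g₂ / 2) ^ 2 := by
  have h1 := (hasDerivAt_weierstrassP L hz).tendsto_slope
  have h2 := (hasDerivAt_derivWeierstrassP L hz).tendsto_slope
  have h3 : Tendsto (fun w => L.weierstrassP (w + z) + L.weierstrassP w + L.weierstrassP z)
      (𝓝[≠] z) (𝓝 (L.weierstrassP (z + z) + L.weierstrassP z + L.weierstrassP z)) := by
    have c1 : ContinuousAt (fun w => L.weierstrassP (w + z)) z :=
      ((hasDerivAt_weierstrassP L (z := z + z) (by rwa [← two_mul])).comp_add_const z z).continuousAt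
    have c2 := (hasDerivAt_weierstrassP L hz).continuousAt
    exact ((c1.add c2).add continuousAt_const).tendsto.mono_left nhdsWithin_le_nhds
  have h4 := ((h1.pow 2).const_mul 4).mul h3
  have h5 := h2.pow 2
  have h6 := tendsto_nhds_unique (h4.congr' ?_) h5
  · rw [two_mul z]
    linear_combination h6
  · have m1 := nhdsWithin_le_nhds (s := {z}ᶜ) ((isOpen_compl_lattice L).mem_nhds hz)
    have m2 := nhdsWithin_le_nhds (s := {z}ᶜ)
      ((continuous_add_const z).continuousAt.preimage_mem_nhds
        ((isOpen_compl_lattice L).mem_nhds (show z + z ∈ (L.lattice : Set ℂ)ᶜ by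
          rw [← two_mul]; exact hz2)))
    have m3 := nhdsWithin_le_nhds (s := {z}ᶜ)
      ((continuous_sub_right z).continuousAt.preimage_mem_nhds
        (show ((L.lattice : Set ℂ) \ {0})ᶜ ∈ 𝓝 (z - z) by
          rw [sub_self]; exact L.compl_lattice_sdiff_singleton_mem_nhds 0))
    filter_upwards [m1, m2, m3, self_mem_nhdsWithin] with w hw1 hw2 hw3 hw4
    have hw5 : w - z ≠ 0 := sub_ne_zero.2 hw4
    have := weierstrassP_add L hw1 hz hw2 (fun h => hw3 ⟨h, hw5⟩)
    simp only [slope_def_field]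
    rw [div_pow, div_pow, ← this]
    field_simp

lemma derivWeierstrassP_two_mul {z : ℂ} (hz : z ∉ L.lattice) (hz2 : 2 * z ∉ L.lattice) :
    4 * L.derivWeierstrassP z ^ 3 * L.derivWeierstrassP (2 * z) =
      12 * L.weierstrassP z * (6 * L.weierstrassP z ^ 2 - L.g₂ / 2) * L.derivWeierstrassP z ^ 2
        - (6 * L.weierstrassP z ^ 2 - L.g₂ / 2) ^ 3 - 4 * L.derivWeierstrassP z ^ 4 := by
  have hP := hasDerivAt_weierstrassP L hz
  have hP' := hasDerivAt_derivWeierstrassP L hz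
  have hm : HasDerivAt (fun w : ℂ => 2 * w) 2 z := by simpa using (hasDerivAt_id z).const_mul 2
  have hP2 : HasDerivAt (fun w => L.weierstrassP (2 * w)) (L.derivWeierstrassP (2 * z) * 2) z :=
    (hasDerivAt_weierstrassP L hz2).comp z hm
  have h1 := ((hP'.fun_pow 2).const_mul 4).mul (hP2.add (hP.const_mul 2))
  have h2 := (((hP.fun_pow 2).const_mul 6).sub_const (L.g₂ / 2)).fun_pow 2
  have h3 := h1.unique (h2.congr_of_eventuallyEq (by
    filter_upwards [(isOpen_compl_lattice L).mem_nhds hz,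
      (continuous_const_mul (2 : ℂ)).continuousAt.preimage_mem_nhds
        ((isOpen_compl_lattice L).mem_nhds hz2)] with w hw1 hw2
    exact weierstrassP_two_mul L hw1 hw2))
  have h4 := weierstrassP_two_mul L hz hz2
  norm_num at h3
  -- `h3` is the differentiated duplication formula, and subtracting a multiple of the formula
  -- itself eliminates `℘(2z)`.
  linear_combination (L.derivWeierstrassP z / 2) * h3 -
    (6 * L.weierstrassP z ^ 2 - L.g₂ / 2) * h4

/-! ### Surjectivity -/

/-- If `c` were omitted, `1/(℘ - c)`, extended by `0` to the lattice, would be entire and periodic,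
hence constant. It vanishes at `0` but not at a half period. -/
lemma exists_weierstrassP_eq (c : ℂ) : ∃ z, z ∉ L.lattice ∧ L.weierstrassP z = c := by
  by_contra! hc
  classical
  set F : ℂ → ℂ := fun z => if z ∈ L.lattice then 0 else 1 / (L.weierstrassP z - c) with hF
  have hFper (z ω : ℂ) (hω : ω ∈ L.lattice) : F (z + ω) = F z := by
    simp only [hF, L.weierstrassP_add_coe z ⟨ω, hω⟩]
    congr 1
    simpa using L.lattice.toAddSubgroup.add_mem_cancel_right (y := z) hω
  have hF0 : DifferentiableAt ℂ F 0 := by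
    have h1 : DifferentiableAt ℂ (fun z => z ^ 2 / (1 + z ^ 2 * (L.weierstrassPExcept 0 z - c))) 0 := by
      have := (L.analyticAt_weierstrassPExcept 0).differentiableAt
      exact DifferentiableAt.div (by fun_prop) (by fun_prop) (by simp)
    refine h1.congr_of_eventuallyEq ?_
    filter_upwards [L.compl_lattice_sdiff_singleton_mem_nhds 0] with z hz
    by_cases hz0 : z = 0
    · simp [hF, hz0]
    · have hzl : z ∉ L.lattice := fun h => hz ⟨h, hz0⟩
      have h2 := L.weierstrassPExcept_def 0 z
      simp only [ZeroMemClass.coe_zero, sub_zero] at h2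
      have h3 := sub_ne_zero.2 (hc z hzl)
      have h4 : 1 + z ^ 2 * (L.weierstrassPExcept 0 z - c) = z ^ 2 * (L.weierstrassP z - c) := by
        rw [h2]
        field_simp
        ring
      simp only [hF, if_neg hzl, h4]
      field_simp
  have hFd : Differentiable ℂ F := by
    intro z
    by_cases hz : z ∈ L.lattice
    · have h1 : F = fun w => F (w - z) := by
        ext w
        rw [← hFper (w - z) z hz, sub_add_cancel]
      rw [h1]
      exact DifferentiableAt.comp z (g := F) (f := fun w => w - z) (by simpa using hF0)
        (by fun_prop)
    · refine DifferentiableAt.congr_of_eventuallyEq (f := fun w => 1 / (L.weierstrassP w - c)) ?_ ?_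
      · exact (differentiableAt_const _).div
          ((hasDerivAt_weierstrassP L hz).differentiableAt.sub_const c) (sub_ne_zero.2 (hc z hz))
      · filter_upwards [(isOpen_compl_lattice L).mem_nhds hz] with w hw
        simp only [hF, if_neg (show w ∉ L.lattice from hw)]
  have h := eq_of_periodic_of_differentiable L hFd hFper (L.ω₁ / 2) 0
  have hω := L.ω₁_div_two_notMem_lattice
  simp only [hF, if_neg hω, if_pos (zero_mem L.lattice)] at h
  exact one_div_ne_zero (sub_ne_zero.2 (hc _ hω)) h

/-- The half periods are zeros of `℘'` with different values of `℘`. -/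
lemma discriminant_ne_zero : L.g₂ ^ 3 - 27 * L.g₃ ^ 2 ≠ 0 := by
  have h₁ := L.ω₁_div_two_notMem_lattice
  have h₂ := L.ω₂_div_two_notMem_lattice
  have h₃ : L.ω₁ / 2 + L.ω₂ / 2 ∉ L.lattice := by
    simpa [inv_mul_eq_div] using
      (L.mul_ω₁_add_mul_ω₂_mem_lattice (α := 1 / 2) (β := 1 / 2)).not.mpr (by norm_num)
  have h₄ : L.ω₁ / 2 - L.ω₂ / 2 ∉ L.lattice := by
    intro h
    apply h₃
    have := add_mem h L.ω₂_mem_lattice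
    convert this using 1
    ring
  have z₁ : L.derivWeierstrassP (L.ω₁ / 2) = 0 := by
    by_contra h
    refine (derivWeierstrassP_ne_zero_iff L h₁).1 h ?_
    convert L.ω₁_mem_lattice using 1
    ring
  have z₂ : L.derivWeierstrassP (L.ω₂ / 2) = 0 := by
    by_contra h
    refine (derivWeierstrassP_ne_zero_iff L h₂).1 h ?_
    convert L.ω₂_mem_lattice using 1
    ring
  have z₃ : L.derivWeierstrassP (L.ω₁ / 2 + L.ω₂ / 2) = 0 := by
    by_contra h
    refine (derivWeierstrassP_ne_zero_iff L h₃).1 h ?_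
    convert add_mem L.ω₁_mem_lattice L.ω₂_mem_lattice using 1
    ring
  have n₁₂ : L.weierstrassP (L.ω₁ / 2) ≠ L.weierstrassP (L.ω₂ / 2) := by
    rw [Ne, weierstrassP_eq_iff L h₁ h₂]
    tauto
  have n₁₃ : L.weierstrassP (L.ω₁ / 2) ≠ L.weierstrassP (L.ω₁ / 2 + L.ω₂ / 2) := by
    rw [Ne, weierstrassP_eq_iff L h₁ h₃, not_or]
    constructor
    · intro h
      apply h₂
      convert sub_mem h L.ω₁_mem_lattice using 1
      ring
    · intro h
      apply h₂
      convert neg_mem h using 1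
      ring
  have n₂₃ : L.weierstrassP (L.ω₂ / 2) ≠ L.weierstrassP (L.ω₁ / 2 + L.ω₂ / 2) := by
    rw [Ne, weierstrassP_eq_iff L h₂ h₃, not_or]
    constructor
    · intro h
      apply h₁
      convert sub_mem h L.ω₂_mem_lattice using 1
      ring
    · intro h
      apply h₁
      convert neg_mem h using 1
      ring
  have e₁ := L.derivWeierstrassP_sq _ h₁
  have e₂ := L.derivWeierstrassP_sq _ h₂
  have e₃ := L.derivWeierstrassP_sq _ h₃
  rw [z₁] at e₁
  rw [z₂] at e₂
  rw [z₃] at e₃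
  generalize L.weierstrassP (L.ω₁ / 2) = a at *
  generalize L.weierstrassP (L.ω₂ / 2) = b at *
  generalize L.weierstrassP (L.ω₁ / 2 + L.ω₂ / 2) = c at *
  have s₁ : 4 * (a ^ 2 + a * b + b ^ 2) = L.g₂ :=
    mul_left_cancel₀ (sub_ne_zero.2 n₁₂) (by linear_combination e₂ - e₁)
  have s₂ : 4 * (a ^ 2 + a * c + c ^ 2) = L.g₂ :=
    mul_left_cancel₀ (sub_ne_zero.2 n₁₃) (by linear_combination e₃ - e₁)
  have s₃ : a + b + c = 0 :=
    mul_left_cancel₀ (sub_ne_zero.2 n₂₃) (by linear_combination (s₁ - s₂) / 4)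
  have hg₃ : L.g₃ = 4 * a ^ 3 - L.g₂ * a := by linear_combination e₁
  have hc : c = -a - b := by linear_combination s₃
  have : L.g₂ ^ 3 - 27 * L.g₃ ^ 2 = 16 * ((a - b) * (a - c) * (b - c)) ^ 2 := by
    rw [hg₃, ← s₁, hc]
    ring
  rw [this]
  exact mul_ne_zero (by norm_num) (pow_ne_zero 2 (mul_ne_zero
    (mul_ne_zero (sub_ne_zero.2 n₁₂) (sub_ne_zero.2 n₁₃)) (sub_ne_zero.2 n₂₃)))

end PointEq
end

noncomputable section

namespace PointEq

open MvPolynomial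

/-! ### The elliptic case -/

lemma ellP_eq (g g₂ g₃ : ℂ) : ellP g g₂ g₃ =
    squarePoly (12 * g ^ 2 - g₂) (-(4 * g ^ 3 + g₂ * g + 2 * g₃))
      (2 * (g ^ 4 - g₃ * g - g₂ ^ 2 / 16)) (-(g * (4 * g ^ 3 - 3 * g₂ * g - 4 * g₃)))
      (g * (g₂ * g ^ 2 + 6 * g₃ * g + g₂ ^ 2 / 4))
      ((12 * g ^ 2 - g₂) * (g₂ ^ 2 / 16) + (4 * g ^ 3 + g₂ * g + 2 * g₃) * g₃) := by
  simp only [ellP, squarePoly, C_neg, C_add, C_mul]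
  ring

lemma ellH_eq (g g₂ g₃ : ℂ) : ellH g g₂ g₃ =
    biquadratic 1 (-2 * g) (g ^ 2) (g₂ / 2 - 2 * g ^ 2) (g * g₂ / 2 + g₃)
      (g₂ ^ 2 / 16 + g * g₃) := by
  have h2 : (C (g₂ / 2) : MvPolynomial (Fin 2) ℂ) = 2 * C (g₂ / 4) := by
    rw [← map_ofNat (C : ℂ →+* MvPolynomial (Fin 2) ℂ) 2, ← C_mul]; congr 1; ring
  have h3 : (C (g * g₂ / 2) : MvPolynomial (Fin 2) ℂ) = 2 * C g * C (g₂ / 4) := by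
    rw [← map_ofNat (C : ℂ →+* MvPolynomial (Fin 2) ℂ) 2, ← C_mul, ← C_mul]; congr 1; ring
  have h4 : (C (g₂ ^ 2 / 16) : MvPolynomial (Fin 2) ℂ) = C (g₂ / 4) ^ 2 := by
    rw [← C_pow]; congr 1; ring
  simp only [ellH, biquadratic, C_neg, C_add, C_mul, C_sub, C_pow, C_1, h2, h3, h4, map_ofNat]
  ring

/-- The leading coefficient of the edge form of `ellP`. -/
def ellLead (g g₂ g₃ : ℂ) : ℂ :=
  (4 * g ^ 3 + g₂ * g + 2 * g₃) ^ 2 - 2 * (12 * g ^ 2 - g₂) * (g ^ 4 - g₃ * g - g₂ ^ 2 / 16)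

lemma edgeForm_ellP (g g₂ g₃ : ℂ) :
    edgeForm (ellP g g₂ g₃) = C (ellLead g g₂ g₃) * rename ![1, 2] (ellH g g₂ g₃) := by
  rw [ellP_eq, ellH_eq, edgeForm_squarePoly, ← rename_C ![1, 2], ← map_mul, C_mul_biquadratic]
  congr 2 <;> simp only [ellLead] <;> ring

lemma inFamily_ell {g g₂ g₃ : ℂ} (h : ellLead g g₂ g₃ ≠ 0) :
    InFamily (ellP g g₂ g₃) (ellH g g₂ g₃) := by
  have hP : ellP g g₂ g₃ ≠ 0 := by
    intro h0
    have e := edgeForm_ellP g g₂ g₃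
    rw [h0, ellH_eq, ← rename_C ![1, 2], ← map_mul, eq_comm] at e
    simp only [edgeForm, map_zero, mul_zero, sub_zero] at e
    have e1 := rename_edge_injective (e.trans (map_zero _).symm)
    rw [mul_eq_zero, C_eq_zero, or_iff_right h] at e1
    have v := fun x => congrArg (eval x) e1
    have v0 := v ![0, 0]
    have v1 := v ![1, 1]
    have v2 := v ![-1, -1]
    have v3 := v ![2, 2]
    have v4 := v ![-2, -2]
    simp only [eval_biquadratic, map_zero, Matrix.cons_val] at v0 v1 v2 v3 v4
    -- On the diagonal `H` is a monic quartic, and its fourth difference is `4! = 24`.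
    have : (24 : ℂ) = 0 := by linear_combination v3 + v4 - 4 * v1 - 4 * v2 + 6 * v0
    norm_num at this
  refine ⟨hP, ?_, ?_, ?_, _, h, (edgeForm_ellP g g₂ g₃).symm⟩
  · rw [ellP_eq]; exact isSquareAffine_squarePoly _ _ _ _ _ _
  · rw [ellH_eq]; exact degreeOf_biquadratic _ _ _ _ _ _
  · rw [ellH_eq]; exact rename_biquadratic _ _ _ _ _ _

section Identities

variable {X Y x g G g₂ g₃ K N P₂ D p q v w ζ : ℂ}

/-- Here `g`, `G`, `P₂` stand for `℘(γ)`, `℘'(γ)`, `℘''(γ)`. Centring all variables at `g` expresses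
`P` by `G²`, `P₂` and `K`, the constants that occur in the addition theorem. -/
lemma eval_ellP_shift (hG : G ^ 2 = 4 * g ^ 3 - g₂ * g - g₃) (hP₂ : P₂ = 6 * g ^ 2 - g₂ / 2)
    (hK : K = (P₂ ^ 2 - 12 * g * G ^ 2) / 4) :
    eval ![w + g, D + g, v + g, ζ + g] (ellP g g₂ g₃) =
      2 * (P₂ * (D * v * w * ζ) + G ^ 2 * (D * v * w + D * v * ζ + D * w * ζ + v * w * ζ)
        - K * (v + w) * (D + ζ) + G ^ 4 + K * P₂) := by
  have hg₃ : g₃ = 4 * g ^ 3 - g₂ * g - G ^ 2 := by linear_combination hG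
  rw [ellP_eq, eval_squarePoly, hK, hP₂, hg₃]
  simp only [Matrix.cons_val]
  ring

lemma eval_ellH_shift (hG : G ^ 2 = 4 * g ^ 3 - g₂ * g - g₃) (hP₂ : P₂ = 6 * g ^ 2 - g₂ / 2)
    (hK : K = (P₂ ^ 2 - 12 * g * G ^ 2) / 4) :
    eval ![D + g, v + g] (ellH g g₂ g₃) =
      K - G ^ 2 * D - v * (P₂ * D + G ^ 2) + v ^ 2 * D ^ 2 := by
  have hg₃ : g₃ = 4 * g ^ 3 - g₂ * g - G ^ 2 := by linear_combination hG
  rw [ellH_eq, eval_biquadratic, hK, hP₂, hg₃]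
  simp only [Matrix.cons_val]
  ring

/-- With `p, q = ℘(u±γ) - ℘(γ)` and `D = ℘(u) - ℘(γ)`. The bracket is antisymmetric in `p` and `q`,
hence `q - p` times a polynomial in `p + q` and `pq`; the hypotheses replace all three. -/
lemma face_identity (hD : D ≠ 0) (h₁ : D ^ 2 * (p * q) = K - G ^ 2 * D)
    (h₂ : D ^ 2 * (q - p) = G * Y) (h₃ : D ^ 2 * (p + q) = P₂ * D + G ^ 2) :
    D ^ 3 * ((q - v) * (q - w) * (K - G ^ 2 * p - D * ζ * p ^ 2)
        - (p - v) * (p - w) * (K - G ^ 2 * q - D * ζ * q ^ 2)) =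
      G * Y * (P₂ * (D * v * w * ζ) + G ^ 2 * (D * v * w + D * v * ζ + D * w * ζ + v * w * ζ)
        - K * (v + w) * (D + ζ) + G ^ 4 + K * P₂) := by
  refine mul_left_cancel₀ hD ?_
  linear_combination D ^ 2 * (K * (p + q) - G ^ 2 * (p * q) - K * (v + w)
      - D * ζ * (v + w) * (p * q) + v * w * G ^ 2 + v * w * D * ζ * (p + q)) * h₂
    + G * Y * ((K + v * w * D * ζ) * h₃ - (G ^ 2 + D * ζ * (v + w)) * h₁)

end Identities

variable (L : PeriodPair)

/-- `℘''`, expressed in terms of `℘`. -/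
def ellSnd (z : ℂ) : ℂ := 6 * L.weierstrassP z ^ 2 - L.g₂ / 2

/-- The value at infinity of the biquadratic `ellH`, taken at `℘`. -/
def ellConst (z : ℂ) : ℂ :=
  (ellSnd L z ^ 2 - 12 * L.weierstrassP z * L.derivWeierstrassP z ^ 2) / 4

variable {L} {u γ : ℂ}

lemma weierstrassP_sub_ne_zero (hu : u ∉ L.lattice) (hγ : γ ∉ L.lattice)
    (h₁ : u + γ ∉ L.lattice) (h₂ : u - γ ∉ L.lattice) :
    L.weierstrassP u - L.weierstrassP γ ≠ 0 := by
  rw [sub_ne_zero, Ne, weierstrassP_eq_iff L hu hγ]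
  tauto

lemma weierstrassP_sub_sub (hu : u ∉ L.lattice) (hγ : γ ∉ L.lattice)
    (h₁ : u + γ ∉ L.lattice) (h₂ : u - γ ∉ L.lattice) :
    (L.weierstrassP u - L.weierstrassP γ) ^ 2 *
      (L.weierstrassP (u - γ) - L.weierstrassP (u + γ)) =
      L.derivWeierstrassP γ * L.derivWeierstrassP u := by
  have e₁ := weierstrassP_add L hu hγ h₁ h₂
  have e₂ := weierstrassP_add L hu (b := -γ) (by rwa [neg_mem_iff]) (by rwa [← sub_eq_add_neg])
    (by rwa [sub_neg_eq_add])
  rw [L.weierstrassP_neg, L.derivWeierstrassP_neg, ← sub_eq_add_neg] at e₂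
  linear_combination (e₂ - e₁) / 4

lemma weierstrassP_add_add (hu : u ∉ L.lattice) (hγ : γ ∉ L.lattice)
    (h₁ : u + γ ∉ L.lattice) (h₂ : u - γ ∉ L.lattice) :
    (L.weierstrassP u - L.weierstrassP γ) ^ 2 * ((L.weierstrassP (u + γ) - L.weierstrassP γ) +
      (L.weierstrassP (u - γ) - L.weierstrassP γ)) =
      ellSnd L γ * (L.weierstrassP u - L.weierstrassP γ) + L.derivWeierstrassP γ ^ 2 := by
  have e₁ := weierstrassP_add L hu hγ h₁ h₂
  have e₂ := weierstrassP_add L hu (b := -γ) (by rwa [neg_mem_iff]) (by rwa [← sub_eq_add_neg])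
    (by rwa [sub_neg_eq_add])
  rw [L.weierstrassP_neg, L.derivWeierstrassP_neg, ← sub_eq_add_neg] at e₂
  have f₁ := L.derivWeierstrassP_sq u hu
  have f₂ := L.derivWeierstrassP_sq γ hγ
  rw [ellSnd]
  linear_combination (e₂ + e₁) / 4 + f₁ / 2 - f₂ / 2

/-- From `4pq = (p+q)² - (q-p)²` with the sum and difference already known, and `℘'(u)²` expanded in
powers of `℘(u) - ℘(γ)`. -/
lemma weierstrassP_add_mul (hu : u ∉ L.lattice) (hγ : γ ∉ L.lattice)
    (h₁ : u + γ ∉ L.lattice) (h₂ : u - γ ∉ L.lattice) :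
    (L.weierstrassP u - L.weierstrassP γ) ^ 2 * ((L.weierstrassP (u + γ) - L.weierstrassP γ) *
      (L.weierstrassP (u - γ) - L.weierstrassP γ)) =
      ellConst L γ - L.derivWeierstrassP γ ^ 2 * (L.weierstrassP u - L.weierstrassP γ) := by
  have hD := weierstrassP_sub_ne_zero hu hγ h₁ h₂
  have e₁ := weierstrassP_add_add hu hγ h₁ h₂
  have e₂ := weierstrassP_sub_sub hu hγ h₁ h₂
  have f₁ := L.derivWeierstrassP_sq u hu
  have f₂ := L.derivWeierstrassP_sq γ hγ
  rw [ellConst]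
  refine mul_left_cancel₀ (pow_ne_zero 2 hD) ?_
  have e₃ : (4 : ℂ) * ((L.weierstrassP u - L.weierstrassP γ) ^ 2 *
      ((L.weierstrassP u - L.weierstrassP γ) ^ 2 * ((L.weierstrassP (u + γ) - L.weierstrassP γ) *
      (L.weierstrassP (u - γ) - L.weierstrassP γ)))) =
      (ellSnd L γ * (L.weierstrassP u - L.weierstrassP γ) + L.derivWeierstrassP γ ^ 2) ^ 2 -
      (L.derivWeierstrassP γ * L.derivWeierstrassP u) ^ 2 := by
    rw [← e₁, ← e₂]; ring
  have e₄ : (L.derivWeierstrassP γ * L.derivWeierstrassP u) ^ 2 = L.derivWeierstrassP γ ^ 2 *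
      (4 * (L.weierstrassP u - L.weierstrassP γ) ^ 3
        + 12 * L.weierstrassP γ * (L.weierstrassP u - L.weierstrassP γ) ^ 2
        + 2 * ellSnd L γ * (L.weierstrassP u - L.weierstrassP γ)
        + L.derivWeierstrassP γ ^ 2) := by
    rw [ellSnd]
    linear_combination L.derivWeierstrassP γ ^ 2 * (f₁ - f₂)
  linear_combination (e₃ - e₄) / 4

/-- The product formula turns the left side into `(℘(u+γ) - ℘(v))(℘(u-γ) - ℘(v))` times sigma
factors. So `H` is the quadratic in `℘(v)` with roots `℘(u±γ)`, scaled by `(℘(u) - ℘(γ))²`. -/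
lemma factorNum_mul_factorDen_eq (L : PeriodPair) {γ u v : ℂ} (hu : u ∉ L.lattice)
    (hγ : γ ∉ L.lattice) (hv : v ∉ L.lattice) (h₁ : u + γ ∉ L.lattice) (h₂ : u - γ ∉ L.lattice) :
    factorNum (weierstrassSigma L) u v (-γ) * factorDen (weierstrassSigma L) u v (-γ) =
      weierstrassSigma L u ^ 4 * weierstrassSigma L γ ^ 4 * weierstrassSigma L v ^ 4 *
        eval ![L.weierstrassP u, L.weierstrassP v] (ellH (L.weierstrassP γ) L.g₂ L.g₃) := by
  have hH := eval_ellH_shift (D := L.weierstrassP u - L.weierstrassP γ)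
    (v := L.weierstrassP v - L.weierstrassP γ) (L.derivWeierstrassP_sq γ hγ) rfl
    (K := ellConst L γ) rfl
  rw [sub_add_cancel, sub_add_cancel] at hH
  have s₁ := weierstrassSigma_add_mul_sub L h₁ hv
  have s₂ := weierstrassSigma_add_mul_sub L h₂ hv
  have s₃ := weierstrassSigma_add_mul_sub L hu hγ
  have e₁ := weierstrassP_add_add hu hγ h₁ h₂
  have e₂ := weierstrassP_add_mul hu hγ h₁ h₂
  rw [ellSnd] at e₁
  have hs : factorNum (weierstrassSigma L) u v (-γ) * factorDen (weierstrassSigma L) u v (-γ) =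
      weierstrassSigma L (u + γ + v) * weierstrassSigma L (u + γ - v) *
      (weierstrassSigma L (u - γ + v) * weierstrassSigma L (u - γ - v)) := by
    rw [factorNum, factorDen, show u + v + -γ = u - γ + v by ring,
      show u - v + -γ = u - γ - v by ring, show u + v - -γ = u + γ + v by ring,
      show u - v - -γ = u + γ - v by ring, mul_comm]
  rw [hs, hH, s₁, s₂, ← e₂, ← e₁]
  linear_combination (weierstrassSigma L v ^ 4 *
    ((L.weierstrassP (u + γ) - L.weierstrassP v) * (L.weierstrassP (u - γ) - L.weierstrassP v)) *
    (weierstrassSigma L (u + γ) * weierstrassSigma L (u - γ) - weierstrassSigma L u ^ 2 *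
      weierstrassSigma L γ ^ 2 * (L.weierstrassP u - L.weierstrassP γ))) * s₃

/-- The product formula at `(u+γ, γ)` involves `σ(u+2γ)σ(u)`, the one at `(u, γ)` involves
`σ(u+γ)σ(u-γ)`. Combining the first with the square of the second eliminates `σ(u+γ)`. -/
lemma weierstrassSigma_tangent (L : PeriodPair) {u γ : ℂ} (hu : u ∉ L.lattice) (hγ : γ ∉ L.lattice)
    (h₁ : u + γ ∉ L.lattice) :
    weierstrassSigma L (u + 2 * γ) * weierstrassSigma L (u - γ) ^ 2 =
      -weierstrassSigma L γ ^ 6 * weierstrassSigma L u ^ 3 *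
        ((L.weierstrassP u - L.weierstrassP γ) ^ 2 *
          (L.weierstrassP (u + γ) - L.weierstrassP γ)) := by
  have s₁ := weierstrassSigma_add_mul_sub L h₁ hγ
  have s₂ := weierstrassSigma_add_mul_sub L hu hγ
  rw [show u + γ + γ = u + 2 * γ by ring, add_sub_cancel_right] at s₁
  refine mul_right_cancel₀ ((weierstrassSigma_eq_zero_iff L).not.2 hu) ?_
  linear_combination weierstrassSigma L (u - γ) ^ 2 * s₁ - weierstrassSigma L γ ^ 2 *
    (L.weierstrassP (u + γ) - L.weierstrassP γ) *
    (weierstrassSigma L (u + γ) * weierstrassSigma L (u - γ) - weierstrassSigma L u ^ 2 *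
      weierstrassSigma L γ ^ 2 * (L.weierstrassP u - L.weierstrassP γ)) * s₂

/-- One of the two products in the face identity. -/
lemma sigma_product_eq (L : PeriodPair) {u γ v w z : ℂ} (hu : u ∉ L.lattice) (hγ : γ ∉ L.lattice)
    (hv : v ∉ L.lattice) (hw : w ∉ L.lattice) (hz : z ∉ L.lattice)
    (h₁ : u + γ ∉ L.lattice) (h₂ : u - γ ∉ L.lattice) (h₃ : u + 2 * γ ∉ L.lattice) :
    (weierstrassSigma L (u + 2 * γ + z) * weierstrassSigma L (u + 2 * γ - z)) *
      (weierstrassSigma L (u - γ + v) * weierstrassSigma L (u - γ - v)) *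
      (weierstrassSigma L (u - γ + w) * weierstrassSigma L (u - γ - w)) =
    -(weierstrassSigma L γ ^ 12 * weierstrassSigma L u ^ 6 *
      (weierstrassSigma L z * weierstrassSigma L v * weierstrassSigma L w) ^ 2) *
      ((L.weierstrassP u - L.weierstrassP γ) ^ 3 *
      ((L.weierstrassP (u - γ) - L.weierstrassP v) * (L.weierstrassP (u - γ) - L.weierstrassP w) *
      (ellConst L γ - L.derivWeierstrassP γ ^ 2 * (L.weierstrassP (u + γ) - L.weierstrassP γ)
        - (L.weierstrassP u - L.weierstrassP γ) * (L.weierstrassP z - L.weierstrassP γ) *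
          (L.weierstrassP (u + γ) - L.weierstrassP γ) ^ 2))) := by
  -- The product relation centred at `u + γ` links `℘(u+2γ)` and `℘(u)`, so `℘(u+2γ)` can be
  -- eliminated in favour of `℘(u+γ)`.
  have e := weierstrassP_add_mul h₁ hγ (by rwa [add_assoc, ← two_mul])
    (by rwa [add_sub_cancel_right])
  rw [add_sub_cancel_right, add_assoc, ← two_mul] at e
  have t := weierstrassSigma_tangent L hu hγ h₁
  rw [weierstrassSigma_add_mul_sub L h₃ hz, weierstrassSigma_add_mul_sub L h₂ hv,
    weierstrassSigma_add_mul_sub L h₂ hw, ← e]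
  linear_combination (-(weierstrassSigma L z * weierstrassSigma L v * weierstrassSigma L w) ^ 2 *
    ((L.weierstrassP (u + 2 * γ) - L.weierstrassP z) *
      (L.weierstrassP (u - γ) - L.weierstrassP v) * (L.weierstrassP (u - γ) - L.weierstrassP w)) *
    (weierstrassSigma L (u + 2 * γ) * weierstrassSigma L (u - γ) ^ 2
      -weierstrassSigma L γ ^ 6 * weierstrassSigma L u ^ 3 *
        ((L.weierstrassP u - L.weierstrassP γ) ^ 2 *
          (L.weierstrassP (u + γ) - L.weierstrassP γ)))) * t

lemma face_sigma_of_generic (L : PeriodPair) {u γ v w z : ℂ} (hu : u ∉ L.lattice)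
    (hγ : γ ∉ L.lattice) (hv : v ∉ L.lattice) (hw : w ∉ L.lattice) (hz : z ∉ L.lattice)
    (h₁ : u + γ ∉ L.lattice) (h₂ : u - γ ∉ L.lattice) (h₃ : u + 2 * γ ∉ L.lattice)
    (h₄ : u - 2 * γ ∉ L.lattice) :
    factorNum (weierstrassSigma L) u z (2 * γ) * factorNum (weierstrassSigma L) u v (-γ) *
        factorNum (weierstrassSigma L) u w (-γ) -
      factorDen (weierstrassSigma L) u z (2 * γ) * factorDen (weierstrassSigma L) u v (-γ) *
        factorDen (weierstrassSigma L) u w (-γ) =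
    -(1 / 2) * (weierstrassSigma L γ ^ 12 * weierstrassSigma L u ^ 6 *
      (weierstrassSigma L z * weierstrassSigma L v * weierstrassSigma L w) ^ 2) *
      (L.derivWeierstrassP γ * L.derivWeierstrassP u) *
      eval ![L.weierstrassP w, L.weierstrassP u, L.weierstrassP v, L.weierstrassP z]
        (ellP (L.weierstrassP γ) L.g₂ L.g₃) := by
  have hγ' : -γ ∉ L.lattice := by rwa [neg_mem_iff]
  have s₁ := sigma_product_eq L hu hγ hv hw hz h₁ h₂ h₃
  -- The product of denominators is the product of numerators with `γ` replaced by `-γ`, which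
  -- exchanges `p` and `q` in `face_identity`.
  have s₂ := sigma_product_eq L hu hγ' hv hw hz (by rwa [← sub_eq_add_neg])
    (by rwa [sub_neg_eq_add]) (by rwa [mul_neg, ← sub_eq_add_neg])
  have hK : ellConst L (-γ) = ellConst L γ := by
    simp only [ellConst, ellSnd, L.weierstrassP_neg, L.derivWeierstrassP_neg]; ring
  have hσ : weierstrassSigma L (-γ) ^ 12 = weierstrassSigma L γ ^ 12 := by
    rw [weierstrassSigma_neg]; ring
  have hG : (-L.derivWeierstrassP γ) ^ 2 = L.derivWeierstrassP γ ^ 2 := by ring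
  rw [hK, hσ, L.weierstrassP_neg, L.derivWeierstrassP_neg, hG, mul_neg, ← sub_eq_add_neg,
    ← sub_eq_add_neg, sub_neg_eq_add] at s₂
  have hP := eval_ellP_shift (D := L.weierstrassP u - L.weierstrassP γ)
    (v := L.weierstrassP v - L.weierstrassP γ) (w := L.weierstrassP w - L.weierstrassP γ)
    (ζ := L.weierstrassP z - L.weierstrassP γ) (L.derivWeierstrassP_sq γ hγ) rfl
    (K := ellConst L γ) rfl
  simp only [sub_add_cancel] at hP
  have hF := face_identity (v := L.weierstrassP v - L.weierstrassP γ)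
    (w := L.weierstrassP w - L.weierstrassP γ) (ζ := L.weierstrassP z - L.weierstrassP γ)
    (weierstrassP_sub_ne_zero hu hγ h₁ h₂) (weierstrassP_add_mul hu hγ h₁ h₂)
    (by rw [sub_sub_sub_cancel_right]; exact weierstrassP_sub_sub hu hγ h₁ h₂)
    (weierstrassP_add_add hu hγ h₁ h₂)
  simp only [sub_sub_sub_cancel_right] at hF
  simp only [factorNum, factorDen, show u + z + 2 * γ = u + 2 * γ + z by ring,
    show u - z + 2 * γ = u + 2 * γ - z by ring, show u + z - 2 * γ = u - 2 * γ + z by ring,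
    show u - z - 2 * γ = u - 2 * γ - z by ring, show u + v + -γ = u - γ + v by ring,
    show u - v + -γ = u - γ - v by ring, show u + v - -γ = u + γ + v by ring,
    show u - v - -γ = u + γ - v by ring, show u + w + -γ = u - γ + w by ring,
    show u - w + -γ = u - γ - w by ring, show u + w - -γ = u + γ + w by ring,
    show u - w - -γ = u + γ - w by ring]
  rw [s₁, s₂, hP]
  simp only [ellSnd] at *
  linear_combination -(weierstrassSigma L γ ^ 12 * weierstrassSigma L u ^ 6 *
      (weierstrassSigma L z * weierstrassSigma L v * weierstrassSigma L w) ^ 2) * hF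

/-- For `A, B = ℘(u∓2γ)` one has `(A-x)(B-y) - (A-y)(B-x) = (A-B)(x-y)`, and `A - B` comes from the
addition theorem with `2γ` in place of `γ`. -/
lemma cross_sigma_of_generic (L : PeriodPair) {u γ z z' : ℂ} (hu : u ∉ L.lattice)
    (hγ : γ ∉ L.lattice) (hγ₂ : 2 * γ ∉ L.lattice) (hz : z ∉ L.lattice) (hz' : z' ∉ L.lattice)
    (h₃ : u + 2 * γ ∉ L.lattice) (h₄ : u - 2 * γ ∉ L.lattice) :
    factorDen (weierstrassSigma L) u z (2 * γ) * factorNum (weierstrassSigma L) u z' (2 * γ) -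
      factorDen (weierstrassSigma L) u z' (2 * γ) * factorNum (weierstrassSigma L) u z (2 * γ) =
    L.derivWeierstrassP u * L.derivWeierstrassP (2 * γ) * L.derivWeierstrassP γ ^ 4 *
      weierstrassSigma L γ ^ 16 * weierstrassSigma L u ^ 4 *
      (weierstrassSigma L z * weierstrassSigma L z') ^ 2 *
      (L.weierstrassP z - L.weierstrassP z') := by
  have s := weierstrassSigma_add_mul_sub L hu hγ₂
  have e := weierstrassP_sub_sub hu hγ₂ h₃ h₄
  simp only [factorNum, factorDen, show u + z + 2 * γ = u + 2 * γ + z by ring,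
    show u - z + 2 * γ = u + 2 * γ - z by ring, show u + z - 2 * γ = u - 2 * γ + z by ring,
    show u - z - 2 * γ = u - 2 * γ - z by ring, show u + z' + 2 * γ = u + 2 * γ + z' by ring,
    show u - z' + 2 * γ = u + 2 * γ - z' by ring, show u + z' - 2 * γ = u - 2 * γ + z' by ring,
    show u - z' - 2 * γ = u - 2 * γ - z' by ring]
  rw [weierstrassSigma_add_mul_sub L h₃ hz, weierstrassSigma_add_mul_sub L h₄ hz,
    weierstrassSigma_add_mul_sub L h₃ hz', weierstrassSigma_add_mul_sub L h₄ hz']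
  have s₂ := weierstrassSigma_two_mul L hγ
  have s₄ : L.derivWeierstrassP γ ^ 4 * weierstrassSigma L γ ^ 16 =
      weierstrassSigma L (2 * γ) ^ 4 := by rw [s₂]; ring
  have e' : L.derivWeierstrassP u * L.derivWeierstrassP (2 * γ) * L.derivWeierstrassP γ ^ 4 *
      weierstrassSigma L γ ^ 16 = weierstrassSigma L (2 * γ) ^ 4 *
      ((L.weierstrassP u - L.weierstrassP (2 * γ)) ^ 2 *
      (L.weierstrassP (u - 2 * γ) - L.weierstrassP (u + 2 * γ))) := by
    rw [e, ← s₄]; ring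
  rw [e']
  linear_combination (weierstrassSigma L z * weierstrassSigma L z') ^ 2 *
    (L.weierstrassP z - L.weierstrassP z') *
    (L.weierstrassP (u - 2 * γ) - L.weierstrassP (u + 2 * γ)) *
    (weierstrassSigma L (u + 2 * γ) * weierstrassSigma L (u - 2 * γ) - weierstrassSigma L u ^ 2 *
      weierstrassSigma L (2 * γ) ^ 2 * (L.weierstrassP u - L.weierstrassP (2 * γ))) * s

end PointEq
end

/-! ### Removal of the exceptional shifts by continuity, and the point equivalence in the elliptic
case -/

noncomputable section

namespace PointEq

open MvPolynomial

variable (L : PeriodPair)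

/-- The points at which one of the shifts by `±γ`, `±2γ` meets the lattice. -/
def badShifts (γ : ℂ) : Set ℂ :=
  ⋃ i : Fin 5, (fun u => u + ![0, γ, -γ, 2 * γ, -(2 * γ)] i) ⁻¹' L.lattice

lemma countable_badShifts (γ : ℂ) : (badShifts L γ).Countable :=
  Set.countable_iUnion fun _ =>
    (countable_lattice L).preimage_of_injOn (add_left_injective _).injOn

variable {L}

lemma notMem_of_notMem_badShifts {γ u : ℂ} (h : u ∉ badShifts L γ) :
    u ∉ L.lattice ∧ u + γ ∉ L.lattice ∧ u - γ ∉ L.lattice ∧ u + 2 * γ ∉ L.lattice ∧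
      u - 2 * γ ∉ L.lattice := by
  simp only [badShifts, Set.mem_iUnion, not_exists, Set.mem_preimage, SetLike.mem_coe] at h
  have h0 := h 0
  have h1 := h 1
  have h2 := h 2
  have h3 := h 3
  have h4 := h 4
  simp only [Matrix.cons_val, add_zero, ← sub_eq_add_neg] at h0 h1 h2 h3 h4
  exact ⟨h0, h1, h2, h3, h4⟩

variable {γ u v w z z' : ℂ}

lemma continuous_weierstrassSigma : Continuous (weierstrassSigma L) :=
  (differentiable_weierstrassSigma L).continuous

lemma continuous_factorNum (p α : ℂ) :
    Continuous fun u => factorNum (weierstrassSigma L) u p α := by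
  have := continuous_weierstrassSigma (L := L)
  unfold factorNum
  fun_prop

lemma continuous_factorDen (p α : ℂ) :
    Continuous fun u => factorDen (weierstrassSigma L) u p α := by
  have := continuous_weierstrassSigma (L := L)
  unfold factorDen
  fun_prop

lemma continuousAt_weierstrassP (hu : u ∉ L.lattice) : ContinuousAt L.weierstrassP u :=
  (hasDerivAt_weierstrassP L hu).continuousAt

lemma continuousAt_derivWeierstrassP (hu : u ∉ L.lattice) : ContinuousAt L.derivWeierstrassP u :=
  (hasDerivAt_derivWeierstrassP L hu).continuousAt

lemma edge_sigma (hu : u ∉ L.lattice) (hγ : γ ∉ L.lattice) (hv : v ∉ L.lattice) :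
    factorNum (weierstrassSigma L) u v (-γ) * factorDen (weierstrassSigma L) u v (-γ) =
      weierstrassSigma L u ^ 4 * weierstrassSigma L γ ^ 4 * weierstrassSigma L v ^ 4 *
        eval ![L.weierstrassP u, L.weierstrassP v] (ellH (L.weierstrassP γ) L.g₂ L.g₃) := by
  have c₁ := continuous_factorNum (L := L) v (-γ)
  have c₂ := continuous_factorDen (L := L) v (-γ)
  have c₃ := continuous_weierstrassSigma (L := L)
  have c₄ := continuousAt_weierstrassP hu
  refine eq_of_eq_off_countable (countable_badShifts L γ) (x := u)
    (f := fun u => factorNum (weierstrassSigma L) u v (-γ) * factorDen (weierstrassSigma L) u v (-γ))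
    (g := fun u => weierstrassSigma L u ^ 4 * weierstrassSigma L γ ^ 4 * weierstrassSigma L v ^ 4 *
        eval ![L.weierstrassP u, L.weierstrassP v] (ellH (L.weierstrassP γ) L.g₂ L.g₃))
    (by fun_prop) ?_ fun x hx => ?_
  · simp only [ellH_eq, eval_biquadratic, Matrix.cons_val]
    fun_prop
  · obtain ⟨h0, h1, h2, -, -⟩ := notMem_of_notMem_badShifts hx
    exact factorNum_mul_factorDen_eq L h0 hγ hv h1 h2

lemma face_sigma (hu : u ∉ L.lattice) (hγ : γ ∉ L.lattice) (hv : v ∉ L.lattice)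
    (hw : w ∉ L.lattice) (hz : z ∉ L.lattice) :
    factorNum (weierstrassSigma L) u z (2 * γ) * factorNum (weierstrassSigma L) u v (-γ) *
        factorNum (weierstrassSigma L) u w (-γ) -
      factorDen (weierstrassSigma L) u z (2 * γ) * factorDen (weierstrassSigma L) u v (-γ) *
        factorDen (weierstrassSigma L) u w (-γ) =
    -(1 / 2) * (weierstrassSigma L γ ^ 12 * weierstrassSigma L u ^ 6 *
      (weierstrassSigma L z * weierstrassSigma L v * weierstrassSigma L w) ^ 2) *
      (L.derivWeierstrassP γ * L.derivWeierstrassP u) *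
      eval ![L.weierstrassP w, L.weierstrassP u, L.weierstrassP v, L.weierstrassP z]
        (ellP (L.weierstrassP γ) L.g₂ L.g₃) := by
  have c₁ (p α : ℂ) := continuous_factorNum (L := L) p α
  have c₂ (p α : ℂ) := continuous_factorDen (L := L) p α
  have c₃ := continuous_weierstrassSigma (L := L)
  have c₄ := continuousAt_weierstrassP hu
  have c₅ := continuousAt_derivWeierstrassP hu
  have n (p α : ℂ) := (c₁ p α).continuousAt (x := u)
  have d (p α : ℂ) := (c₂ p α).continuousAt (x := u)
  refine eq_of_eq_off_countable (countable_badShifts L γ) (x := u)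
    (((n z _).mul (n v _)).mul (n w _) |>.sub (((d z _).mul (d v _)).mul (d w _)))
    (g := fun u => -(1 / 2) * (weierstrassSigma L γ ^ 12 * weierstrassSigma L u ^ 6 *
      (weierstrassSigma L z * weierstrassSigma L v * weierstrassSigma L w) ^ 2) *
      (L.derivWeierstrassP γ * L.derivWeierstrassP u) *
      eval ![L.weierstrassP w, L.weierstrassP u, L.weierstrassP v, L.weierstrassP z]
        (ellP (L.weierstrassP γ) L.g₂ L.g₃)) ?_ fun x hx => ?_
  · simp only [ellP_eq, eval_squarePoly, Matrix.cons_val]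
    fun_prop
  · obtain ⟨h0, h1, h2, h3, h4⟩ := notMem_of_notMem_badShifts hx
    exact face_sigma_of_generic L h0 hγ hv hw hz h1 h2 h3 h4

lemma cross_sigma (hu : u ∉ L.lattice) (hγ : γ ∉ L.lattice) (hγ₂ : 2 * γ ∉ L.lattice)
    (hz : z ∉ L.lattice) (hz' : z' ∉ L.lattice) :
    factorDen (weierstrassSigma L) u z (2 * γ) * factorNum (weierstrassSigma L) u z' (2 * γ) -
      factorDen (weierstrassSigma L) u z' (2 * γ) * factorNum (weierstrassSigma L) u z (2 * γ) =
    L.derivWeierstrassP u * L.derivWeierstrassP (2 * γ) * L.derivWeierstrassP γ ^ 4 *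
      weierstrassSigma L γ ^ 16 * weierstrassSigma L u ^ 4 *
      (weierstrassSigma L z * weierstrassSigma L z') ^ 2 *
      (L.weierstrassP z - L.weierstrassP z') := by
  have n (p α : ℂ) := (continuous_factorNum (L := L) p α).continuousAt (x := u)
  have d (p α : ℂ) := (continuous_factorDen (L := L) p α).continuousAt (x := u)
  have c₃ := continuous_weierstrassSigma (L := L)
  have c₅ := continuousAt_derivWeierstrassP hu
  refine eq_of_eq_off_countable (countable_badShifts L γ) (x := u)
    (((d z _).mul (n z' _)).sub ((d z' _).mul (n z _)))
    (g := fun u => L.derivWeierstrassP u * L.derivWeierstrassP (2 * γ) *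
      L.derivWeierstrassP γ ^ 4 * weierstrassSigma L γ ^ 16 * weierstrassSigma L u ^ 4 *
      (weierstrassSigma L z * weierstrassSigma L z') ^ 2 *
      (L.weierstrassP z - L.weierstrassP z')) (by fun_prop) fun x hx => ?_
  obtain ⟨h0, h1, h2, h3, h4⟩ := notMem_of_notMem_badShifts hx
  exact cross_sigma_of_generic L h0 hγ hγ₂ hz hz' h3 h4

/-- The derivative of the duplication formula in disguise. It turns nonvanishing of the edge form
into the condition `4γ ∉ Λ`. -/
lemma ellLead_weierstrassP (hγ : γ ∉ L.lattice) (hγ₂ : 2 * γ ∉ L.lattice) :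
    ellLead (L.weierstrassP γ) L.g₂ L.g₃ =
      -4 * L.derivWeierstrassP γ ^ 3 * L.derivWeierstrassP (2 * γ) := by
  have h := derivWeierstrassP_two_mul L hγ hγ₂
  have e := L.derivWeierstrassP_sq γ hγ
  have e4 : L.derivWeierstrassP γ ^ 4 =
      (4 * L.weierstrassP γ ^ 3 - L.g₂ * L.weierstrassP γ - L.g₃) ^ 2 := by rw [← e]; ring
  rw [e, e4] at h
  rw [ellLead]
  linear_combination h

lemma notMem_of_four_mul (h : 4 * γ ∉ L.lattice) : γ ∉ L.lattice ∧ 2 * γ ∉ L.lattice := by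
  have h2 : 2 * γ ∉ L.lattice := fun h' => h (by convert add_mem h' h' using 1; ring)
  exact ⟨fun h' => h2 (by rw [two_mul]; exact add_mem h' h'), h2⟩

lemma derivWeierstrassP_ne_zero_of_four_mul (h : 4 * γ ∉ L.lattice) :
    L.derivWeierstrassP γ ≠ 0 ∧ L.derivWeierstrassP (2 * γ) ≠ 0 := by
  obtain ⟨h1, h2⟩ := notMem_of_four_mul h
  refine ⟨(derivWeierstrassP_ne_zero_iff L h1).2 h2, (derivWeierstrassP_ne_zero_iff L h2).2 ?_⟩
  rwa [← mul_assoc, show (2 : ℂ) * 2 = 4 by norm_num]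

lemma ellLead_ne_zero (h : 4 * γ ∉ L.lattice) : ellLead (L.weierstrassP γ) L.g₂ L.g₃ ≠ 0 := by
  obtain ⟨h1, h2⟩ := notMem_of_four_mul h
  obtain ⟨h3, h4⟩ := derivWeierstrassP_ne_zero_of_four_mul h
  rw [ellLead_weierstrassP h1 h2]
  simp [h3, h4]

lemma notMem_of_deriv_ne_zero (h : deriv L.weierstrassP u ≠ 0) : u ∉ L.lattice := by
  rw [L.deriv_weierstrassP] at h
  exact fun hu => h (L.derivWeierstrassP_coe ⟨u, hu⟩)

theorem pointEquivalentVia_ell (hγ : 4 * γ ∉ L.lattice) :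
    PointEquivalentVia L.weierstrassP
      (4 * L.derivWeierstrassP γ ^ 2 * L.derivWeierstrassP (2 * γ))
      (sigmaLattice (weierstrassSigma L) γ)
      (rationalLattice (ellP (L.weierstrassP γ) L.g₂ L.g₃) (ellH (L.weierstrassP γ) L.g₂ L.g₃)) := by
  obtain ⟨g1, g2⟩ := notMem_of_four_mul hγ
  obtain ⟨n1, n2⟩ := derivWeierstrassP_ne_zero_of_four_mul hγ
  refine pointEquivalentVia_of_window
    (mul_ne_zero (mul_ne_zero (by norm_num) (pow_ne_zero 2 n1)) n2)
    fun x₀ x₁ x₂ x₃ x₄ h₀ h₁ h₂ h₃ h₄ hdom => ?_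
  replace h₀ := notMem_of_deriv_ne_zero h₀
  replace h₁ := notMem_of_deriv_ne_zero h₁
  replace h₂ := notMem_of_deriv_ne_zero h₂
  replace h₃ := notMem_of_deriv_ne_zero h₃
  replace h₄ := notMem_of_deriv_ne_zero h₄
  rw [L.deriv_weierstrassP]
  simp only [rationalLattice]
  -- The symmetry of the square rotates the left window, so that both values of `P` have the form of
  -- `face_sigma` with centre `x₂`.
  have e₁ : eval ![L.weierstrassP x₀, L.weierstrassP x₁, L.weierstrassP x₂, L.weierstrassP x₃]
      (ellP (L.weierstrassP γ) L.g₂ L.g₃) =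
      eval ![L.weierstrassP x₁, L.weierstrassP x₂, L.weierstrassP x₃, L.weierstrassP x₀]
      (ellP (L.weierstrassP γ) L.g₂ L.g₃) := by
    simp only [ellP_eq, eval_squarePoly, Matrix.cons_val]
    ring
  have e₂ : eval ![L.weierstrassP x₁, L.weierstrassP x₂] (ellH (L.weierstrassP γ) L.g₂ L.g₃) =
      eval ![L.weierstrassP x₂, L.weierstrassP x₁] (ellH (L.weierstrassP γ) L.g₂ L.g₃) := by
    simp only [ellH_eq, eval_biquadratic, Matrix.cons_val]
    ring
  rw [e₁, e₂]
  refine sigmaLattice_window hdom (face_sigma h₂ g1 h₃ h₁ h₄) (face_sigma h₂ g1 h₃ h₁ h₀)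
    (edge_sigma h₂ g1 h₃) (edge_sigma h₂ g1 h₁) (cross_sigma h₂ g1 g2 h₄ h₀) ?_
  ring

end PointEq
end

noncomputable section

namespace PointEq

open UpperHalfPlane ModularForm ModularFormClass MatrixGroups EisensteinSeries Filter Topology

/-! ### Lattices with given invariants -/

/-- If `f` had no zero, `Δ/f` would be a modular form of weight 0, hence constant. It tends to `0`
at the cusp because `f` does not, which contradicts `Δ ≠ 0`. -/
lemma exists_eq_zero_of_coeff_zero_ne_zero (f : ModularForm 𝒮ℒ 12)
    (hf : (qExpansion 1 f).coeff 0 ≠ 0) : ∃ z, f z = 0 := by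
  by_contra! hne
  have hlim : Tendsto f atImInfty (𝓝 ((qExpansion 1 f).coeff 0)) := by
    have hval := qExpansion_coeff_zero (f := f) one_pos
      (ModularFormClass.analyticAt_cuspFunction_zero _ one_pos one_mem_strictPeriods_SL)
      (SlashInvariantFormClass.periodic_comp_ofComplex _ one_mem_strictPeriods_SL)
    rw [hval]
    obtain ⟨c, hc, hO⟩ := exp_decay_sub_atImInfty' f
    have hexp : Tendsto (fun τ : ℍ => Real.exp (-c * τ.im)) atImInfty (𝓝 0) :=
      Real.tendsto_exp_atBot.comp ((tendsto_comap (f := UpperHalfPlane.im)).const_mul_atTop_of_neg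
        (neg_lt_zero.2 hc))
    simpa using (hO.trans_tendsto hexp).add_const (valueAtInfty f)
  have hlimΔ : Tendsto ModularForm.discriminant atImInfty (𝓝 0) := discriminant_isZeroAtImInfty
  have hquot : Tendsto (fun z => ModularForm.discriminant z / f z) atImInfty (𝓝 0) := by
    have := hlimΔ.div hlim hf
    rwa [zero_div] at this
  have hslash (γ : SL(2, ℤ)) : (fun z ↦ ModularForm.discriminant z / f z) ∣[(0 : ℤ)] γ =
      fun z ↦ ModularForm.discriminant z / f z := by
    have hγ : (γ : GL (Fin 2) ℝ) ∈ 𝒮ℒ := ⟨γ, rfl⟩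
    have h0 : (0 : ℤ) = 12 - 12 := rfl
    rw [h0]
    change (⇑CuspForm.discriminant / ⇑f) ∣[(12 : ℤ) - 12] γ = ⇑CuspForm.discriminant / ⇑f
    simp_rw [div_slash_SL2, SL_slash, SlashInvariantForm.slash_action_eqn _ _ hγ]
  let g : ModularForm 𝒮ℒ 0 :=
    { toFun z := ModularForm.discriminant z / f z
      slash_action_eq' := fun _ ⟨γ, hγ⟩ ↦ hγ ▸ hslash γ
      holo' := CuspForm.discriminant.holo'.div f.holo' hne
      bdd_at_cusps' {c} hc := by
        rw [Subgroup.IsArithmetic.isCusp_iff_isCusp_SL2Z] at hc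
        rw [OnePoint.isBoundedAt_iff_forall_SL2Z hc]
        intro γ _
        rw [hslash γ]
        exact hquot.isBigO_one ℝ }
  obtain ⟨c, hc⟩ := levelOne_weight_zero_const g
  have hg (z : ℍ) : ModularForm.discriminant z / f z = c := congrFun hc z
  have hc0 : c = 0 := by
    simp only [hg] at hquot
    exact tendsto_nhds_unique tendsto_const_nhds hquot
  have h := hg UpperHalfPlane.I
  rw [hc0, div_eq_zero_iff] at h
  exact h.elim (ModularForm.discriminant_ne_zero _) (hne _)

lemma exists_mul_E₄_pow_add_mul_E₆_pow_eq_zero {p q : ℂ} (h : p + q ≠ 0) :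
    ∃ z : ℍ, p * E₄ z ^ 3 + q * E₆ z ^ 2 = 0 := by
  let f₄ : ModularForm 𝒮ℒ 12 := ModularForm.mcast (by decide) (E₄.pow 3)
  let f₆ : ModularForm 𝒮ℒ 12 := ModularForm.mcast (by decide) (E₆.pow 2)
  let f : ModularForm 𝒮ℒ 12 := p • f₄ + q • f₆
  have hfz (z : ℍ) : f z = p * E₄ z ^ 3 + q * E₆ z ^ 2 := by
    simp only [f, f₄, f₆, FunLike.coe_add, FunLike.coe_smul, Pi.add_apply, Pi.smul_apply, coe_mcast,
      coe_pow, Pi.pow_apply, smul_eq_mul]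
  have hq : qExpansion 1 f = p • (qExpansion 1 E₄) ^ 3 + q • (qExpansion 1 E₆) ^ 2 := by
    have h₄ : qExpansion 1 f₄ = (qExpansion 1 E₄) ^ 3 :=
      ModularForm.qExpansion_pow one_pos one_mem_strictPeriods_SL E₄ 3
    have h₆ : qExpansion 1 f₆ = (qExpansion 1 E₆) ^ 2 :=
      ModularForm.qExpansion_pow one_pos one_mem_strictPeriods_SL E₆ 2
    rw [← h₄, ← h₆, ← ModularForm.qExpansion_smul one_pos one_mem_strictPeriods_SL p f₄,
      ← ModularForm.qExpansion_smul one_pos one_mem_strictPeriods_SL q f₆]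
    exact ModularForm.qExpansion_add one_pos one_mem_strictPeriods_SL (p • f₄) (q • f₆)
  obtain ⟨z, hz⟩ := exists_eq_zero_of_coeff_zero_ne_zero f (by
    have h4 := E_qExpansion_coeff_zero (k := 4) (by norm_num) ⟨2, rfl⟩
    have h6 := E_qExpansion_coeff_zero (k := 6) (by norm_num) ⟨3, rfl⟩
    rw [PowerSeries.coeff_zero_eq_constantCoeff] at h4 h6
    simpa [hq, h4, h6] using h)
  exact ⟨z, by rwa [← hfz]⟩

/-- The lattice with the periods `c z` and `c`. -/
def scaledPeriodPair (c : ℂ) (hc : c ≠ 0) (z : ℍ) : PeriodPair where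
  ω₁ := c * z
  ω₂ := c
  indep := by
    rw [LinearIndependent.pair_iff]
    intro s t h
    have h1 : (s : ℂ) * z + t = 0 := by
      refine mul_left_cancel₀ hc ?_
      simp only [Complex.real_smul] at h
      linear_combination h
    have h2 := congrArg Complex.im h1
    simp only [Complex.add_im, Complex.mul_im, Complex.ofReal_re, Complex.ofReal_im, zero_mul,
      add_zero, Complex.zero_im, mul_eq_zero, coe_im, z.im_ne_zero, or_false] at h2
    subst h2
    exact ⟨rfl, by simpa using h1⟩

lemma scaledPeriodPair_G {c : ℂ} (hc : c ≠ 0) (z : ℍ) {k : ℕ} (hk : 3 ≤ k) :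
    (scaledPeriodPair c hc z).G k = (c ^ k)⁻¹ * (2 * riemannZeta k * E hk z) := by
  have h1 := tsum_eisSummand_eq_riemannZeta_mul_eisensteinSeries hk z
  have h2 : E hk z = (1 / 2 : ℂ) * eisensteinSeries (N := 1) 0 k z := rfl
  have h3 : 2 * riemannZeta k * E hk z = ∑' v : Fin 2 → ℤ, eisSummand k v z := by
    rw [h1, h2]; ring
  rw [h3, ← tsum_mul_left, PeriodPair.G,
    ← (scaledPeriodPair c hc z).latticeEquivProd.symm.toEquiv.tsum_eq,
    ← (finTwoArrowEquiv ℤ).tsum_eq]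
  refine tsum_congr fun v => ?_
  have h4 := (scaledPeriodPair c hc z).latticeEquiv_symm_apply (finTwoArrowEquiv ℤ v)
  simp only [LinearEquiv.coe_toEquiv] at h4 ⊢
  rw [h4, eisSummand, zpow_neg, zpow_natCast, ← mul_inv, ← mul_pow]
  congr 2
  change (v 0 : ℂ) * (c * z) + (v 1 : ℂ) * c = c * (v 0 * z + v 1)
  ring

lemma riemannZeta_six : riemannZeta 6 = Real.pi ^ 6 / 945 := by
  convert congr_arg ((↑) : ℝ → ℂ) (hasSum_zeta_nat (k := 3) (by norm_num)).tsum_eq using 1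
  · have := zeta_nat_eq_tsum_of_gt_one (show 1 < 6 by norm_num)
    push_cast at this ⊢
    norm_num at this ⊢
    exact this
  · rw [show bernoulli (2 * 3) = 1 / 42 by decide +kernel]
    norm_num [Nat.factorial]
    ring

/-- Two pairs with the same ratio of cube to square differ by a scaling of weights 2 and 3. If all
entries are nonzero, then `t = t³/t²` is forced; otherwise a root is extracted. -/
lemma exists_sq_eq_cube_eq {A B a b : ℂ} (hAB : A ≠ 0 ∨ B ≠ 0) (hab : a ≠ 0 ∨ b ≠ 0)
    (h : A ^ 3 * b ^ 2 = B ^ 2 * a ^ 3) : ∃ t : ℂ, t ≠ 0 ∧ t ^ 2 * A = a ∧ t ^ 3 * B = b := by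
  by_cases hA : A = 0
  · have hB := hAB.resolve_left (not_not.2 hA)
    have ha : a = 0 := by simpa [hA, hB] using h
    have hb := hab.resolve_left (not_not.2 ha)
    obtain ⟨t, ht⟩ := IsAlgClosed.exists_pow_nat_eq (b / B) (n := 3) (by norm_num)
    refine ⟨t, ?_, by rw [hA, ha, mul_zero], by rw [ht, div_mul_cancel₀ _ hB]⟩
    rintro rfl
    exact div_ne_zero hb hB (by simpa using ht.symm)
  by_cases hB : B = 0
  · have hb : b = 0 := by simpa [hA, hB] using h
    have ha := hab.resolve_right (not_not.2 hb)
    obtain ⟨t, ht⟩ := IsAlgClosed.exists_pow_nat_eq (a / A) (n := 2) (by norm_num)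
    refine ⟨t, ?_, by rw [ht, div_mul_cancel₀ _ hA], by rw [hB, hb, mul_zero]⟩
    rintro rfl
    exact div_ne_zero ha hA (by simpa using ht.symm)
  have hb : b ≠ 0 := by
    rintro rfl
    exact hab.resolve_right (by simp) (by simpa [hB] using h.symm)
  have ha : a ≠ 0 := by
    rintro rfl
    exact hb (by simpa [hA] using h)
  refine ⟨b * A / (a * B), by positivity, ?_, ?_⟩
  · field_simp
    linear_combination h
  · field_simp
    linear_combination h

/-- A zero `z` of `27b²E₄³ - a³E₆²`, whose constant term is nonzero by `h`, gives the right ratio of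
`g₂³` to `g₃²`. Rescaling the lattice of `z` and `1` by `c` with `c⁻² = t` adjusts the values
themselves. -/
theorem exists_periodPair {a b : ℂ} (h : a ^ 3 - 27 * b ^ 2 ≠ 0) :
    ∃ L : PeriodPair, L.g₂ = a ∧ L.g₃ = b := by
  obtain ⟨z, hz⟩ := exists_mul_E₄_pow_add_mul_E₆_pow_eq_zero (p := 27 * b ^ 2) (q := -a ^ 3)
    (fun h' => h (by linear_combination -h'))
  have hπ : (Real.pi : ℂ) ≠ 0 := by exact_mod_cast Real.pi_ne_zero
  have hE : E₄ z ≠ 0 ∨ E₆ z ≠ 0 := by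
    by_contra! h0
    have := discriminant_eq_E₄_cube_sub_E₆_sq z
    rw [h0.1, h0.2] at this
    exact ModularForm.discriminant_ne_zero z (by simpa using this)
  obtain ⟨t, ht, h₂, h₃⟩ := exists_sq_eq_cube_eq (A := 4 * Real.pi ^ 4 / 3 * E₄ z)
    (B := 8 * Real.pi ^ 6 / 27 * E₆ z) (a := a) (b := b)
    (hE.imp (mul_ne_zero (by simp [hπ])) (mul_ne_zero (by simp [hπ])))
    (by
      by_contra! h0
      exact h (by simp [h0.1, h0.2]))
    (by linear_combination (64 * Real.pi ^ 12 / 729 : ℂ) * hz)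
  obtain ⟨c, hc⟩ := IsAlgClosed.exists_pow_nat_eq t⁻¹ (n := 2) (by norm_num)
  have hc0 : c ≠ 0 := by
    rintro rfl
    exact inv_ne_zero ht (by simpa using hc.symm)
  have ht' : (c ^ 2)⁻¹ = t := by rw [hc, inv_inv]
  refine ⟨scaledPeriodPair c hc0 z, ?_, ?_⟩
  · rw [PeriodPair.g₂, scaledPeriodPair_G hc0 z (by norm_num), ← h₂, ← ht']
    have := riemannZeta_four
    push_cast
    rw [this]
    field_simp
    ring
  · rw [PeriodPair.g₃, scaledPeriodPair_G hc0 z (by norm_num), ← h₃, ← ht']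
    have := riemannZeta_six
    push_cast
    rw [this]
    field_simp
    ring

end PointEq
end

noncomputable section

namespace PointEq

open MvPolynomial

/-! ### The quartic of a polynomial with the symmetry of a square -/

/-- `quarticDiscr` in terms of the coefficients of the quartic. -/
def discrForm (r₄ r₃ r₂ r₁ r₀ : ℂ) : ℂ :=
  4 * (12 * r₄ * r₀ - 3 * r₃ * r₁ + r₂ ^ 2) ^ 3
    - (72 * r₄ * r₂ * r₀ + 9 * r₃ * r₂ * r₁ - 27 * r₄ * r₁ ^ 2 - 27 * r₀ * r₃ ^ 2
        - 2 * r₂ ^ 3) ^ 2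

/-- `discrForm` of the discriminant of a biquadratic polynomial. -/
def biquadraticDiscr (a b c d e f : ℂ) : ℂ :=
  discrForm (b ^ 2 - 4 * (a * c)) (2 * (b * d) - 4 * (a * e + b * c))
    (d ^ 2 + 2 * (b * e) - 4 * (a * f + b * e + c * c)) (2 * (d * e) - 4 * (b * f + c * e))
    (e ^ 2 - 4 * (c * f))

lemma quarticDiscr_eq (r₄ r₃ r₂ r₁ r₀ : ℂ) :
    quarticDiscr (Polynomial.C r₄ * Polynomial.X ^ 4 + Polynomial.C r₃ * Polynomial.X ^ 3
      + Polynomial.C r₂ * Polynomial.X ^ 2 + Polynomial.C r₁ * Polynomial.X + Polynomial.C r₀) =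
    discrForm r₄ r₃ r₂ r₁ r₀ := by
  simp [quarticDiscr, discrForm, Polynomial.coeff_X, Polynomial.coeff_C]

lemma quarticDiscr_edgeQuartic_squarePoly (a b c d e f : ℂ) :
    quarticDiscr (edgeQuartic (squarePoly a b c d e f)) =
      biquadraticDiscr (b ^ 2 - a * c) (b * d - a * e) (c * d - b * e) (d ^ 2 - a * f)
        (e * d - b * f) (e ^ 2 - c * f) := by
  rw [biquadraticDiscr, ← quarticDiscr_eq]
  congr 1
  rw [edgeQuartic, edgeForm_squarePoly]
  generalize b ^ 2 - a * c = p₁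
  generalize b * d - a * e = p₂
  generalize c * d - b * e = p₃
  generalize d ^ 2 - a * f = p₄
  generalize e * d - b * f = p₅
  generalize e ^ 2 - c * f = p₆
  simp [biquadratic, pderiv_X, MvPolynomial.algebraMap_eq]
  rw [show (Polynomial.C 2 : Polynomial ℂ) = 2 from rfl,
    show (Polynomial.C 4 : Polynomial ℂ) = 4 from rfl]
  ring

lemma isGeneric_squarePoly_iff (a b c d e f : ℂ) :
    IsGeneric (squarePoly a b c d e f) ↔
      biquadraticDiscr (b ^ 2 - a * c) (b * d - a * e) (c * d - b * e) (d ^ 2 - a * f)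
        (e * d - b * f) (e ^ 2 - c * f) ≠ 0 := by
  rw [IsGeneric, quarticDiscr_edgeQuartic_squarePoly]

/-- `discrForm` is an invariant of binary quartic forms, of weight `12`. -/
lemma discrForm_moebius (κ l μ ν r₄ r₃ r₂ r₁ r₀ : ℂ) :
    discrForm
      (r₄ * ν ^ 4 - r₃ * ν ^ 3 * μ + r₂ * ν ^ 2 * μ ^ 2 - r₁ * ν * μ ^ 3 + r₀ * μ ^ 4)
      (-4 * r₄ * ν ^ 3 * l + r₃ * (ν ^ 3 * κ + 3 * ν ^ 2 * l * μ)
        - r₂ * (2 * ν ^ 2 * κ * μ + 2 * ν * l * μ ^ 2) + r₁ * (3 * ν * κ * μ ^ 2 + l * μ ^ 3)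
        - 4 * r₀ * κ * μ ^ 3)
      (6 * r₄ * ν ^ 2 * l ^ 2 - r₃ * (3 * ν ^ 2 * l * κ + 3 * ν * l ^ 2 * μ)
        + r₂ * (ν ^ 2 * κ ^ 2 + 4 * ν * l * κ * μ + l ^ 2 * μ ^ 2)
        - r₁ * (3 * ν * κ ^ 2 * μ + 3 * l * κ * μ ^ 2) + 6 * r₀ * κ ^ 2 * μ ^ 2)
      (-4 * r₄ * ν * l ^ 3 + r₃ * (3 * ν * l ^ 2 * κ + l ^ 3 * μ)
        - r₂ * (2 * ν * l * κ ^ 2 + 2 * l ^ 2 * κ * μ) + r₁ * (ν * κ ^ 3 + 3 * l * κ ^ 2 * μ)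
        - 4 * r₀ * κ ^ 3 * μ)
      (r₄ * l ^ 4 - r₃ * l ^ 3 * κ + r₂ * l ^ 2 * κ ^ 2 - r₁ * l * κ ^ 3 + r₀ * κ ^ 4) =
    (κ * ν - l * μ) ^ 12 * discrForm r₄ r₃ r₂ r₁ r₀ := by
  have hI (x₄ x₃ x₂ x₁ x₀ I J : ℂ) (h : 12 * x₄ * x₀ - 3 * x₃ * x₁ + x₂ ^ 2 = I)
      (h' : 72 * x₄ * x₂ * x₀ + 9 * x₃ * x₂ * x₁ - 27 * x₄ * x₁ ^ 2 - 27 * x₀ * x₃ ^ 2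
        - 2 * x₂ ^ 3 = J) : discrForm x₄ x₃ x₂ x₁ x₀ = 4 * I ^ 3 - J ^ 2 := by
    rw [discrForm, h, h']
  rw [hI _ _ _ _ _ ((κ * ν - l * μ) ^ 4 * (12 * r₄ * r₀ - 3 * r₃ * r₁ + r₂ ^ 2))
    ((κ * ν - l * μ) ^ 6 * (72 * r₄ * r₂ * r₀ + 9 * r₃ * r₂ * r₁ - 27 * r₄ * r₁ ^ 2
      - 27 * r₀ * r₃ ^ 2 - 2 * r₂ ^ 3)) (by ring) (by ring), discrForm]
  ring

lemma discrForm_mul (t r₄ r₃ r₂ r₁ r₀ : ℂ) :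
    discrForm (t * r₄) (t * r₃) (t * r₂) (t * r₁) (t * r₀) =
      t ^ 6 * discrForm r₄ r₃ r₂ r₁ r₀ := by
  simp only [discrForm]
  ring

lemma biquadraticDiscr_mul (t a b c d e f : ℂ) :
    biquadraticDiscr (t * a) (t * b) (t * c) (t * d) (t * e) (t * f) =
      t ^ 12 * biquadraticDiscr a b c d e f := by
  rw [biquadraticDiscr, biquadraticDiscr, show t ^ 12 = (t ^ 2) ^ 6 by ring, ← discrForm_mul]
  congr 1 <;> ring

/-- Eliminating the second variable contributes `det²` to the quartic, hence `det¹²` to its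
discriminant of degree 6; the invariant weight contributes the other `det¹²`. -/
lemma biquadraticDiscr_moebius (κ l μ ν a b c d e f : ℂ) :
    biquadraticDiscr
        (squareForm a b d c e f (ν ^ 2) (-ν * μ) (μ ^ 2) (ν ^ 2) (-ν * μ) (μ ^ 2))
        (squareForm a b d c e f (ν ^ 2) (-ν * μ) (μ ^ 2)
          (-2 * ν * l) (ν * κ + l * μ) (-2 * κ * μ))
        (squareForm a b d c e f (ν ^ 2) (-ν * μ) (μ ^ 2) (l ^ 2) (-l * κ) (κ ^ 2))
        (squareForm a b d c e f (-2 * ν * l) (ν * κ + l * μ) (-2 * κ * μ)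
          (-2 * ν * l) (ν * κ + l * μ) (-2 * κ * μ))
        (squareForm a b d c e f (-2 * ν * l) (ν * κ + l * μ) (-2 * κ * μ)
          (l ^ 2) (-l * κ) (κ ^ 2))
        (squareForm a b d c e f (l ^ 2) (-l * κ) (κ ^ 2) (l ^ 2) (-l * κ) (κ ^ 2)) =
      (κ * ν - l * μ) ^ 24 * biquadraticDiscr a b c d e f := by
  have h := discrForm_moebius κ l μ ν (b ^ 2 - 4 * (a * c)) (2 * (b * d) - 4 * (a * e + b * c))
    (d ^ 2 + 2 * (b * e) - 4 * (a * f + b * e + c * c)) (2 * (d * e) - 4 * (b * f + c * e))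
    (e ^ 2 - 4 * (c * f))
  rw [biquadraticDiscr, biquadraticDiscr,
    show (κ * ν - l * μ) ^ 24 = ((κ * ν - l * μ) ^ 2) ^ 6 * (κ * ν - l * μ) ^ 12 by ring,
    mul_assoc (((κ * ν - l * μ) ^ 2) ^ 6), ← h, ← discrForm_mul]
  simp only [squareForm]
  congr 1 <;> ring

lemma isGeneric_moebiusAct_iff {P : MvPolynomial (Fin 4) ℂ} (hP : IsSquareAffine P)
    {κ l μ ν : ℂ} (h : κ * ν - l * μ ≠ 0) :
    IsGeneric (moebiusAct 1 κ l μ ν P) ↔ IsGeneric P := by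
  obtain ⟨a, b, c, d, e, f, rfl⟩ := exists_eq_squarePoly hP
  rw [moebiusAct_squarePoly h, isGeneric_squarePoly_iff, isGeneric_squarePoly_iff]
  have key := biquadraticDiscr_moebius κ l μ ν (b ^ 2 - a * c) (b * d - a * e) (c * d - b * e)
    (d ^ 2 - a * f) (e * d - b * f) (e ^ 2 - c * f)
  refine Iff.trans (Eq.congr_left ?_).not (mul_ne_zero_iff_left (pow_ne_zero 48 h))
  refine Eq.trans ?_ (congrArg (((κ * ν - l * μ) ^ 2) ^ 12 * ·) key |>.trans (by ring))
  rw [← biquadraticDiscr_mul]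
  congr 1 <;> simp only [squareForm] <;> ring

end PointEq
end

noncomputable section

namespace PointEq

open MvPolynomial

/-! ### Composition of Möbius transformations and the generic orbits -/

lemma C_mul_squarePoly (k a b c d e f : ℂ) :
    C k * squarePoly a b c d e f =
      squarePoly (k * a) (k * b) (k * c) (k * d) (k * e) (k * f) := by
  simp only [squarePoly, C_mul]
  ring

lemma moebiusAct_moebiusAct {P : MvPolynomial (Fin 4) ℂ} (hP : IsSquareAffine P)
    {κ l μ ν κ' l' μ' ν' : ℂ} (h : κ * ν - l * μ ≠ 0) (h' : κ' * ν' - l' * μ' ≠ 0) :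
    moebiusAct 1 κ l μ ν (moebiusAct 1 κ' l' μ' ν' P) =
      moebiusAct 1 (κ * κ' + l * μ') (κ * l' + l * ν') (μ * κ' + ν * μ') (μ * l' + ν * ν') P := by
  have h'' : (κ * κ' + l * μ') * (μ * l' + ν * ν') - (κ * l' + l * ν') * (μ * κ' + ν * μ') ≠ 0 := by
    convert mul_ne_zero h h' using 1
    ring
  obtain ⟨a, b, c, d, e, f, rfl⟩ := exists_eq_squarePoly hP
  rw [moebiusAct_squarePoly h', moebiusAct_squarePoly h, moebiusAct_squarePoly h'']
  congr 1 <;> simp only [squareForm] <;> ring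

lemma moebiusAct_scalar {P : MvPolynomial (Fin 4) ℂ} (hP : IsSquareAffine P) {t : ℂ} (h : t ≠ 0) :
    moebiusAct 1 t 0 0 t P = C (t ^ 4) * P := by
  obtain ⟨a, b, c, d, e, f, rfl⟩ := exists_eq_squarePoly hP
  rw [moebiusAct_squarePoly (by simpa using h), C_mul_squarePoly]
  congr 1 <;> simp only [squareForm] <;> ring

lemma isSquareAffine_moebiusAct {P : MvPolynomial (Fin 4) ℂ} (hP : IsSquareAffine P)
    {κ l μ ν : ℂ} (h : κ * ν - l * μ ≠ 0) : IsSquareAffine (moebiusAct 1 κ l μ ν P) := by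
  obtain ⟨a, b, c, d, e, f, rfl⟩ := exists_eq_squarePoly hP
  rw [moebiusAct_squarePoly h]
  exact isSquareAffine_squarePoly _ _ _ _ _ _

lemma isSquareAffine_ellP (g g₂ g₃ : ℂ) : IsSquareAffine (ellP g g₂ g₃) := by
  rw [ellP_eq]
  exact isSquareAffine_squarePoly _ _ _ _ _ _

/-- `P` is in the orbit of one of the elliptic polynomials. -/
def IsElliptic (P : MvPolynomial (Fin 4) ℂ) : Prop :=
  ∃ (L : PeriodPair) (γ : ℂ), 4 * γ ∉ L.lattice ∧
    ∃ κ l μ ν : ℂ, κ * ν - l * μ ≠ 0 ∧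
      P = moebiusAct 1 κ l μ ν (ellP (L.weierstrassP γ) L.g₂ L.g₃)

lemma IsElliptic.moebiusAct {P : MvPolynomial (Fin 4) ℂ} (hP : IsElliptic P)
    {κ l μ ν : ℂ} (h : κ * ν - l * μ ≠ 0) : IsElliptic (moebiusAct 1 κ l μ ν P) := by
  obtain ⟨L, γ, hγ, κ', l', μ', ν', h', rfl⟩ := hP
  refine ⟨L, γ, hγ, _, _, _, _, ?_, moebiusAct_moebiusAct (isSquareAffine_ellP _ _ _) h h'⟩
  convert mul_ne_zero h h' using 1
  ring

/-- A scalar matrix `t` acts as multiplication by `t⁴`, and every complex number is a fourth power.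
-/
lemma isElliptic_C_mul {P : MvPolynomial (Fin 4) ℂ} (hP : IsSquareAffine P) (h : IsElliptic P)
    {s : ℂ} (hs : s ≠ 0) : IsElliptic (C s * P) := by
  obtain ⟨t, rfl⟩ := IsAlgClosed.exists_pow_nat_eq s (n := 4) (by norm_num)
  have ht : t ≠ 0 := by
    rintro rfl
    simp at hs
  rw [← moebiusAct_scalar hP ht]
  exact h.moebiusAct (by simpa using ht)

lemma isElliptic_of_moebiusAct {P : MvPolynomial (Fin 4) ℂ} (hP : IsSquareAffine P)
    {κ l μ ν : ℂ} (h : κ * ν - l * μ ≠ 0) (hM : IsElliptic (moebiusAct 1 κ l μ ν P)) :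
    IsElliptic P := by
  have h' : ν * κ - -l * -μ ≠ 0 := by
    convert h using 1
    ring
  have h1 := hM.moebiusAct h'
  rw [moebiusAct_moebiusAct hP h' h, show ν * κ + -l * μ = κ * ν - l * μ by ring,
    show ν * l + -l * ν = 0 by ring, show -μ * κ + κ * μ = 0 by ring,
    show -μ * l + κ * ν = κ * ν - l * μ by ring, moebiusAct_scalar hP h] at h1
  have h2 : C (((κ * ν - l * μ) ^ 4)⁻¹) * (C ((κ * ν - l * μ) ^ 4) * P) = P := by
    rw [← mul_assoc, ← C_mul, inv_mul_cancel₀ (pow_ne_zero 4 h), C_1, one_mul]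
  rw [← h2]
  refine isElliptic_C_mul ?_ h1 (inv_ne_zero (pow_ne_zero 4 h))
  rw [← moebiusAct_scalar hP h]
  exact isSquareAffine_moebiusAct hP (by simpa using h)

lemma discrForm_weierstrass (k g₂ g₃ : ℂ) :
    discrForm 0 (4 * k) 0 (-(k * g₂)) (-(k * g₃)) = 6912 * k ^ 6 * (g₂ ^ 3 - 27 * g₃ ^ 2) := by
  simp only [discrForm]
  ring

/-- The discriminant of `ellH` in one variable is `℘'(γ)²(4u³ - g₂u - g₃)`, whose zeros are infinity
and the three distinct values of `℘` at the half periods. -/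
lemma isGeneric_ellP {L : PeriodPair} {γ : ℂ} (hγ : 4 * γ ∉ L.lattice) :
    IsGeneric (ellP (L.weierstrassP γ) L.g₂ L.g₃) := by
  have hq := ellLead_ne_zero hγ
  have hG := (derivWeierstrassP_ne_zero_of_four_mul hγ).1
  have hG2 := L.derivWeierstrassP_sq γ (notMem_of_four_mul hγ).1
  rw [ellP_eq, isGeneric_squarePoly_iff]
  have hd : biquadraticDiscr 1 (-2 * L.weierstrassP γ) (L.weierstrassP γ ^ 2)
      (L.g₂ / 2 - 2 * L.weierstrassP γ ^ 2) (L.weierstrassP γ * L.g₂ / 2 + L.g₃)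
      (L.g₂ ^ 2 / 16 + L.weierstrassP γ * L.g₃) =
      6912 * (L.derivWeierstrassP γ ^ 2) ^ 6 * (L.g₂ ^ 3 - 27 * L.g₃ ^ 2) := by
    rw [← discrForm_weierstrass, hG2, biquadraticDiscr]
    congr 1 <;> ring
  have h := mul_ne_zero (pow_ne_zero 12 hq) (hd.trans_ne (mul_ne_zero
    (mul_ne_zero (by norm_num) (pow_ne_zero 6 (pow_ne_zero 2 hG))) (discriminant_ne_zero L)))
  rw [← biquadraticDiscr_mul] at h
  refine Eq.trans_ne ?_ h
  congr 1 <;> simp only [ellLead] <;> ring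

/-- A polynomial whose edge form is proportional to `ellH` is proportional to `ellP`. -/
lemma exists_eq_C_mul_ellP {a b c d e f g g₂ g₃ q : ℂ} (hq : q ≠ 0)
    (hk : 4 * g ^ 3 - g₂ * g - g₃ ≠ 0) (h₁ : b ^ 2 - a * c = q) (h₂ : b * d - a * e = q * (-2 * g))
    (h₃ : c * d - b * e = q * g ^ 2) (h₄ : d ^ 2 - a * f = q * (g₂ / 2 - 2 * g ^ 2))
    (h₅ : e * d - b * f = q * (g * g₂ / 2 + g₃)) (h₆ : e ^ 2 - c * f = q * (g₂ ^ 2 / 16 + g * g₃)) :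
    ∃ s : ℂ, s ≠ 0 ∧ squarePoly a b c d e f = C s * ellP g g₂ g₃ ∧ q = s ^ 2 * ellLead g g₂ g₃ := by
  set A := 12 * g ^ 2 - g₂ with hA
  set B := -(4 * g ^ 3 + g₂ * g + 2 * g₃) with hB
  -- `D` is the determinant of the symmetric matrix of `P`. The next six identities are the entries
  -- of `adj(adj M) = det M · M`, with the prescribed minors inserted.
  obtain ⟨D, hD⟩ : ∃ D, D = a * (c * f - e ^ 2) - b * (b * f - d * e) + d * (b * e - c * d) :=
    ⟨_, rfl⟩
  have ea : D * a = -(q ^ 2 / 2) * A := by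
    rw [show D * a = (d ^ 2 - a * f) * (b ^ 2 - a * c) - (b * d - a * e) ^ 2 by rw [hD]; ring,
      h₁, h₂, h₄, hA]
    ring
  have eb : D * b = -(q ^ 2 / 2) * B := by
    rw [show D * b = (e * d - b * f) * (b ^ 2 - a * c) - (b * d - a * e) * (c * d - b * e) by
      rw [hD]; ring, h₁, h₂, h₃, h₅, hB]
    ring
  have ec : D * c = -(q ^ 2 / 2) * (2 * (g ^ 4 - g₃ * g - g₂ ^ 2 / 16)) := by
    rw [show D * c = (e ^ 2 - c * f) * (b ^ 2 - a * c) - (c * d - b * e) ^ 2 by rw [hD]; ring,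
      h₁, h₃, h₆]
    ring
  have ed : D * d = -(q ^ 2 / 2) * (-(g * (4 * g ^ 3 - 3 * g₂ * g - 4 * g₃))) := by
    rw [show D * d = (e * d - b * f) * (b * d - a * e) - (d ^ 2 - a * f) * (c * d - b * e) by
      rw [hD]; ring, h₂, h₃, h₄, h₅]
    ring
  have ee : D * e = -(q ^ 2 / 2) * (g * (g₂ * g ^ 2 + 6 * g₃ * g + g₂ ^ 2 / 4)) := by
    rw [show D * e = (e ^ 2 - c * f) * (b * d - a * e) - (e * d - b * f) * (c * d - b * e) by
      rw [hD]; ring, h₂, h₃, h₅, h₆]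
    ring
  have ef : D * f = -(q ^ 2 / 2) * (A * (g₂ ^ 2 / 16) + (4 * g ^ 3 + g₂ * g + 2 * g₃) * g₃) := by
    rw [show D * f = (e ^ 2 - c * f) * (d ^ 2 - a * f) - (e * d - b * f) ^ 2 by rw [hD]; ring,
      h₄, h₅, h₆, hA]
    ring
  have hq2 : -(q ^ 2 / 2) ≠ 0 := by simpa using hq
  have hD0 : D ≠ 0 := by
    intro h0
    rw [h0, zero_mul, eq_comm, mul_eq_zero, or_iff_right hq2] at ea eb
    exact hk (by linear_combination (norm := (rw [hA, hB]; ring)) eb / 2 + g / 2 * ea)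
  obtain ⟨s, hs⟩ : ∃ s, s = -(q ^ 2 / 2) / D := ⟨_, rfl⟩
  have key {x y : ℂ} (h : D * x = -(q ^ 2 / 2) * y) : x = s * y := by
    rw [hs, div_mul_eq_mul_div, eq_div_iff hD0, mul_comm, h]
  refine ⟨s, hs ▸ div_ne_zero hq2 hD0, ?_, ?_⟩
  · rw [ellP_eq, C_mul_squarePoly, ← key ea, ← key eb, ← key ec, ← key ed, ← key ee, ← key ef]
  · rw [← h₁, key ea, key eb, key ec, ellLead, hA, hB]
    ring

lemma isElliptic_of_edgeForm {a b c d e f g g₂ g₃ q : ℂ} (hq : q ≠ 0)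
    (hΔ : g₂ ^ 3 - 27 * g₃ ^ 2 ≠ 0)
    (hk : 4 * g ^ 3 - g₂ * g - g₃ ≠ 0) (h₁ : b ^ 2 - a * c = q) (h₂ : b * d - a * e = q * (-2 * g))
    (h₃ : c * d - b * e = q * g ^ 2) (h₄ : d ^ 2 - a * f = q * (g₂ / 2 - 2 * g ^ 2))
    (h₅ : e * d - b * f = q * (g * g₂ / 2 + g₃)) (h₆ : e ^ 2 - c * f = q * (g₂ ^ 2 / 16 + g * g₃)) :
    IsElliptic (squarePoly a b c d e f) := by
  obtain ⟨L, rfl, rfl⟩ := exists_periodPair hΔ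
  obtain ⟨γ, hγ, rfl⟩ := exists_weierstrassP_eq L g
  obtain ⟨s, hs, hP, hlead⟩ := exists_eq_C_mul_ellP hq hk h₁ h₂ h₃ h₄ h₅ h₆
  rw [← L.derivWeierstrassP_sq γ hγ] at hk
  have hγ₂ := (derivWeierstrassP_ne_zero_iff L hγ).1 (pow_ne_zero_iff two_ne_zero |>.1 hk)
  rw [hlead, ellLead_weierstrassP hγ hγ₂] at hq
  have hγ₄ := (derivWeierstrassP_ne_zero_iff L hγ₂).1
    (right_ne_zero_of_mul (right_ne_zero_of_mul hq))
  rw [← mul_assoc, show (2 : ℂ) * 2 = 4 by norm_num] at hγ₄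
  rw [hP]
  refine isElliptic_C_mul (isSquareAffine_ellP _ _ _) ⟨L, γ, hγ₄, 1, 0, 0, 1, by simp, ?_⟩ hs
  rw [moebiusAct_scalar (isSquareAffine_ellP _ _ _) one_ne_zero]
  simp

/-- The case in which the quartic is in the Weierstrass normal form. -/
lemma isElliptic_of_normal {a b c d e f p₁ p₂ p₃ p₄ p₅ p₆ : ℂ} (h₁ : b ^ 2 - a * c = p₁)
    (h₂ : b * d - a * e = p₂) (h₃ : c * d - b * e = p₃) (h₄ : d ^ 2 - a * f = p₄)
    (h₅ : e * d - b * f = p₅) (h₆ : e ^ 2 - c * f = p₆)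
    (hr₄ : p₂ ^ 2 - 4 * (p₁ * p₃) = 0)
    (hr₂ : p₄ ^ 2 + 2 * (p₂ * p₅) - 4 * (p₁ * p₆ + p₂ * p₅ + p₃ * p₃) = 0)
    (hΔ : biquadraticDiscr p₁ p₂ p₃ p₄ p₅ p₆ ≠ 0) : IsElliptic (squarePoly a b c d e f) := by
  rw [biquadraticDiscr, hr₄, hr₂] at hΔ
  have hr₃ : 2 * (p₂ * p₄) - 4 * (p₁ * p₅ + p₂ * p₃) ≠ 0 := by
    intro h0
    simp [h0, discrForm] at hΔ
  -- Otherwise `r₄ = 0` gives `p₂ = 0` and then `r₃ = 0`, so the quartic would have a multiple root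
  -- at infinity.
  have hp₁ : p₁ ≠ 0 := by
    rintro h0
    have : p₂ = 0 := by simpa [h0] using hr₄
    simp [h0, this] at hr₃
  obtain ⟨g, rfl⟩ : ∃ g, p₂ = p₁ * (-2 * g) := ⟨-p₂ / (2 * p₁), by field_simp⟩
  obtain rfl : p₃ = p₁ * g ^ 2 :=
    mul_left_cancel₀ (mul_ne_zero (show (4 : ℂ) ≠ 0 by norm_num) hp₁) (by linear_combination -hr₄)
  obtain ⟨m, rfl⟩ : ∃ m, p₄ = p₁ * m := ⟨p₄ / p₁, by field_simp⟩
  obtain ⟨n, rfl⟩ : ∃ n, p₅ = p₁ * n := ⟨p₅ / p₁, by field_simp⟩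
  obtain rfl : p₆ = p₁ * ((m ^ 2 + 4 * g * n - 4 * g ^ 4) / 4) :=
    mul_left_cancel₀ (mul_ne_zero (show (4 : ℂ) ≠ 0 by norm_num) hp₁) (by linear_combination -hr₂)
  have hk : 2 * g ^ 3 - n - g * m ≠ 0 := by
    intro h0
    apply hr₃
    linear_combination 4 * p₁ ^ 2 * h0
  -- The values of `g₂` and `g₃` solve `m = g₂/2 - 2g²` and `n = g g₂/2 + g₃`; the coefficient `p₆`
  -- then has its required value because `r₂ = 0`.
  have hd := discrForm_weierstrass (p₁ ^ 2 * (2 * g ^ 3 - n - g * m)) (2 * m + 4 * g ^ 2)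
    (n - 2 * g ^ 3 - g * m)
  refine isElliptic_of_edgeForm (g := g) (g₂ := 2 * m + 4 * g ^ 2) (g₃ := n - 2 * g ^ 3 - g * m)
    hp₁ ?_ ?_ h₁ h₂ h₃ (h₄.trans (by ring)) (h₅.trans (by ring)) (h₆.trans (by ring))
  · intro h0
    rw [h0, mul_zero] at hd
    refine hΔ (Eq.trans ?_ hd)
    congr 1 <;> ring
  · convert hk using 1
    ring

lemma isElliptic_of_cubic {a b c d e f : ℂ}
    (hr₄ : (b * d - a * e) ^ 2 - 4 * ((b ^ 2 - a * c) * (c * d - b * e)) = 0)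
    (hΔ : IsGeneric (squarePoly a b c d e f)) : IsElliptic (squarePoly a b c d e f) := by
  have hgen := hΔ
  rw [isGeneric_squarePoly_iff, biquadraticDiscr, hr₄] at hΔ
  obtain ⟨r₃, h3⟩ : ∃ r₃, r₃ = 2 * ((b * d - a * e) * (d ^ 2 - a * f)) -
    4 * ((b ^ 2 - a * c) * (e * d - b * f) + (b * d - a * e) * (c * d - b * e)) := ⟨_, rfl⟩
  obtain ⟨r₂, h2⟩ : ∃ r₂, r₂ = (d ^ 2 - a * f) ^ 2 + 2 * ((b * d - a * e) * (e * d - b * f)) -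
    4 * ((b ^ 2 - a * c) * (e ^ 2 - c * f) + (b * d - a * e) * (e * d - b * f) +
      (c * d - b * e) * (c * d - b * e)) := ⟨_, rfl⟩
  rw [← h3, ← h2] at hΔ
  have hr₃ : r₃ ≠ 0 := by
    rintro h0
    simp [h0, discrForm] at hΔ
    apply hΔ
    ring
  -- The translation `u ↦ u + τ` changes the quadratic coefficient of the cubic `r` to `r₂ - 3τr₃`.
  obtain ⟨τ, hτ⟩ : ∃ τ, r₂ = 3 * τ * r₃ := ⟨r₂ / (3 * r₃), by field_simp⟩
  have hdet : (1 : ℂ) * 1 - τ * 0 ≠ 0 := by simp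
  have hsq := isSquareAffine_squarePoly a b c d e f
  refine isElliptic_of_moebiusAct hsq hdet ?_
  rw [← isGeneric_moebiusAct_iff hsq hdet] at hgen
  rw [moebiusAct_squarePoly hdet] at hgen ⊢
  rw [isGeneric_squarePoly_iff] at hgen
  refine isElliptic_of_normal rfl rfl rfl rfl rfl rfl ?_ ?_ hgen
  · simp only [squareForm]
    linear_combination hr₄
  · simp only [squareForm]
    linear_combination hτ - h2 + 3 * τ * h3 + 6 * τ ^ 2 * hr₄

theorem isElliptic_of_isGeneric {P : MvPolynomial (Fin 4) ℂ} (hP : IsSquareAffine P)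
    (h : IsGeneric P) : IsElliptic P := by
  obtain ⟨a, b, c, d, e, f, rfl⟩ := exists_eq_squarePoly hP
  obtain ⟨r₄, h4⟩ : ∃ r₄, r₄ = (b * d - a * e) ^ 2 - 4 * ((b ^ 2 - a * c) * (c * d - b * e)) :=
    ⟨_, rfl⟩
  by_cases hr₄ : r₄ = 0
  · exact isElliptic_of_cubic (h4.symm.trans hr₄) h
  obtain ⟨r₃, h3⟩ : ∃ r₃, r₃ = 2 * ((b * d - a * e) * (d ^ 2 - a * f)) -
    4 * ((b ^ 2 - a * c) * (e * d - b * f) + (b * d - a * e) * (c * d - b * e)) := ⟨_, rfl⟩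
  obtain ⟨r₂, h2⟩ : ∃ r₂, r₂ = (d ^ 2 - a * f) ^ 2 + 2 * ((b * d - a * e) * (e * d - b * f)) -
    4 * ((b ^ 2 - a * c) * (e ^ 2 - c * f) + (b * d - a * e) * (e * d - b * f) +
      (c * d - b * e) * (c * d - b * e)) := ⟨_, rfl⟩
  obtain ⟨r₁, h1⟩ : ∃ r₁, r₁ = 2 * ((d ^ 2 - a * f) * (e * d - b * f)) -
    4 * ((b * d - a * e) * (e ^ 2 - c * f) + (c * d - b * e) * (e * d - b * f)) := ⟨_, rfl⟩
  obtain ⟨r₀, h0⟩ : ∃ r₀, r₀ = (e * d - b * f) ^ 2 - 4 * ((c * d - b * e) * (e ^ 2 - c * f)) :=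
    ⟨_, rfl⟩
  obtain ⟨ρ, hρ⟩ : ∃ ρ, r₄ * ρ ^ 4 + r₃ * ρ ^ 3 + r₂ * ρ ^ 2 + r₁ * ρ + r₀ = 0 := by
    have hdeg : (Polynomial.C r₄ * Polynomial.X ^ 4 + Polynomial.C r₃ * Polynomial.X ^ 3
      + Polynomial.C r₂ * Polynomial.X ^ 2 + Polynomial.C r₁ * Polynomial.X
      + Polynomial.C r₀).degree ≠ 0 := by
      have : (Polynomial.C r₄ * Polynomial.X ^ 4 + Polynomial.C r₃ * Polynomial.X ^ 3
        + Polynomial.C r₂ * Polynomial.X ^ 2 + Polynomial.C r₁ * Polynomial.X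
        + Polynomial.C r₀).degree = 4 := by compute_degree!
      rw [this]
      norm_num
    obtain ⟨ρ, hρ⟩ := IsAlgClosed.exists_root _ hdeg
    exact ⟨ρ, by simpa using hρ⟩
  -- The transformation `u ↦ 1/(u - ρ)` sends the root `ρ` to infinity, so the transformed quartic
  -- has no term of degree 4.
  have hdet : (0 : ℂ) * -ρ - 1 * 1 ≠ 0 := by simp
  refine isElliptic_of_moebiusAct hP hdet ?_
  rw [← isGeneric_moebiusAct_iff hP hdet] at h
  rw [moebiusAct_squarePoly hdet] at h ⊢
  refine isElliptic_of_cubic ?_ h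
  simp only [squareForm]
  linear_combination hρ - ρ ^ 4 * h4 - ρ ^ 3 * h3 - ρ ^ 2 * h2 - ρ * h1 - h0

theorem isGeneric_iff_isElliptic {P : MvPolynomial (Fin 4) ℂ} (hP : IsSquareAffine P) :
    IsGeneric P ↔ IsElliptic P := by
  refine ⟨isElliptic_of_isGeneric hP, ?_⟩
  rintro ⟨L, γ, hγ, κ, l, μ, ν, h, rfl⟩
  exact (isGeneric_moebiusAct_iff (isSquareAffine_ellP _ _ _) h).2 (isGeneric_ellP hγ)

end PointEq
end

theorem mainTheorem1 :
    -- elliptic case: `s = σ`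
    (∀ (L : PeriodPair) (γ : ℂ), 4 * γ ∉ L.lattice →
      PointEq.InFamily (PointEq.ellP (L.weierstrassP γ) L.g₂ L.g₃)
        (PointEq.ellH (L.weierstrassP γ) L.g₂ L.g₃) ∧
      PointEq.PointEquivalentVia L.weierstrassP
        (4 * L.derivWeierstrassP γ ^ 2 * L.derivWeierstrassP (2 * γ))
        (PointEq.sigmaLattice (PointEq.weierstrassSigma L) γ)
        (PointEq.rationalLattice (PointEq.ellP (L.weierstrassP γ) L.g₂ L.g₃)
          (PointEq.ellH (L.weierstrassP γ) L.g₂ L.g₃))) ∧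
    -- trigonometric case: `s = sinh`
    (∀ γ : ℂ, Complex.sinh (4 * γ) ≠ 0 →
      PointEq.InFamily (PointEq.trigP (Complex.exp (2 * γ)))
        (PointEq.trigH (Complex.exp (2 * γ))) ∧
      PointEq.PointEquivalentVia (fun u => Complex.cosh (2 * u)) (-1 / Complex.sinh (4 * γ))
        (PointEq.sigmaLattice Complex.sinh γ)
        (PointEq.rationalLattice (PointEq.trigP (Complex.exp (2 * γ)))
          (PointEq.trigH (Complex.exp (2 * γ))))) ∧
    -- rational case: `s(x) = x`
    (∀ γ : ℂ, γ ≠ 0 →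
      PointEq.InFamily (PointEq.ratP γ) (PointEq.ratH γ) ∧
      PointEq.PointEquivalentVia (fun u => u ^ 2) (-1 / (4 * γ))
        (PointEq.sigmaLattice (fun x => x) γ)
        (PointEq.rationalLattice (PointEq.ratP γ) (PointEq.ratH γ))) ∧
    -- invariance of the family under the Möbius transformations
    (∀ (P : MvPolynomial (Fin 4) ℂ) (H : MvPolynomial (Fin 2) ℂ), PointEq.InFamily P H →
      ∀ κ l μ ν : ℂ, κ * ν - l * μ ≠ 0 →
        PointEq.InFamily (PointEq.moebiusAct 1 κ l μ ν P) (PointEq.moebiusAct 2 κ l μ ν H) ∧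
        PointEq.PointEquivalentVia (PointEq.moebius κ l μ ν) 1
          (PointEq.rationalLattice P H)
          (PointEq.rationalLattice (PointEq.moebiusAct 1 κ l μ ν P)
            (PointEq.moebiusAct 2 κ l μ ν H))) ∧
    -- the elliptic polynomials are, up to Möbius transformations, exactly the generic ones
    (∀ P : MvPolynomial (Fin 4) ℂ, PointEq.IsSquareAffine P →
      (PointEq.IsGeneric P ↔
        ∃ (L : PeriodPair) (γ : ℂ), 4 * γ ∉ L.lattice ∧
          ∃ κ l μ ν : ℂ, κ * ν - l * μ ≠ 0 ∧
            P = PointEq.moebiusAct 1 κ l μ ν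
              (PointEq.ellP (L.weierstrassP γ) L.g₂ L.g₃))) := by
  refine ⟨fun L γ hγ => ⟨PointEq.inFamily_ell (PointEq.ellLead_ne_zero hγ),
      PointEq.pointEquivalentVia_ell hγ⟩,
    fun γ hγ => ⟨PointEq.inFamily_trig (Complex.exp_ne_zero _), PointEq.pointEquivalentVia_trig hγ⟩,
    fun γ hγ => ⟨PointEq.inFamily_rat γ, PointEq.pointEquivalentVia_rat hγ⟩,
    fun P H hPH κ l μ ν h => ⟨PointEq.inFamily_moebiusAct hPH h,
      PointEq.pointEquivalentVia_moebius hPH h⟩,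
    fun P hP => PointEq.isGeneric_iff_isElliptic hP⟩
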